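/- **Setting.** For each $n\in\mathbb N$ let $p=p_n$, let $\beta^o=\beta^o_n\in\mathbb R^p$, let $\lambda_0=\lambda_{0,n}\ge 0$ be a baseline hazard, and let $(\tilde T,U,\mathcal Z)$, $\mathcal Z=\{Z(t):t\in\mathcal T\}$, be a generic triple of non-negative failure and censoring times and a jointly measurable (e.g. predictable) $\mathbb R^p$-valued covariate process, whose law may depend on $n$. Put $T=\min(\tilde T,U)$, $\delta=\mathbf 1_{\{\tilde T\le U\}}$, $Y(t)=\mathbf 1_{\{T\ge t\}}$, $N(t)=\mathbf 1_{\{T\le t,\delta=1\}}$, $t_+=\inf\{t\ge0:\mathbb P(T\le t)=1\}$, and $\mathcal T=[0,t_+]$ if $t_+<\infty$, $\mathcal T=[0,\infty)$ otherwise. Given $\mathcal Z$, $\tilde T$ and $U$ are conditionally independent, and $\tilde T$ has conditional hazard $\lambda_0(t)\exp\{\beta^{o\top}Z(t)\}$, i.e. $\mathbb P(\tilde T>t\mid\mathcal Z)=\exp\{-\int_0^t\lambda_0(s)e^{\beta^{o\top}Z(s)}ds\}$ for $0\le t<t_+$. We observe $n$ independent copies $(T_i,\delta_i,\mathcal Z_i)$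 of $(T,\delta,\mathcal Z)$, with associated $Y_i,N_i$. Write $\tilde w_i(s,\beta)=Y_i(s)e^{\beta^\top Z_i(s)}$, $w_i=\tilde w_i/\sum_j\tilde w_j$ (with $0/0=0$), $\bar Z(s,\beta)=\sum_i Z_i(s)w_i(s,\beta)$, and let $$\ell(\beta)=\frac1n\sum_{i=1}^n\int_{\mathcal T}\Bigl(\beta^\top Z_i(s)-\log\sum_{j=1}^n\tilde w_j(s,\beta)\Bigr)dN_i(s)$$ be the log-partial likelihood, with gradient $\dot\ell(\beta)=\frac1n\sum_i\int\{Z_i(s)-\bar Z(s,\beta)\}\,dN_i(s)$ and Hessian $\ddot\ell$. Let $$\mu(t)=\frac{\mathbb E\{Z(t)Y(t)e^{\beta^{o\top}Z(t)}\}}{\mathbb E\{Y(t)e^{\beta^{o\top}Z(t)}\}},\quad \Sigma=\mathbb E\int_{\mathcal T}\{Z(s)-\mu(s)\}^{\otimes2}dN(s),\quad \widehat{\mathcal V}(\beta)=\frac1n\sum_{i=1}^n\int_{\mathcal T}\{Z_i(s)-\bar Z(s,\beta)\}^{\otimes2}dN_i(s),$$ and assume that $\Sigma$ is invertible. For a matrix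 $A$, let $\|A\|_{\mathrm{op},1}=\sup_{v\ne0}\|Av\|_1/\|v\|_1$. Let $\mathcal S=\{j:\beta^o_j\ne0\}$, $\mathcal N=\mathcal S^c$, $d_o=|\mathcal S|$, $r_j=|\{i:(\Sigma^{-1})_{ij}\ne0\}|$. For $\lambda>0$, $\hat\beta$ is any minimiser over $\beta\in\mathbb R^p$ of $-\ell(\beta)+\lambda\|\beta\|_1$. For $\lambda_n>0$, $\hat\Theta$ is any $p\times p$ matrix whose $j$th row, for each $j$, has minimal $\ell_1$ norm among all $b\in\mathbb R^p$ with $\|\widehat{\mathcal V}(\hat\beta)b-e_j\|_\infty\le\lambda_n$, whenever such $b$ exist (it is arbitrary otherwise). **Assumptions.** There are constants $K_Z,L,C,B,\delta_0>0$, not depending on $n$, such that: * (A1) $\mathbb P(\|Z(t)\|_\infty\le K_Z)=1$ for all $t\in\mathcal T$, and almost surely $\|Z(s)-Z(t)\|_\infty\le L|s-t|$ for all $s,t\in\mathcal T$; * (A2)(a) $T$ has a Lebesgue density bounded by $C$; * $\|\beta^o\|_1\le B$; * (A3)(b) $d_o=o(n^{1/2}/\log^{1/2}(np))$; and, along those $n$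 (if there are infinitely many) for which $\beta^o=0$, $p=o(e^{n^a})$ for every $a>0$; * (A4)(a) $1/\kappa=O_p(1)$, where $$\kappa=\inf\Bigl\{\frac{d_o^{1/2}\{-v^\top\ddot\ell(\beta^o)v\}^{1/2}}{\|v_{\mathcal S}\|_1}: v\in\mathbb R^p\setminus\{0\},\ \|v_{\mathcal N}\|_1\le2\|v_{\mathcal S}\|_1\Bigr\}$$ ($\inf\emptyset=\infty$); * (A4)(c) $\|\Sigma^{-1}\|_{\mathrm{op},1}^2\max\bigl\{\frac{d_o\log(np)}{n^{1/2}},n^{-(1/3-\delta_0)}\bigr\}\max_jr_j=o\bigl(\log^{-1/2}(np)\bigr)$. **Proposition 2.** For every $K_Z>0$ there is a constant $A_0>0$, depending only on $K_Z$, such that the following holds. Under the above assumptions, let $\lambda\asymp n^{-1/2}\log^{1/2}(np)$ with $\lambda\ge A_0n^{-1/2}\log^{1/2}(np)$ for all large $n$, and let $$\lambda_n\asymp\max\Bigl(\|\Sigma^{-1}\|_{\mathrm{op},1}\frac{d_o\log(np)}{n^{1/2}},\ \|\Sigma^{-1}\|_{\mathrm{op},1}n^{-(1/3-\delta_0)}\Bigr).$$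 Then for every sequence $c=c_n\in\mathbb R^p$ with $\|c\|_1=1$, $$c^\top(\hat\Theta-\Sigma^{-1})\dot\ell(\beta^o)=o_p(n^{-1/2}).$$ -/

import Mathlib

open MeasureTheory Filter Topology Asymptotics Matrix

noncomputable section

namespace Cox

/-- The `ℓ₁` norm of a vector. -/
def l1 {p : ℕ} (v : Fin p → ℝ) : ℝ := ∑ j, |v j|

/-- The operator `ℓ₁` norm `sup_{v ≠ 0} ‖A v‖₁ / ‖v‖₁`. -/
def opOne {p : ℕ} (A : Matrix (Fin p) (Fin p) ℝ) : ℝ :=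
  ⨆ v : {v : Fin p → ℝ // v ≠ 0}, l1 (A *ᵥ v.1) / l1 v.1

/-- The largest number of non-zero entries in a column. -/
def maxColSupport {p : ℕ} (A : Matrix (Fin p) (Fin p) ℝ) : ℕ :=
  Finset.univ.sup fun j => {i : Fin p | A i j ≠ 0}.ncard

/-- The number of non-zero coordinates. -/
def sparsity {p : ℕ} (β : Fin p → ℝ) : ℕ := {j : Fin p | β j ≠ 0}.ncard

/-- A failure time, a censoring time and a `p`-variate covariate process on a sample space `Ω`.
The covariate process is used at times of the time index set only. -/
structure Triple (Ω : Type*) (p : ℕ) where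
  /-- The failure time. -/
  failure : Ω → ℝ
  /-- The censoring time. -/
  censor : Ω → ℝ
  /-- The covariate process. -/
  covariate : ℝ → Ω → Fin p → ℝ

namespace Triple

variable {Ω : Type*} {p : ℕ}

/-- The observed (possibly censored) time. -/
def time (X : Triple Ω p) (ω : Ω) : ℝ := min (X.failure ω) (X.censor ω)

/-- The indicator that failure is observed. -/
def event (X : Triple Ω p) (ω : Ω) : ℝ := if X.failure ω ≤ X.censor ω then 1 else 0

/-- The at-risk indicator. -/
def atRisk (X : Triple Ω p) (t : ℝ) (ω : Ω) : ℝ := if t ≤ X.time ω then 1 else 0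

/-- The unnormalised weight `Y(t) exp(βᵀ Z(t))`. -/
def weight (X : Triple Ω p) (t : ℝ) (β : Fin p → ℝ) (ω : Ω) : ℝ :=
  X.atRisk t ω * Real.exp (β ⬝ᵥ X.covariate t ω)

/-- The integral `∫ g dN` against the counting process `N(t) = 1{T ≤ t, δ = 1}`, which has a
single jump, of size one, at `T` if failure is observed and no jump otherwise. -/
def integralN (X : Triple Ω p) (g : ℝ → ℝ) (ω : Ω) : ℝ := X.event ω * g (X.time ω)

variable [MeasurableSpace Ω]

/-- The upper limit `inf {t ≥ 0 : F_T(t) = 1}` of the support of the observed time, `⊤` if there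
is no such `t`. -/
def tPlus (X : Triple Ω p) (P : Measure Ω) : EReal :=
  sInf ((fun t : ℝ => (t : EReal)) '' {t : ℝ | 0 ≤ t ∧ P {ω | X.time ω ≤ t} = 1})

/-- The time index set: `[0, t₊]` if `t₊ < ∞` and `[0, ∞)` otherwise. -/
def timeSet (X : Triple Ω p) (P : Measure Ω) : Set ℝ :=
  {t : ℝ | 0 ≤ t ∧ (t : EReal) ≤ X.tPlus P}

/-- The σ-algebra generated by the whole covariate process on the time index set. -/
abbrev covariateSigma (X : Triple Ω p) (P : Measure Ω) : MeasurableSpace Ω :=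
  ⨆ t ∈ X.timeSet P, MeasurableSpace.comap (X.covariate t) inferInstance

/-- The Cox proportional hazards model with regression vector `β` and baseline hazard `haz`:
failure and censoring times are conditionally independent given the covariate process, and the
conditional hazard of the failure time given the covariate process is
`haz t * exp (βᵀ Z(t))` for `0 ≤ t < t₊`, expressed through the conditional survival function. -/
structure IsCoxModel (X : Triple Ω p) (P : Measure Ω) (β : Fin p → ℝ) (haz : ℝ → ℝ) :
    Prop where
  measurable_failure : Measurable X.failure
  measurable_censor : Measurable X.censor
  /-- Joint measurability; every predictable process has it. -/
  measurable_covariate : Measurable fun q : ℝ × Ω => X.covariate q.1 q.2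
  failure_nonneg : ∀ ω, 0 ≤ X.failure ω
  censor_nonneg : ∀ ω, 0 ≤ X.censor ω
  condIndep : ∀ s u : Set ℝ, MeasurableSet s → MeasurableSet u →
    P[(X.failure ⁻¹' s ∩ X.censor ⁻¹' u).indicator (fun _ => (1 : ℝ)) | X.covariateSigma P]
      =ᵐ[P] fun ω =>
        (P[(X.failure ⁻¹' s).indicator (fun _ => (1 : ℝ)) | X.covariateSigma P]) ω *
        (P[(X.censor ⁻¹' u).indicator (fun _ => (1 : ℝ)) | X.covariateSigma P]) ω
  haz_nonneg : ∀ t, 0 ≤ haz t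
  haz_integrable : ∀ t : ℝ, 0 ≤ t → (t : EReal) < X.tPlus P →
    IntegrableOn haz (Set.Icc 0 t) volume
  hazard : ∀ t : ℝ, 0 ≤ t → (t : EReal) < X.tPlus P →
    P[{ω | t < X.failure ω}.indicator (fun _ => (1 : ℝ)) | X.covariateSigma P]
      =ᵐ[P] fun ω =>
        Real.exp (-∫ s in (0 : ℝ)..t, haz s * Real.exp (β ⬝ᵥ X.covariate s ω))

/-- The covariates are almost surely bounded by `K` in sup-norm at every time. -/
def BoundedCovariates (X : Triple Ω p) (P : Measure Ω) (K : ℝ) : Prop :=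
  ∀ t ∈ X.timeSet P, ∀ᵐ ω ∂P, ∀ j, |X.covariate t ω j| ≤ K

/-- Almost surely, the covariate paths are `L`-Lipschitz for the sup-norm. -/
def LipschitzCovariates (X : Triple Ω p) (P : Measure Ω) (L : ℝ) : Prop :=
  ∀ᵐ ω ∂P, ∀ s ∈ X.timeSet P, ∀ t ∈ X.timeSet P, ∀ j,
    |X.covariate s ω j - X.covariate t ω j| ≤ L * |s - t|

/-- The observed time has a Lebesgue density that is bounded by `C`. -/
def BoundedDensity (X : Triple Ω p) (P : Measure Ω) (C : ℝ) : Prop :=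
  ∃ f : ℝ → ℝ, Measurable f ∧ (∀ t, 0 ≤ f t ∧ f t ≤ C) ∧
    P.map X.time = volume.withDensity fun t => ENNReal.ofReal (f t)

/-- `μ(t, β) = E{Z(t) Y(t) exp(βᵀ Z(t))} / E{Y(t) exp(βᵀ Z(t))}`. -/
def mu (X : Triple Ω p) (P : Measure Ω) (t : ℝ) (β : Fin p → ℝ) : Fin p → ℝ := fun j =>
  (∫ ω, X.covariate t ω j * X.weight t β ω ∂P) / ∫ ω, X.weight t β ω ∂P

/-- `Σ = E ∫ {Z(s) - μ(s, β)}^{⊗2} dN(s)`. -/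
def sigma (X : Triple Ω p) (P : Measure Ω) (β : Fin p → ℝ) : Matrix (Fin p) (Fin p) ℝ :=
  Matrix.of fun j k => ∫ ω, X.integralN (fun s =>
    (X.covariate s ω j - X.mu P s β j) * (X.covariate s ω k - X.mu P s β k)) ω ∂P

end Triple

/-! ### Sample quantities

The sample of size `n` is realised on the product space `Fin n → Ω`: the `i`-th copy of the
triple `X` at the sample point `ω` is `X` at `ω i`. Under `Measure.pi fun _ => P` these are `n`
independent copies of `X`. -/

section Sample

variable {Ω : Type*} {p n : ℕ}

/-- The log-partial likelihood divided by `n`. -/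
def logLik (X : Triple Ω p) (ω : Fin n → Ω) (β : Fin p → ℝ) : ℝ :=
  (1 / (n : ℝ)) * ∑ i, X.integralN (fun s => β ⬝ᵥ X.covariate s (ω i)) (ω i) -
    (1 / (n : ℝ)) * ∑ i, X.integralN (fun s => Real.log (∑ j, X.weight s β (ω j))) (ω i)

/-- The Lasso penalised estimator: `b` minimises `-ℓ(β) + lam ‖β‖₁`. -/
def IsLasso (X : Triple Ω p) (ω : Fin n → Ω) (lam : ℝ) (b : Fin p → ℝ) : Prop :=
  ∀ β : Fin p → ℝ, -logLik X ω b + lam * l1 b ≤ -logLik X ω β + lam * l1 β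

/-- The normalised weight of individual `i` (with `0 / 0 = 0`). -/
def normWeight (X : Triple Ω p) (ω : Fin n → Ω) (s : ℝ) (β : Fin p → ℝ) (i : Fin n) : ℝ :=
  X.weight s β (ω i) / ∑ j, X.weight s β (ω j)

/-- The weighted average of the covariate processes. -/
def zbar (X : Triple Ω p) (ω : Fin n → Ω) (s : ℝ) (β : Fin p → ℝ) : Fin p → ℝ := fun k =>
  ∑ i, X.covariate s (ω i) k * normWeight X ω s β i

/-- The score vector, i.e. the gradient of `logLik`. -/
def score (X : Triple Ω p) (ω : Fin n → Ω) (β : Fin p → ℝ) : Fin p → ℝ := fun k =>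
  (1 / (n : ℝ)) * ∑ i, X.integralN (fun s => X.covariate s (ω i) k - zbar X ω s β k) (ω i)

/-- The Hessian matrix of `logLik`. -/
def hessian (X : Triple Ω p) (ω : Fin n → Ω) (β : Fin p → ℝ) : Matrix (Fin p) (Fin p) ℝ :=
  Matrix.of fun k l => -((1 / (n : ℝ)) * ∑ m, X.integralN (fun s =>
    ∑ i, (X.covariate s (ω i) k - zbar X ω s β k) * (X.covariate s (ω i) l - zbar X ω s β l) *
      normWeight X ω s β i) (ω m))

/-- The matrix `V̂(β) = n⁻¹ ∑ᵢ ∫ {Zᵢ(s) - Z̄(s, β)}^{⊗2} dNᵢ(s)`. -/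
def vhat (X : Triple Ω p) (ω : Fin n → Ω) (β : Fin p → ℝ) : Matrix (Fin p) (Fin p) ℝ :=
  Matrix.of fun k l => (1 / (n : ℝ)) * ∑ i, X.integralN (fun s =>
    (X.covariate s (ω i) k - zbar X ω s β k) * (X.covariate s (ω i) l - zbar X ω s β l)) (ω i)

/-- The constraint set of the `j`-th CLIME problem for the matrix `V`. -/
def climeFeasible (V : Matrix (Fin p) (Fin p) ℝ) (lam : ℝ) (j : Fin p) : Set (Fin p → ℝ) :=
  {b | ‖V *ᵥ b - Pi.single j 1‖ ≤ lam}

/-- The rows of `Θ` solve the CLIME problems: row `j` has minimal `ℓ₁` norm in the `j`-th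
constraint set. Nothing is required of row `j` when that constraint set is empty. -/
def IsClime (V : Matrix (Fin p) (Fin p) ℝ) (lam : ℝ) (Θ : Matrix (Fin p) (Fin p) ℝ) : Prop :=
  ∀ j, (climeFeasible V lam j).Nonempty →
    Θ j ∈ climeFeasible V lam j ∧ ∀ b ∈ climeFeasible V lam j, l1 (Θ j) ≤ l1 b

/-- The compatibility factor of `-ℓ̈(β)`, an infimum over the non-zero `v` with
`‖v_N‖₁ ≤ 2 ‖v_S‖₁`, where `S` and `N` are the support of `β` and its complement. -/
def kappa (X : Triple Ω p) (ω : Fin n → Ω) (β : Fin p → ℝ) : ENNReal :=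
  ⨅ v : {v : Fin p → ℝ // v ≠ 0 ∧ ∑ j with β j = 0, |v j| ≤ 2 * ∑ j with β j ≠ 0, |v j|},
    ENNReal.ofReal (√(sparsity β) * √(v.1 ⬝ᵥ (-hessian X ω β) *ᵥ v.1)) /
      ENNReal.ofReal (∑ j with β j ≠ 0, |v.1 j|)

theorem hasDerivAt_weight (X : Triple Ω p) (s : ℝ) (β v : Fin p → ℝ) (w : Ω) :
    HasDerivAt (fun t : ℝ => X.weight s (β + t • v) w)
      (X.weight s β w * (v ⬝ᵥ X.covariate s w)) 0 := by
  have h1 : HasDerivAt (fun t : ℝ => (β + t • v) ⬝ᵥ X.covariate s w)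
      (v ⬝ᵥ X.covariate s w) 0 := by
    simp only [add_dotProduct, smul_dotProduct, smul_eq_mul]
    simpa using ((hasDerivAt_id (0 : ℝ)).mul_const (v ⬝ᵥ X.covariate s w)).const_add
      (β ⬝ᵥ X.covariate s w)
  have h2 := (h1.exp).const_mul (X.atRisk s w)
  simpa [Triple.weight, mul_assoc] using h2

theorem sum_weight_pos (X : Triple Ω p) (ω : Fin n → Ω) (β : Fin p → ℝ) (i : Fin n) :
    0 < ∑ j, X.weight (X.time (ω i)) β (ω j) := by
  refine Finset.sum_pos' (fun j _ => ?_) ⟨i, Finset.mem_univ _, ?_⟩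
  · unfold Triple.weight Triple.atRisk
    split_ifs <;> simp [Real.exp_nonneg]
  · simp [Triple.weight, Triple.atRisk, Real.exp_pos]

/-- `score` is the gradient of `logLik`. -/
theorem hasDerivAt_logLik (X : Triple Ω p) (ω : Fin n → Ω) (β v : Fin p → ℝ) :
    HasDerivAt (fun t : ℝ => logLik X ω (β + t • v)) (score X ω β ⬝ᵥ v) 0 := by
  have hA : ∀ i, HasDerivAt (fun t : ℝ =>
      X.integralN (fun s => (β + t • v) ⬝ᵥ X.covariate s (ω i)) (ω i))
      (X.event (ω i) * (v ⬝ᵥ X.covariate (X.time (ω i)) (ω i))) 0 := fun i => by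
    simp only [Triple.integralN, add_dotProduct, smul_dotProduct, smul_eq_mul]
    refine HasDerivAt.const_mul _ ?_
    simpa using ((hasDerivAt_id (0 : ℝ)).mul_const
      (v ⬝ᵥ X.covariate (X.time (ω i)) (ω i))).const_add
      (β ⬝ᵥ X.covariate (X.time (ω i)) (ω i))
  have hB : ∀ i, HasDerivAt (fun t : ℝ =>
      X.integralN (fun s => Real.log (∑ j, X.weight s (β + t • v) (ω j))) (ω i))
      (X.event (ω i) * (zbar X ω (X.time (ω i)) β ⬝ᵥ v)) 0 := fun i => by
    simp only [Triple.integralN]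
    refine HasDerivAt.const_mul _ ?_
    have h := HasDerivAt.fun_sum (u := Finset.univ) fun (j : Fin n) _ =>
      hasDerivAt_weight X (X.time (ω i)) β v (ω j)
    have hl := h.log (by simpa using (sum_weight_pos X ω β i).ne')
    refine hl.congr_deriv (Eq.symm ?_)
    simp only [zero_smul, add_zero, zbar, normWeight, dotProduct, Finset.sum_mul, Finset.mul_sum,
      Finset.sum_div]
    rw [Finset.sum_comm]
    refine Finset.sum_congr rfl fun j _ => Finset.sum_congr rfl fun k _ => ?_
    ring
  have hA' := (HasDerivAt.fun_sum (u := Finset.univ) fun i _ => hA i).const_mul (1 / (n : ℝ))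
  have hB' := (HasDerivAt.fun_sum (u := Finset.univ) fun i _ => hB i).const_mul (1 / (n : ℝ))
  refine (hA'.fun_sub hB').congr_deriv (Eq.symm ?_)
  simp only [score, Triple.integralN, dotProduct, Finset.sum_mul, Finset.mul_sum]
  rw [Finset.sum_comm, ← Finset.sum_sub_distrib]
  refine Finset.sum_congr rfl fun j _ => ?_
  rw [← Finset.sum_sub_distrib]
  refine Finset.sum_congr rfl fun k _ => ?_
  ring

/-- `hessian` is the derivative of `score`. -/
theorem hasDerivAt_score (X : Triple Ω p) (ω : Fin n → Ω) (β v : Fin p → ℝ) (k : Fin p) :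
    HasDerivAt (fun t : ℝ => score X ω (β + t • v) k) ((hessian X ω β *ᵥ v) k) 0 := by
  have hZ : ∀ m, HasDerivAt (fun t : ℝ => zbar X ω (X.time (ω m)) (β + t • v) k)
      (∑ l, (∑ i, (X.covariate (X.time (ω m)) (ω i) k - zbar X ω (X.time (ω m)) β k) *
        (X.covariate (X.time (ω m)) (ω i) l - zbar X ω (X.time (ω m)) β l) *
          normWeight X ω (X.time (ω m)) β i) * v l) 0 := fun m => by
    set s := X.time (ω m) with hs
    have hS := sum_weight_pos X ω β m
    rw [← hs] at hS
    have hD := HasDerivAt.fun_sum (u := Finset.univ) fun (j : Fin n) _ =>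
      hasDerivAt_weight X s β v (ω j)
    have hN := HasDerivAt.fun_sum (u := Finset.univ) fun (j : Fin n) _ =>
      (hasDerivAt_weight X s β v (ω j)).const_mul (X.covariate s (ω j) k)
    have hq := hN.fun_div hD (by simpa using hS.ne')
    have hsum : ∑ i, normWeight X ω s β i = 1 := by
      simp only [normWeight, ← Finset.sum_div]
      exact div_self hS.ne'
    have hcen : ∑ i, (X.covariate s (ω i) k - zbar X ω s β k) * normWeight X ω s β i = 0 := by
      simp only [sub_mul, Finset.sum_sub_distrib, ← Finset.mul_sum, hsum]
      simp [zbar]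
    have hE : (fun t : ℝ => zbar X ω s (β + t • v) k) = fun t : ℝ =>
        (∑ j, X.covariate s (ω j) k * X.weight s (β + t • v) (ω j)) /
          ∑ j, X.weight s (β + t • v) (ω j) := by
      funext t
      simp only [zbar, normWeight, Finset.sum_div, mul_div_assoc]
    rw [hE]
    refine hq.congr_deriv (Eq.symm ?_)
    simp only [zero_smul, add_zero]
    have h1 : ∀ l, (∑ i, (X.covariate s (ω i) k - zbar X ω s β k) *
        (X.covariate s (ω i) l - zbar X ω s β l) * normWeight X ω s β i) =
        ∑ i, (X.covariate s (ω i) k - zbar X ω s β k) * normWeight X ω s β i *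
          X.covariate s (ω i) l := fun l => by
      have : ∀ i, (X.covariate s (ω i) k - zbar X ω s β k) *
          (X.covariate s (ω i) l - zbar X ω s β l) * normWeight X ω s β i =
          (X.covariate s (ω i) k - zbar X ω s β k) * normWeight X ω s β i *
            X.covariate s (ω i) l -
          (X.covariate s (ω i) k - zbar X ω s β k) * normWeight X ω s β i *
            zbar X ω s β l := fun i => by ring
      simp only [this, Finset.sum_sub_distrib, ← Finset.sum_mul, hcen]
      ring
    simp only [h1]
    have h2 : ∑ l, (∑ i, (X.covariate s (ω i) k - zbar X ω s β k) * normWeight X ω s β i *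
        X.covariate s (ω i) l) * v l =
        ∑ i, (X.covariate s (ω i) k - zbar X ω s β k) * normWeight X ω s β i *
          (v ⬝ᵥ X.covariate s (ω i)) := by
      simp only [Finset.sum_mul, dotProduct, Finset.mul_sum]
      rw [Finset.sum_comm]
      refine Finset.sum_congr rfl fun i _ => Finset.sum_congr rfl fun l _ => ?_
      ring
    rw [h2]
    have h3 : zbar X ω s β k = (∑ j, X.covariate s (ω j) k * X.weight s β (ω j)) /
        ∑ j, X.weight s β (ω j) := by
      simp only [zbar, normWeight, Finset.sum_div, mul_div_assoc]
    rw [h3]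
    have hne := hS.ne'
    set S := ∑ j, X.weight s β (ω j) with hSdef
    set N := ∑ j, X.covariate s (ω j) k * X.weight s β (ω j) with hNdef
    have h4 : ∀ i, (X.covariate s (ω i) k - N / S) * normWeight X ω s β i *
        (v ⬝ᵥ X.covariate s (ω i)) =
        (X.covariate s (ω i) k * (X.weight s β (ω i) * (v ⬝ᵥ X.covariate s (ω i)))) / S -
        N * (X.weight s β (ω i) * (v ⬝ᵥ X.covariate s (ω i))) / S ^ 2 := fun i => by
      simp only [normWeight, ← hSdef]
      field_simp
    simp only [h4, Finset.sum_sub_distrib, ← Finset.sum_div, ← Finset.mul_sum]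
    field_simp
  have hI : ∀ m, HasDerivAt (fun t : ℝ => X.integralN (fun s =>
      X.covariate s (ω m) k - zbar X ω s (β + t • v) k) (ω m)) _ 0 := fun m =>
    ((hZ m).const_sub (X.covariate (X.time (ω m)) (ω m) k)).const_mul (X.event (ω m))
  have h := (HasDerivAt.fun_sum (u := Finset.univ) fun m _ => hI m).const_mul (1 / (n : ℝ))
  refine h.congr_deriv (Eq.symm ?_)
  simp only [hessian, mulVec, dotProduct, Matrix.of_apply, Triple.integralN]
  simp only [mul_neg, Finset.sum_neg_distrib, neg_mul, neg_inj]
  simp only [Finset.mul_sum, Finset.sum_mul]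
  rw [Finset.sum_comm]
  refine Finset.sum_congr rfl fun m _ => Finset.sum_congr rfl fun l _ =>
    Finset.sum_congr rfl fun i _ => ?_
  ring

end Sample

/-- `ξ n = O_p(1)` for `[0, ∞]`-valued random variables on varying probability spaces. -/
def IsBigOpOne {S : ℕ → Type*} [∀ n, MeasurableSpace (S n)] (Q : ∀ n, Measure (S n))
    (ξ : ∀ n, S n → ENNReal) : Prop :=
  ∀ ε : ENNReal, 0 < ε → ∃ M : NNReal, ∀ᶠ n in atTop, Q n {ω | (M : ENNReal) < ξ n ω} ≤ ε

/-- `ξ n = o_p(a n)` for real random variables on varying probability spaces and a positive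
sequence `a`. -/
def IsLittleOp {S : ℕ → Type*} [∀ n, MeasurableSpace (S n)] (Q : ∀ n, Measure (S n))
    (ξ : ∀ n, S n → ℝ) (a : ℕ → ℝ) : Prop :=
  ∀ ε : ℝ, 0 < ε → Tendsto (fun n => Q n {ω | ε * a n < |ξ n ω|}) atTop (𝓝 0)

end Cox

end

/-!
At the true parameter the score is a sum of martingale increments: multiplying the factors
`exp (θ (Zₖ - Z̄ₖ) - compensator)` over the failures in order of time gives an exponential
supermartingale, so the sup norm of the score is at most of order `√(log (n p) / n)`. The estimator
`vhat` at the true parameter deviates from `Σ` by that order too: given individual `i`, the other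
individuals still form an independent sample, so `Z̄ - μ` at the failure time of `i` is of order
`√(log (n p) / m)` with `m` individuals at risk, and `1 / √m` averages to at most `2 / √n`.

By the basic inequality for the Lasso and the compatibility factor, its `ℓ₁` error is of order
`d₀ λ`, and replacing `β` by its estimate moves `vhat` by this order. Hence the rows of `Σ⁻¹` are
feasible for the CLIME programme, and the minimality of the rows of `Θhat`, with the column sparsity
of `Σ⁻¹`, bounds their `ℓ₁` error by a multiple of `r ‖Σ⁻¹‖ λₙ`. Hölder's inequality with the bound
on the score finishes the proof.

The covariates are only almost surely bounded and left-continuous; all these estimates are made for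
a version of them that is bounded everywhere and jointly measurable.
-/

noncomputable section

namespace Cox

/-! ### Exponential inequalities -/

theorem exp_mul_sub_sq_le_one_add {b x : ℝ} (θ : ℝ) (hx : |x| ≤ b) :
    Real.exp (θ * x - (θ * b) ^ 2 / 2) ≤
      1 + Real.exp (-((θ * b) ^ 2 / 2)) * (Real.sinh (θ * b) / b) * x := by
  obtain rfl | hb := ((abs_nonneg x).trans hx).eq_or_lt
  · simp [abs_nonpos_iff.mp hx]
  have hconvex : Real.exp (θ * x) ≤ Real.cosh (θ * b) + x / b * Real.sinh (θ * b) := by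
    have := Real.exp_mul_le_cosh_add_mul_sinh
      (by rwa [abs_div, abs_of_pos hb, div_le_one hb] : |x / b| ≤ 1) (θ * b)
    rwa [show x / b * (θ * b) = θ * x by field_simp] at this
  calc Real.exp (θ * x - (θ * b) ^ 2 / 2)
      = Real.exp (-((θ * b) ^ 2 / 2)) * Real.exp (θ * x) := by rw [← Real.exp_add]; ring_nf
    _ ≤ Real.exp (-((θ * b) ^ 2 / 2)) *
          (Real.exp ((θ * b) ^ 2 / 2) + x / b * Real.sinh (θ * b)) := by
        gcongr
        exact hconvex.trans (add_le_add_left (Real.cosh_le_exp_half_sq _) _)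
    _ = _ := by rw [mul_add, ← Real.exp_add, neg_add_cancel, Real.exp_zero]; ring

theorem sum_mul_exp_mul_sub_sq_le {ι : Type*} (s : Finset ι) {w x : ι → ℝ} {b : ℝ} (θ : ℝ)
    (hw : ∀ i ∈ s, 0 ≤ w i) (hx : ∀ i ∈ s, |x i| ≤ b) (hmean : ∑ i ∈ s, w i * x i = 0) :
    ∑ i ∈ s, w i * Real.exp (θ * x i - (θ * b) ^ 2 / 2) ≤ ∑ i ∈ s, w i := by
  calc ∑ i ∈ s, w i * Real.exp (θ * x i - (θ * b) ^ 2 / 2)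
      ≤ ∑ i ∈ s, w i * (1 + Real.exp (-((θ * b) ^ 2 / 2)) * (Real.sinh (θ * b) / b) * x i) :=
        Finset.sum_le_sum fun i hi =>
          mul_le_mul_of_nonneg_left (exp_mul_sub_sq_le_one_add θ (hx i hi)) (hw i hi)
    _ = ∑ i ∈ s, w i + Real.exp (-((θ * b) ^ 2 / 2)) * (Real.sinh (θ * b) / b) *
          ∑ i ∈ s, w i * x i := by
        rw [Finset.mul_sum, ← Finset.sum_add_distrib]
        exact Finset.sum_congr rfl fun i _ => by ring
    _ = ∑ i ∈ s, w i := by rw [hmean, mul_zero, add_zero]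

/-- Hoeffding's lemma, with the compensator charged only where `Y` does not vanish. -/
theorem lintegral_exp_mul_sub_sq_le_one {Ω : Type*} [MeasurableSpace Ω] {P : Measure Ω}
    [IsProbabilityMeasure P] {ξ Y : Ω → ℝ} {b : ℝ} (θ : ℝ) (hξ : Measurable ξ)
    (hY : ∀ ω, Y ω = 0 ∨ Y ω = 1) (hb : ∀ ω, |ξ ω| ≤ b * Y ω) (hmean : ∫ ω, ξ ω ∂P = 0) :
    ∫⁻ ω, ENNReal.ofReal (Real.exp (θ * ξ ω - (θ * b) ^ 2 / 2 * Y ω)) ∂P ≤ 1 := by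
  set a := Real.exp (-((θ * b) ^ 2 / 2)) * (Real.sinh (θ * b) / b)
  have hle : ∀ ω, Real.exp (θ * ξ ω - (θ * b) ^ 2 / 2 * Y ω) ≤ 1 + a * ξ ω := fun ω => by
    have hbω := hb ω
    rcases hY ω with h | h
    · have : ξ ω = 0 := by simpa [h] using hbω
      simp [h, this]
    · rw [h, mul_one] at hbω ⊢
      exact exp_mul_sub_sq_le_one_add θ hbω
  have hInt : Integrable ξ P := by
    refine Integrable.of_bound hξ.aestronglyMeasurable |b| (Eventually.of_forall fun ω => ?_)
    have hbω := hb ω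
    rw [Real.norm_eq_abs]
    rcases hY ω with h | h <;> rw [h] at hbω <;> linarith [le_abs_self b, abs_nonneg b]
  calc ∫⁻ ω, ENNReal.ofReal (Real.exp (θ * ξ ω - (θ * b) ^ 2 / 2 * Y ω)) ∂P
      ≤ ∫⁻ ω, ENNReal.ofReal (1 + a * ξ ω) ∂P :=
        lintegral_mono fun ω => ENNReal.ofReal_le_ofReal (hle ω)
    _ = ENNReal.ofReal (∫ ω, (1 + a * ξ ω) ∂P) :=
        (ofReal_integral_eq_lintegral_ofReal ((integrable_const _).add (hInt.const_mul a))
          (Eventually.of_forall fun ω => (Real.exp_pos _).le.trans (hle ω))).symm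
    _ = 1 := by
        rw [integral_add (integrable_const _) (hInt.const_mul a), integral_const_mul, hmean]
        simp

/-! ### Sums and products ordered by a time -/

theorem prod_eq_one_add_sum_prod_lt {ι R T : Type*} [CommRing R] [LinearOrder T]
    (s : Finset ι) {τ : ι → T} (a : ι → R) (hτ : Set.InjOn τ s) :
    ∏ j ∈ s, a j = 1 + ∑ i ∈ s, (∏ j ∈ s, if τ j < τ i then a j else 1) * (a i - 1) := by
  classical
  induction s using Finset.induction_on_max_value τ with
  | empty => simp
  | insert m s hm hmax ih =>
    have hlt : ∀ i ∈ s, τ i < τ m := fun i hi => lt_of_le_of_ne (hmax i hi) fun h =>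
      hm (hτ (by simp [hi]) (by simp) h ▸ hi)
    have hother : ∀ i ∈ s, (∏ j ∈ insert m s, if τ j < τ i then a j else 1) =
        ∏ j ∈ s, if τ j < τ i then a j else 1 := fun i hi => by
      rw [Finset.prod_insert hm, if_neg (not_lt.mpr (hlt i hi).le), one_mul]
    have hlast : (∏ j ∈ insert m s, if τ j < τ m then a j else 1) = ∏ j ∈ s, a j := by
      rw [Finset.prod_insert hm, if_neg (lt_irrefl _), one_mul]
      exact Finset.prod_congr rfl fun j hj => if_pos (hlt j hj)
    rw [Finset.prod_insert hm, Finset.sum_insert hm,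
      Finset.sum_congr rfl fun i hi => by rw [hother i hi], hlast]
    linear_combination ih (hτ.mono (by simp))

theorem sum_antitoneOn_card_filter_le {ι T : Type*} [LinearOrder T] (s : Finset ι)
    (τ : ι → T) {φ : ℕ → ℝ} (hφ : AntitoneOn φ (Set.Ici 1)) :
    ∑ i ∈ s, φ (s.filter fun j => τ i ≤ τ j).card ≤ ∑ m ∈ Finset.range s.card, φ (m + 1) := by
  classical
  induction s using Finset.induction_on_min_value τ with
  | empty => simp
  | insert a s ha hmin ih =>
    rw [Finset.sum_insert ha, Finset.card_insert_of_notMem ha, Finset.sum_range_succ, add_comm]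
    refine add_le_add ((Finset.sum_le_sum fun i hi => ?_).trans ih) (le_of_eq ?_)
    · exact hφ (Finset.card_pos.mpr ⟨i, by simp [hi]⟩) (Finset.card_pos.mpr ⟨i, by simp [hi]⟩)
        (Finset.card_le_card (Finset.filter_subset_filter _ (by simp)))
    · rw [Finset.filter_true_of_mem, Finset.card_insert_of_notMem ha]
      intro j hj
      rcases Finset.mem_insert.mp hj with rfl | h
      exacts [le_rfl, hmin j h]

theorem sum_range_one_div_sqrt_le (n : ℕ) :
    ∑ m ∈ Finset.range n, 1 / √((m + 1 : ℕ) : ℝ) ≤ 2 * √n := by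
  induction n with
  | zero => simp
  | succ n ih =>
    have hpos : 0 < √((n + 1 : ℕ) : ℝ) := Real.sqrt_pos.mpr (by positivity)
    have hsq : √((n + 1 : ℕ) : ℝ) ^ 2 = √(n : ℝ) ^ 2 + 1 := by
      rw [Real.sq_sqrt (by positivity), Real.sq_sqrt (by positivity)]; push_cast; rfl
    have hstep : 1 / √((n + 1 : ℕ) : ℝ) ≤ 2 * √((n + 1 : ℕ) : ℝ) - 2 * √(n : ℝ) := by
      rw [div_le_iff₀ hpos]
      nlinarith [sq_nonneg (√((n + 1 : ℕ) : ℝ) - √(n : ℝ))]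
    rw [Finset.sum_range_succ]
    linarith

theorem sum_one_div_sqrt_card_filter_le {ι T : Type*} [Fintype ι] [LinearOrder T] (τ : ι → T) :
    ∑ i, 1 / √((Finset.univ.filter fun j => τ i ≤ τ j).card : ℝ) ≤ 2 * √(Fintype.card ι) := by
  have hanti : AntitoneOn (fun m : ℕ => 1 / √(m : ℝ)) (Set.Ici 1) := fun a ha b _ hab =>
    one_div_le_one_div_of_le (Real.sqrt_pos.mpr (by exact_mod_cast ha))
      (Real.sqrt_le_sqrt (by exact_mod_cast hab))
  exact (sum_antitoneOn_card_filter_le Finset.univ τ hanti).trans (sum_range_one_div_sqrt_le _)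

/-! ### Product measures -/

section Pi

variable {ι : Type*} [Fintype ι] {Ω : ι → Type*} [∀ i, MeasurableSpace (Ω i)]
  (P : ∀ i, Measure (Ω i)) [∀ i, IsProbabilityMeasure (P i)]

theorem lintegral_pi_eq_lintegral_update [DecidableEq ι] (i : ι) {f : (∀ i, Ω i) → ENNReal}
    (hf : Measurable f) :
    ∫⁻ ω, f ω ∂Measure.pi P = ∫⁻ ω, ∫⁻ x, f (Function.update ω i x) ∂P i ∂Measure.pi P := by
  have hmarg := lmarginal_singleton (μ := P) f i
  have hm := Measurable.lmarginal (s := {i}) P hf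
  rw [hmarg] at hm
  refine lintegral_eq_of_lmarginal_eq {i} hf hm ?_
  rw [lmarginal_singleton, lmarginal_singleton]
  funext x
  simp

theorem lintegral_pi_prod {f : ∀ i, Ω i → ENNReal} (hf : ∀ i, Measurable (f i)) :
    ∫⁻ ω, ∏ i, f i (ω i) ∂Measure.pi P = ∏ i, ∫⁻ x, f i x ∂P i := by
  rw [ProbabilityTheory.lintegral_prod_eq_prod_lintegral_of_indepFun Finset.univ _
    (ProbabilityTheory.iIndepFun_pi (X := f) fun i => (hf i).aemeasurable)
    fun i => (hf i).comp (measurable_pi_apply i)]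
  exact Finset.prod_congr rfl fun i _ => (measurePreserving_eval P i).lintegral_comp (hf i)

end Pi

/-! ### The `ℓ₁` norm -/

section L1

variable {p : ℕ}

theorem l1_nonneg (v : Fin p → ℝ) : 0 ≤ l1 v := Finset.sum_nonneg fun _ _ => abs_nonneg _

theorem l1_smul (t : ℝ) (v : Fin p → ℝ) : l1 (t • v) = |t| * l1 v := by
  simp only [l1, Pi.smul_apply, smul_eq_mul, abs_mul, Finset.mul_sum]

theorem l1_add_le (u v : Fin p → ℝ) : l1 (u + v) ≤ l1 u + l1 v := by
  rw [l1, l1, l1, ← Finset.sum_add_distrib]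
  exact Finset.sum_le_sum fun j _ => abs_add_le _ _

theorem abs_dotProduct_le (u : Fin p → ℝ) {v : Fin p → ℝ} {K : ℝ} (hv : ∀ j, |v j| ≤ K) :
    |u ⬝ᵥ v| ≤ l1 u * K := by
  rw [l1, Finset.sum_mul]
  refine (Finset.abs_sum_le_sum_abs _ _).trans (Finset.sum_le_sum fun j _ => ?_)
  rw [abs_mul]
  exact mul_le_mul_of_nonneg_left (hv j) (abs_nonneg _)

end L1

/-! ### Survival functions and hazards -/

theorem lipschitzOnWith_exp_neg : LipschitzOnWith 1 (fun x : ℝ => Real.exp (-x)) (Set.Ici 0) := by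
  refine (convex_Ici 0).lipschitzOnWith_of_nnnorm_deriv_le (fun x _ => by fun_prop) fun x hx => ?_
  have hderiv : deriv (fun x : ℝ => Real.exp (-x)) x = -Real.exp (-x) := by
    simpa using (hasDerivAt_neg x).exp.deriv
  rw [hderiv, nnnorm_neg, ← NNReal.coe_le_coe, coe_nnnorm, Real.norm_of_nonneg (Real.exp_pos _).le]
  exact Real.exp_le_one_iff.mpr (neg_nonpos.mpr hx)

theorem absolutelyContinuousOnInterval_comp {φ f : ℝ → ℝ} {a b : ℝ} {s : Set ℝ} {C : NNReal}
    (hφ : LipschitzOnWith C φ s) (hf : AbsolutelyContinuousOnInterval f a b)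
    (hs : Set.MapsTo f (Set.uIcc a b) s) :
    AbsolutelyContinuousOnInterval (fun x => φ (f x)) a b := by
  rw [absolutelyContinuousOnInterval_iff] at hf ⊢
  intro ε hε
  obtain ⟨δ, hδ, hf⟩ := hf (ε / (C + 1)) (by positivity)
  refine ⟨δ, hδ, fun E hE hlen => ?_⟩
  calc ∑ i ∈ Finset.range E.1, dist (φ (f (E.2 i).1)) (φ (f (E.2 i).2))
      ≤ ∑ i ∈ Finset.range E.1, (C + 1) * dist (f (E.2 i).1) (f (E.2 i).2) := by
        refine Finset.sum_le_sum fun i hi => ?_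
        obtain ⟨hleft, hright⟩ := hE.left i (Finset.mem_coe.mpr hi)
        refine (hφ.dist_le_mul _ (hs hleft) _ (hs hright)).trans ?_
        gcongr
        linarith
    _ < ε := by
        rw [← Finset.mul_sum, ← lt_div_iff₀' (by positivity)]
        exact hf E hE hlen

theorem integral_hazard_mul_survival {h : ℝ → ℝ} {b : ℝ} (hb : 0 ≤ b) (h0 : ∀ s, 0 ≤ h s)
    (hinteg : IntegrableOn h (Set.Icc 0 b)) :
    ∫ s in (0 : ℝ)..b, h s * Real.exp (-∫ u in (0 : ℝ)..s, h u) =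
      1 - Real.exp (-∫ u in (0 : ℝ)..b, h u) := by
  have hInt : IntervalIntegrable h volume 0 b :=
    (intervalIntegrable_iff_integrableOn_Icc_of_le hb).mpr hinteg
  have hac : AbsolutelyContinuousOnInterval (fun x => Real.exp (-∫ u in (0 : ℝ)..x, h u)) 0 b :=
    absolutelyContinuousOnInterval_comp (φ := fun x => Real.exp (-x)) lipschitzOnWith_exp_neg
      (hInt.absolutelyContinuousOnInterval_intervalIntegral (c := 0) (by simp)) fun x hx => by
        rw [Set.uIcc_of_le hb] at hx
        exact intervalIntegral.integral_nonneg hx.1 fun s _ => h0 s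
  have hderiv : ∀ᵐ x, x ∈ Set.uIoc 0 b →
      deriv (fun x => Real.exp (-∫ u in (0 : ℝ)..x, h u)) x =
        -(h x * Real.exp (-∫ u in (0 : ℝ)..x, h u)) := by
    filter_upwards [hInt.ae_hasDerivAt_integral] with x hx hxb
    rw [((hx (Set.uIoc_subset_uIcc hxb) 0 (by simp)).fun_neg.exp).deriv]
    ring
  have hftc := hac.integral_deriv_eq_sub
  rw [intervalIntegral.integral_congr_ae hderiv, intervalIntegral.integral_neg] at hftc
  simp only [intervalIntegral.integral_same, neg_zero, Real.exp_zero] at hftc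
  linarith

theorem lintegral_Icc_hazard_mul_survival {h : ℝ → ℝ} {b : ℝ} (hb : 0 ≤ b) (h0 : ∀ s, 0 ≤ h s)
    (hinteg : IntegrableOn h (Set.Icc 0 b)) :
    ∫⁻ s in Set.Icc 0 b, ENNReal.ofReal (h s * Real.exp (-∫ u in (0 : ℝ)..s, h u)) =
      ENNReal.ofReal (1 - Real.exp (-∫ u in (0 : ℝ)..b, h u)) := by
  have hcont : ContinuousOn (fun t => ∫ s in (0 : ℝ)..t, h s) (Set.Icc 0 b) := by
    rw [← Set.uIcc_of_le hb] at hinteg ⊢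
    exact intervalIntegral.continuousOn_primitive_interval hinteg
  have hprod : IntegrableOn (fun s => h s * Real.exp (-∫ u in (0 : ℝ)..s, h u))
      (Set.Icc 0 b) :=
    hinteg.mul_continuousOn (Real.continuous_exp.comp_continuousOn hcont.neg) isCompact_Icc
  rw [← ofReal_integral_eq_lintegral_ofReal hprod
      (Eventually.of_forall fun s => mul_nonneg (h0 s) (Real.exp_pos _).le),
    integral_Icc_eq_integral_Ioc, ← intervalIntegral.integral_of_le hb,
    integral_hazard_mul_survival hb h0 hinteg]

/-- The interval `[0, τ)` of real times, where `τ` may be infinite. -/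
def ico (τ : EReal) : Set ℝ := {s | 0 ≤ s ∧ (s : EReal) < τ}

theorem measurableSet_ico (τ : EReal) : MeasurableSet (ico τ) :=
  (measurableSet_le measurable_const measurable_id).inter
    (measurableSet_lt measurable_coe_real_ereal measurable_const)

theorem Icc_subset_ico {τ : EReal} {t : ℝ} (ht : t ∈ ico τ) : Set.Icc 0 t ⊆ ico τ :=
  fun _ hs => ⟨hs.1, (EReal.coe_le_coe_iff.mpr hs.2).trans_lt ht.2⟩

theorem ico_eq_iUnion (τ : EReal) :
    ico τ = ⋃ q : {q : ℚ // (q : ℝ) ∈ ico τ}, Set.Icc 0 ((q : ℚ) : ℝ) := by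
  refine Set.Subset.antisymm (fun t ht => ?_) (Set.iUnion_subset fun q => Icc_subset_ico q.2)
  obtain ⟨q, htq, hqτ⟩ := EReal.exists_rat_btwn_of_lt ht.2
  have htq : t ≤ q := by exact_mod_cast htq.le
  exact Set.mem_iUnion.mpr ⟨⟨q, ht.1.trans htq, by exact_mod_cast hqτ⟩, ht.1, htq⟩

theorem measure_Icc_zero_eq_measure_Iic {ν : Measure ℝ} (hneg : ν (Set.Iio 0) = 0) (t : ℝ) :
    ν (Set.Icc 0 t) = ν (Set.Iic t) := by
  rw [← Set.Ici_inter_Iic, Set.inter_comm]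
  refine measure_inter_conull ?_
  rwa [Set.compl_Ici]

section Hazard

variable {ν : Measure ℝ} [IsProbabilityMeasure ν] {h : ℝ → ℝ} {τ : EReal}

theorem measure_Icc_eq_lintegral_of_survival {b : ℝ} (hb : 0 ≤ b) (h0 : ∀ s, 0 ≤ h s)
    (hinteg : IntegrableOn h (Set.Icc 0 b)) (hneg : ν (Set.Iio 0) = 0)
    (hsurv : ν (Set.Ioi b) = ENNReal.ofReal (Real.exp (-∫ s in (0 : ℝ)..b, h s))) :
    ν (Set.Icc 0 b) =
      ∫⁻ s in Set.Icc 0 b, ENNReal.ofReal (h s * Real.exp (-∫ u in (0 : ℝ)..s, h u)) := by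
  rw [lintegral_Icc_hazard_mul_survival hb h0 hinteg, measure_Icc_zero_eq_measure_Iic hneg,
    ← Set.compl_Ioi, prob_compl_eq_one_sub measurableSet_Ioi, hsurv,
    ENNReal.ofReal_sub _ (Real.exp_pos _).le, ENNReal.ofReal_one]

theorem Iic_inter_Icc_zero (a b : ℝ) : Set.Iic a ∩ Set.Icc 0 b = Set.Icc 0 (min a b) := by
  rw [← Set.Ici_inter_Iic, Set.inter_left_comm, Set.Iic_inter_Iic, Set.Ici_inter_Iic]

theorem restrict_Icc_eq_withDensity (h0 : ∀ s, 0 ≤ h s)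
    (hinteg : ∀ t ∈ ico τ, IntegrableOn h (Set.Icc 0 t)) (hneg : ν (Set.Iio 0) = 0)
    (hsurv : ∀ q : ℚ, (q : ℝ) ∈ ico τ →
      ν (Set.Ioi (q : ℝ)) = ENNReal.ofReal (Real.exp (-∫ s in (0 : ℝ)..q, h s)))
    {b : ℚ} (hb : (b : ℝ) ∈ ico τ) :
    ν.restrict (Set.Icc 0 (b : ℝ)) = (volume.restrict (Set.Icc 0 (b : ℝ))).withDensity
      fun s => ENNReal.ofReal (h s * Real.exp (-∫ u in (0 : ℝ)..s, h u)) := by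
  have hIcc (q : ℚ) (hq : (q : ℝ) ∈ ico τ) :=
    measure_Icc_eq_lintegral_of_survival hq.1 h0 (hinteg q hq) hneg (hsurv q hq)
  refine ext_of_generate_finite _ Real.borel_eq_generateFrom_Iic_rat Real.isPiSystem_Iic_rat ?_ ?_
  · simp only [Set.mem_iUnion, Set.mem_singleton_iff]
    rintro _ ⟨q, rfl⟩
    rw [Measure.restrict_apply measurableSet_Iic, withDensity_apply _ measurableSet_Iic,
      Measure.restrict_restrict measurableSet_Iic, Iic_inter_Icc_zero]
    rcases lt_or_ge (q : ℝ) 0 with hq | hq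
    · simp [hq]
    · rw [← Rat.cast_min]
      refine hIcc _ (Icc_subset_ico hb ?_)
      rw [Rat.cast_min]
      exact ⟨le_min hq hb.1, min_le_right _ _⟩
  · rw [Measure.restrict_apply_univ, withDensity_apply _ .univ, Measure.restrict_univ, hIcc b hb]

theorem restrict_ico_eq_withDensity_survival (h0 : ∀ s, 0 ≤ h s)
    (hinteg : ∀ t ∈ ico τ, IntegrableOn h (Set.Icc 0 t)) (hneg : ν (Set.Iio 0) = 0)
    (hsurv : ∀ q : ℚ, (q : ℝ) ∈ ico τ →
      ν (Set.Ioi (q : ℝ)) = ENNReal.ofReal (Real.exp (-∫ s in (0 : ℝ)..q, h s))) :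
    ν.restrict (ico τ) = (volume.restrict (ico τ)).withDensity
      fun s => ENNReal.ofReal (h s * Real.exp (-∫ u in (0 : ℝ)..s, h u)) := by
  rw [← restrict_withDensity (measurableSet_ico τ), ico_eq_iUnion,
    Measure.restrict_iUnion_congr]
  rintro ⟨q, hq⟩
  rw [restrict_withDensity measurableSet_Icc]
  exact restrict_Icc_eq_withDensity h0 hinteg hneg hsurv hq

theorem measure_Ici_eq_survival (h0 : ∀ s, 0 ≤ h s) {t : ℝ} (ht : 0 ≤ t)
    (hinteg : IntegrableOn h (Set.Icc 0 t)) (hneg : ν (Set.Iio 0) = 0)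
    (hdens : ν.restrict (Set.Icc 0 t) = (volume.restrict (Set.Icc 0 t)).withDensity
      fun s => ENNReal.ofReal (h s * Real.exp (-∫ u in (0 : ℝ)..s, h u))) :
    ν (Set.Ici t) = ENNReal.ofReal (Real.exp (-∫ s in (0 : ℝ)..t, h s)) := by
  have hnoatom : ν {t} = 0 := by
    rw [← Measure.restrict_eq_self ν (Set.singleton_subset_iff.mpr (Set.right_mem_Icc.mpr ht)),
      hdens]
    exact withDensity_absolutelyContinuous _ _
      (Measure.absolutelyContinuous_of_le Measure.restrict_le_self (measure_singleton t))
  have hIcc : ν (Set.Icc 0 t) = ENNReal.ofReal (1 - Real.exp (-∫ s in (0 : ℝ)..t, h s)) := by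
    rw [← Measure.restrict_apply_univ, hdens, withDensity_apply _ .univ, Measure.restrict_univ,
      lintegral_Icc_hazard_mul_survival ht h0 hinteg]
  have hIoi : ν (Set.Ioi t) = ENNReal.ofReal (Real.exp (-∫ s in (0 : ℝ)..t, h s)) := by
    have hle : Real.exp (-∫ s in (0 : ℝ)..t, h s) ≤ 1 := Real.exp_le_one_iff.mpr
      (neg_nonpos.mpr (intervalIntegral.integral_nonneg ht fun s _ => h0 s))
    rw [← Set.compl_Iic, prob_compl_eq_one_sub measurableSet_Iic,
      ← measure_Icc_zero_eq_measure_Iic hneg, hIcc, ← ENNReal.ofReal_one,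
      ← ENNReal.ofReal_sub _ (sub_nonneg.mpr hle), sub_sub_cancel]
  rw [← hIoi, ← Set.Ici_sdiff_left, measure_sdiff_null hnoatom]

theorem restrict_ico_eq_withDensity (h0 : ∀ s, 0 ≤ h s)
    (hinteg : ∀ t ∈ ico τ, IntegrableOn h (Set.Icc 0 t)) (hneg : ν (Set.Iio 0) = 0)
    (hsurv : ∀ q : ℚ, (q : ℝ) ∈ ico τ →
      ν (Set.Ioi (q : ℝ)) = ENNReal.ofReal (Real.exp (-∫ s in (0 : ℝ)..q, h s))) :
    ν.restrict (ico τ) =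
      (volume.restrict (ico τ)).withDensity fun s => ENNReal.ofReal (h s) * ν (Set.Ici s) := by
  have hdens := restrict_ico_eq_withDensity_survival h0 hinteg hneg hsurv
  have hdensIcc (t : ℝ) (ht : t ∈ ico τ) := by
    simpa only [Measure.restrict_restrict_of_subset (Icc_subset_ico ht),
      restrict_withDensity (s := Set.Icc 0 t) measurableSet_Icc] using
      congrArg (fun m => m.restrict (Set.Icc 0 t)) hdens
  rw [hdens]
  refine withDensity_congr_ae ((ae_restrict_iff' (measurableSet_ico τ)).mpr
    (Eventually.of_forall fun s hs => ?_))
  beta_reduce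
  rw [ENNReal.ofReal_mul (h0 s),
    measure_Ici_eq_survival h0 hs.1 (hinteg s hs) hneg (hdensIcc s hs)]

end Hazard

theorem measurable_measure_Ici (ν : Measure ℝ) : Measurable fun s => ν (Set.Ici s) :=
  Antitone.measurable fun _ _ hst => measure_mono (Set.Ici_subset_Ici.mpr hst)

section IndependentPair

variable {ν ν' : Measure ℝ} [SFinite ν'] {I : Set ℝ} {f k : ℝ → ENNReal}

theorem lintegral_prod_indicator_le_eq (hI : MeasurableSet I) (hf : Measurable f)
    (hk : Measurable k)
    (hν : ν.restrict I = (volume.restrict I).withDensity fun s => k s * ν (Set.Ici s)) :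
    ∫⁻ q, {q : ℝ × ℝ | q.1 ≤ q.2 ∧ q.1 ∈ I}.indicator (fun q => f q.1) q ∂(ν.prod ν') =
      ∫⁻ s in I, f s * k s * (ν (Set.Ici s) * ν' (Set.Ici s)) := by
  have hmeas : Measurable
      ({q : ℝ × ℝ | q.1 ≤ q.2 ∧ q.1 ∈ I}.indicator fun q => f q.1) :=
    (hf.comp measurable_fst).indicator
      ((measurableSet_le measurable_fst measurable_snd).inter (measurable_fst hI))
  have hinner (s : ℝ) :
      ∫⁻ u, {q : ℝ × ℝ | q.1 ≤ q.2 ∧ q.1 ∈ I}.indicator (fun q => f q.1) (s, u) ∂ν' =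
        I.indicator (fun s => f s * ν' (Set.Ici s)) s := by
    by_cases hs : s ∈ I
    · rw [Set.indicator_of_mem hs, ← lintegral_indicator_const measurableSet_Ici]
      exact lintegral_congr fun u => by simp [Set.indicator, hs]
    · simp [hs]
  rw [lintegral_prod _ hmeas.aemeasurable, lintegral_congr hinner, lintegral_indicator hI, hν]
  refine (lintegral_withDensity_eq_lintegral_mul _ (hk.mul (measurable_measure_Ici ν))
    (hf.mul (measurable_measure_Ici ν'))).trans (lintegral_congr fun s => ?_)
  simp only [Pi.mul_apply]
  ring

theorem lintegral_prod_lintegral_indicator_eq [SFinite ν] (hf : Measurable f) (hk : Measurable k) :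
    ∫⁻ q, (∫⁻ s in I, {s | s ≤ q.1 ∧ s ≤ q.2}.indicator (fun s => f s * k s) s) ∂(ν.prod ν') =
      ∫⁻ s in I, f s * k s * (ν (Set.Ici s) * ν' (Set.Ici s)) := by
  have hmeas : Measurable fun r : (ℝ × ℝ) × ℝ =>
      {s | s ≤ r.1.1 ∧ s ≤ r.1.2}.indicator (fun s => f s * k s) r.2 := by
    have hset : MeasurableSet {r : (ℝ × ℝ) × ℝ | r.2 ≤ r.1.1 ∧ r.2 ≤ r.1.2} :=
      (measurableSet_le measurable_snd (by fun_prop)).inter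
        (measurableSet_le measurable_snd (by fun_prop))
    exact ((hf.mul hk).comp measurable_snd).indicator hset
  rw [lintegral_lintegral_swap hmeas.aemeasurable]
  refine lintegral_congr fun s => ?_
  rw [← Measure.prod_prod, ← lintegral_indicator_const (measurableSet_Ici.prod measurableSet_Ici)]
  exact lintegral_congr fun q => by
    simp only [Set.indicator, Set.mem_ofPred_eq, Set.mem_prod, Set.mem_Ici]

end IndependentPair

section ConditionalLaw

open ProbabilityTheory

variable {Ω E : Type*} [MeasurableSpace Ω] [MeasurableSpace E] {P : Measure Ω}
  [IsProbabilityMeasure P] {π : Ω → E}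

section JointLaw

variable {F G : Type*} [MeasurableSpace F] [StandardBorelSpace F] [Nonempty F]
  [MeasurableSpace G] [StandardBorelSpace G] [Nonempty G] {S : Ω → F} {U : Ω → G}

theorem setLIntegral_condDistrib_mul_condDistrib (hπ : Measurable π) (hS : Measurable S)
    (hU : Measurable U) {s : Set F} {u : Set G} (hs : MeasurableSet s) (hu : MeasurableSet u)
    (hind : P[(S ⁻¹' s ∩ U ⁻¹' u).indicator (fun _ => (1 : ℝ)) |
        MeasurableSpace.comap π inferInstance] =ᵐ[P] fun ω =>
      (P[(S ⁻¹' s).indicator (fun _ => (1 : ℝ)) | MeasurableSpace.comap π inferInstance]) ω *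
      (P[(U ⁻¹' u).indicator (fun _ => (1 : ℝ)) | MeasurableSpace.comap π inferInstance]) ω)
    {A : Set E} (hA : MeasurableSet A) :
    ∫⁻ ω in π ⁻¹' A, condDistrib S π P (π ω) s * condDistrib U π P (π ω) u ∂P =
      P (S ⁻¹' s ∩ U ⁻¹' u ∩ π ⁻¹' A) := by
  set κ := condDistrib S π P
  set κ' := condDistrib U π P
  have hmeas : Measurable fun ω => κ (π ω) s * κ' (π ω) u :=
    ((κ.measurable_coe hs).comp hπ).mul ((κ'.measurable_coe hu).comp hπ)
  have hfin : ∫⁻ ω in π ⁻¹' A, κ (π ω) s * κ' (π ω) u ∂P ≠ ⊤ :=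
    ((setLIntegral_le_lintegral _ _).trans (lintegral_mono fun ω =>
      mul_le_one' prob_le_one prob_le_one)).trans_lt (by simp) |>.ne
  have hSU : MeasurableSet (S ⁻¹' s ∩ U ⁻¹' u) := (hS hs).inter (hU hu)
  have hcond : P[(S ⁻¹' s ∩ U ⁻¹' u).indicator (fun _ => (1 : ℝ)) |
      MeasurableSpace.comap π inferInstance] =ᵐ[P]
        fun ω => (κ (π ω) s * κ' (π ω) u).toReal := by
    filter_upwards [condDistrib_ae_eq_condExp (μ := P) hπ hS hs,
      condDistrib_ae_eq_condExp (μ := P) hπ hU hu, hind] with ω hωS hωU hω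
    rw [hω, ← hωS, ← hωU, ENNReal.toReal_mul]
    rfl
  have hset := setIntegral_condExp (μ := P) hπ.comap_le
    ((integrable_const (1 : ℝ)).indicator hSU) (s := π ⁻¹' A) ⟨A, hA, rfl⟩
  rw [setIntegral_congr_ae (hπ hA) (hcond.mono fun ω hω _ => hω),
    integral_toReal hmeas.aemeasurable (Eventually.of_forall fun ω =>
      ENNReal.mul_lt_top (measure_lt_top _ _) (measure_lt_top _ _)),
    integral_indicator_const _ hSU, smul_eq_mul, mul_one, measureReal_restrict_apply hSU] at hset
  exact (ENNReal.toReal_eq_toReal_iff' hfin (measure_ne_top _ _)).mp hset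

theorem map_prodMk_eq_compProd_condDistrib_prod (hπ : Measurable π) (hS : Measurable S)
    (hU : Measurable U)
    (hind : ∀ s u, MeasurableSet s → MeasurableSet u →
      P[(S ⁻¹' s ∩ U ⁻¹' u).indicator (fun _ => (1 : ℝ)) | MeasurableSpace.comap π inferInstance]
        =ᵐ[P] fun ω =>
        (P[(S ⁻¹' s).indicator (fun _ => (1 : ℝ)) | MeasurableSpace.comap π inferInstance]) ω *
        (P[(U ⁻¹' u).indicator (fun _ => (1 : ℝ)) | MeasurableSpace.comap π inferInstance]) ω) :
    P.map (fun ω => (π ω, S ω, U ω)) =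
      (P.map π) ⊗ₘ (condDistrib S π P ×ₖ condDistrib U π P) := by
  have : IsProbabilityMeasure (P.map fun ω => (π ω, S ω, U ω)) :=
    Measure.isProbabilityMeasure_map (by fun_prop)
  refine Measure.ext_prod₃ fun {A s u} hA hs hu => ?_
  rw [Measure.map_apply (by fun_prop) (hA.prod (hs.prod hu)),
    Measure.compProd_apply_prod hA (hs.prod hu)]
  simp_rw [Kernel.prod_apply_prod]
  rw [setLIntegral_map (f := fun e => condDistrib S π P e s * condDistrib U π P e u) hA
      ((Kernel.measurable_coe _ hs).mul (Kernel.measurable_coe _ hu)) hπ,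
    setLIntegral_condDistrib_mul_condDistrib hπ hS hU hs hu (hind s u hs hu) hA]
  congr 1
  ext ω
  simp only [Set.mem_preimage, Set.mem_prod, Set.mem_inter_iff]
  tauto

theorem ae_condDistrib_eq_zero (hπ : Measurable π) (hS : Measurable S) {s : Set F}
    (hs : MeasurableSet s) (hnull : P (S ⁻¹' s) = 0) :
    ∀ᵐ e ∂(P.map π), condDistrib S π P e s = 0 := by
  have hmeas := Kernel.measurable_coe (condDistrib S π P) hs
  have hzero : ∫⁻ ω, condDistrib S π P (π ω) s ∂P = 0 := by
    simpa [hnull] using setLIntegral_preimage_condDistrib (μ := P) hπ hS.aemeasurable hs .univ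
  rw [ae_map_iff hπ.aemeasurable (measurableSet_eq_fun hmeas measurable_const)]
  exact (lintegral_eq_zero_iff (hmeas.comp hπ)).mp hzero

end JointLaw

variable {S U : Ω → ℝ} {τ : EReal} {h : ℝ → E → ℝ}

theorem ae_condDistrib_Ioi_eq (hπ : Measurable π) (hS : Measurable S)
    (hh : Measurable (Function.uncurry h)) {t : ℝ}
    (hsurv : P[{ω | t < S ω}.indicator (fun _ => (1 : ℝ)) |
        MeasurableSpace.comap π inferInstance]
      =ᵐ[P] fun ω => Real.exp (-∫ s in (0 : ℝ)..t, h s (π ω))) :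
    ∀ᵐ e ∂(P.map π), condDistrib S π P e (Set.Ioi t) =
      ENNReal.ofReal (Real.exp (-∫ s in (0 : ℝ)..t, h s e)) := by
  have hcum : Measurable fun e => ∫ s in (0 : ℝ)..t, h s e := by
    have hswap : StronglyMeasurable fun q : E × ℝ => h q.2 q.1 :=
      (hh.comp measurable_swap).stronglyMeasurable
    exact (hswap.integral_prod_right'.sub hswap.integral_prod_right').measurable
  have hsurvMeas : Measurable fun e => ENNReal.ofReal (Real.exp (-∫ s in (0 : ℝ)..t, h s e)) :=
    hcum.neg.exp.ennreal_ofReal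
  rw [ae_map_iff hπ.aemeasurable (measurableSet_eq_fun
    (Kernel.measurable_coe _ measurableSet_Ioi) hsurvMeas)]
  filter_upwards [condDistrib_ae_eq_condExp (μ := P) hπ hS (measurableSet_Ioi (a := t)), hsurv]
    with ω hcond hω
  rw [← ofReal_measureReal, hcond, ← hω]
  rfl

theorem ae_condDistrib_restrict_ico_eq_withDensity (hπ : Measurable π) (hS : Measurable S)
    (hS0 : ∀ ω, 0 ≤ S ω) (hh : Measurable (Function.uncurry h)) (h0 : ∀ s e, 0 ≤ h s e)
    (hinteg : ∀ e, ∀ t ∈ ico τ, IntegrableOn (fun s => h s e) (Set.Icc 0 t))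
    (hsurv : ∀ t ∈ ico τ, P[{ω | t < S ω}.indicator (fun _ => (1 : ℝ)) |
        MeasurableSpace.comap π inferInstance]
      =ᵐ[P] fun ω => Real.exp (-∫ s in (0 : ℝ)..t, h s (π ω))) :
    ∀ᵐ e ∂(P.map π), (condDistrib S π P e).restrict (ico τ) =
      (volume.restrict (ico τ)).withDensity
        fun s => ENNReal.ofReal (h s e) * condDistrib S π P e (Set.Ici s) := by
  have hnonneg : S ⁻¹' Set.Iio 0 = ∅ := Set.eq_empty_of_forall_notMem fun ω hω =>
    (hS0 ω).not_gt hω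
  filter_upwards [ae_condDistrib_eq_zero hπ hS measurableSet_Iio (hnonneg ▸ measure_empty),
    (ae_all_iff (μ := P.map π)).mpr fun q : {q : ℚ // (q : ℝ) ∈ ico τ} =>
      ae_condDistrib_Ioi_eq hπ hS hh (hsurv q.1 q.2)] with e hneg hrat
  exact restrict_ico_eq_withDensity (fun s => h0 s e) (hinteg e) hneg fun q hq => hrat ⟨q, hq⟩

theorem measurable_lintegral_ico_indicator {g k : ℝ → E → ENNReal}
    (hg : Measurable (Function.uncurry g)) (hk : Measurable (Function.uncurry k)) :
    Measurable fun q : E × ℝ × ℝ => ∫⁻ s in ico τ,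
      {s | s ≤ q.2.1 ∧ s ≤ q.2.2}.indicator (fun s => g s q.1 * k s q.1) s := by
  have hset : MeasurableSet {r : (E × ℝ × ℝ) × ℝ | r.2 ≤ r.1.2.1 ∧ r.2 ≤ r.1.2.2} :=
    (measurableSet_le measurable_snd (by fun_prop)).inter
      (measurableSet_le measurable_snd (by fun_prop))
  have hprod : Measurable fun r : (E × ℝ × ℝ) × ℝ => g r.2 r.1.1 * k r.2 r.1.1 :=
    (hg.mul hk).comp (measurable_snd.prodMk (measurable_fst.comp measurable_fst))
  exact (hprod.indicator hset).lintegral_prod_right'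

/-- This says that `∫ 1{t ≤ S, t ≤ U} h(t) dt` compensates `1{S ≤ U, S ≤ t}`. -/
theorem lintegral_event_eq_lintegral_hazard (hπ : Measurable π)
    (hS : Measurable S) (hU : Measurable U) (hS0 : ∀ ω, 0 ≤ S ω)
    (hh : Measurable (Function.uncurry h)) (h0 : ∀ s e, 0 ≤ h s e)
    (hinteg : ∀ e, ∀ t ∈ ico τ, IntegrableOn (fun s => h s e) (Set.Icc 0 t))
    (hind : ∀ s u : Set ℝ, MeasurableSet s → MeasurableSet u →
      P[(S ⁻¹' s ∩ U ⁻¹' u).indicator (fun _ => (1 : ℝ)) | MeasurableSpace.comap π inferInstance]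
        =ᵐ[P] fun ω =>
        (P[(S ⁻¹' s).indicator (fun _ => (1 : ℝ)) | MeasurableSpace.comap π inferInstance]) ω *
        (P[(U ⁻¹' u).indicator (fun _ => (1 : ℝ)) | MeasurableSpace.comap π inferInstance]) ω)
    (hsurv : ∀ t ∈ ico τ, P[{ω | t < S ω}.indicator (fun _ => (1 : ℝ)) |
        MeasurableSpace.comap π inferInstance]
      =ᵐ[P] fun ω => Real.exp (-∫ s in (0 : ℝ)..t, h s (π ω)))
    {g : ℝ → E → ENNReal} (hg : Measurable (Function.uncurry g)) :
    ∫⁻ ω, {ω | S ω ≤ U ω ∧ S ω ∈ ico τ}.indicator (fun ω => g (S ω) (π ω)) ω ∂P =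
      ∫⁻ ω, (∫⁻ s in ico τ, {s | s ≤ S ω ∧ s ≤ U ω}.indicator
        (fun s => g s (π ω) * ENNReal.ofReal (h s (π ω))) s) ∂P := by
  set κ := condDistrib S π P
  set κ' := condDistrib U π P
  have hdisintegrate {F : E × ℝ × ℝ → ENNReal} (hF : Measurable F) :
      ∫⁻ ω, F (π ω, S ω, U ω) ∂P = ∫⁻ e, ∫⁻ q, F (e, q) ∂((κ e).prod (κ' e)) ∂(P.map π) := by
    simp_rw [← Kernel.prod_apply]
    rw [← Measure.lintegral_compProd hF, ← map_prodMk_eq_compProd_condDistrib_prod hπ hS hU hind,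
      lintegral_map hF (by fun_prop)]
  have hevent : Measurable
      ({q : E × ℝ × ℝ | q.2.1 ≤ q.2.2 ∧ q.2.1 ∈ ico τ}.indicator fun q => g q.2.1 q.1) :=
    (hg.comp ((measurable_fst.comp measurable_snd).prodMk measurable_fst)).indicator
      ((measurableSet_le (measurable_fst.comp measurable_snd)
        (measurable_snd.comp measurable_snd)).inter
        ((measurableSet_ico τ).preimage (measurable_fst.comp measurable_snd)))
  refine (hdisintegrate hevent).trans (Eq.trans (lintegral_congr_ae ?_)
    (hdisintegrate (measurable_lintegral_ico_indicator
      (k := fun s e => ENNReal.ofReal (h s e)) hg hh.ennreal_ofReal)).symm)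
  filter_upwards [ae_condDistrib_restrict_ico_eq_withDensity hπ hS hS0 hh h0 hinteg hsurv]
    with e hκ
  have hge : Measurable fun s => g s e := hg.comp measurable_prodMk_right
  have hhe : Measurable fun s => ENNReal.ofReal (h s e) :=
    (hh.comp measurable_prodMk_right).ennreal_ofReal
  exact (lintegral_prod_indicator_le_eq (measurableSet_ico τ) hge hhe hκ).trans
    (lintegral_prod_lintegral_indicator_eq hge hhe).symm

end ConditionalLaw

/-! ### Regular models -/

/-- A triple whose covariates are bounded everywhere and are a jointly measurable function `Z` of
time and of a random element `π`, and for which the compensator of the failure counting process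
given `π` is `Y(s) haz(s) exp(βᵀ Z(s)) ds` on `I`. The compensator property is stated in integrated
form, so that no filtration is needed. -/
structure IsRegular {Ω E : Type*} [MeasurableSpace Ω] [MeasurableSpace E] {p : ℕ}
    (X : Triple Ω p) (P : Measure Ω) (β : Fin p → ℝ) (K : ℝ) (π : Ω → E)
    (Z : ℝ → E → Fin p → ℝ) (I : Set ℝ) (haz : ℝ → ℝ) : Prop where
  measurable_failure : Measurable X.failure
  measurable_censor : Measurable X.censor
  measurable_proj : Measurable π
  measurable_cov : Measurable fun q : ℝ × E => Z q.1 q.2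
  covariate_eq : ∀ t ω, X.covariate t ω = Z t (π ω)
  bound : ∀ t e j, |Z t e j| ≤ K
  measure_time_eq : ∀ t, P {ω | X.time ω = t} = 0
  measurable_haz : Measurable haz
  haz_nonneg : ∀ t, 0 ≤ haz t
  compensator : ∀ g : ℝ → E → ENNReal, Measurable (Function.uncurry g) →
    ∫⁻ ω, ENNReal.ofReal (X.event ω) * g (X.time ω) (π ω) ∂P =
      ∫⁻ ω, (∫⁻ s in I, ENNReal.ofReal (X.atRisk s ω) * (g s (π ω) *
        ENNReal.ofReal (haz s * Real.exp (β ⬝ᵥ Z s (π ω))))) ∂P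

section Indicators

variable {Ω : Type*} {p : ℕ} (X : Triple Ω p)

theorem event_eq_zero_or_one (ω : Ω) : X.event ω = 0 ∨ X.event ω = 1 := by
  unfold Triple.event; split_ifs <;> simp

theorem event_nonneg (ω : Ω) : 0 ≤ X.event ω := by
  rcases event_eq_zero_or_one X ω with hd | hd <;> simp [hd]

theorem event_le_one (ω : Ω) : X.event ω ≤ 1 := by
  rcases event_eq_zero_or_one X ω with hd | hd <;> simp [hd]

theorem atRisk_eq_zero_or_one (t : ℝ) (ω : Ω) : X.atRisk t ω = 0 ∨ X.atRisk t ω = 1 := by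
  unfold Triple.atRisk; split_ifs <;> simp

theorem atRisk_nonneg (t : ℝ) (ω : Ω) : 0 ≤ X.atRisk t ω := by
  rcases atRisk_eq_zero_or_one X t ω with hy | hy <;> simp [hy]

end Indicators

section RiskMean

variable {ι E : Type*} {p : ℕ} (Z : ℝ → E → Fin p → ℝ) (β : Fin p → ℝ) (k : Fin p)

/-- The weight `1{τ_j ≥ s} exp(βᵀ Z(s, e_j))` of individual `j` at time `s`, given the observed
times `τ` and the covariate paths encoded by `e`. -/
def riskWeight (s : ℝ) (τ : ι → ℝ) (e : ι → E) (j : ι) : ℝ :=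
  (if s ≤ τ j then 1 else 0) * Real.exp (β ⬝ᵥ Z s (e j))

theorem riskWeight_nonneg (s : ℝ) (τ : ι → ℝ) (e : ι → E) (j : ι) :
    0 ≤ riskWeight Z β s τ e j := by
  unfold riskWeight; split_ifs <;> positivity

variable [Fintype ι]

/-- The `k`-th coordinate of `Z̄(s, β)` as a function of the observed times `τ` and of `e`. -/
def riskMean (s : ℝ) (τ : ι → ℝ) (e : ι → E) : ℝ :=
  (∑ j, Z s (e j) k * riskWeight Z β s τ e j) / ∑ j, riskWeight Z β s τ e j

/-- The exponent that individual `i` contributes to the exponential supermartingale on failing at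
time `s`; `b` is a bound on the jumps of the martingale. -/
def exponent (θ b s : ℝ) (τ : ι → ℝ) (e : ι → E) (i : ι) : ℝ :=
  θ * (Z s (e i) k - riskMean Z β k s τ e) - (θ * b) ^ 2 / 2

theorem abs_riskMean_le {K : ℝ} (hK : 0 ≤ K) (hZ : ∀ t e j, |Z t e j| ≤ K) (s : ℝ)
    (τ : ι → ℝ) (e : ι → E) : |riskMean Z β k s τ e| ≤ K := by
  have hw := riskWeight_nonneg Z β s τ e
  have hsum : 0 ≤ ∑ j, riskWeight Z β s τ e j := Finset.sum_nonneg fun j _ => hw j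
  rw [riskMean, abs_div, abs_of_nonneg hsum]
  refine div_le_of_le_mul₀ hsum hK ?_
  calc |∑ j, Z s (e j) k * riskWeight Z β s τ e j|
      ≤ ∑ j, |Z s (e j) k * riskWeight Z β s τ e j| := Finset.abs_sum_le_sum_abs _ _
    _ ≤ ∑ j, K * riskWeight Z β s τ e j := Finset.sum_le_sum fun j _ => by
        rw [abs_mul, abs_of_nonneg (hw j)]
        exact mul_le_mul_of_nonneg_right (hZ _ _ _) (hw j)
    _ = K * ∑ j, riskWeight Z β s τ e j := (Finset.mul_sum _ _ _).symm

theorem abs_sub_riskMean_le {K : ℝ} (hZ : ∀ t e j, |Z t e j| ≤ K) (s : ℝ) (τ : ι → ℝ)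
    (e : ι → E) (i : ι) : |Z s (e i) k - riskMean Z β k s τ e| ≤ 2 * K := by
  have hK : 0 ≤ K := (abs_nonneg _).trans (hZ s (e i) k)
  linarith [abs_sub (Z s (e i) k) (riskMean Z β k s τ e), hZ s (e i) k,
    abs_riskMean_le Z β k hK hZ s τ e]

theorem sum_riskWeight_mul_sub (s : ℝ) (τ : ι → ℝ) (e : ι → E) :
    ∑ j, riskWeight Z β s τ e j * (Z s (e j) k - riskMean Z β k s τ e) = 0 := by
  simp only [mul_sub, Finset.sum_sub_distrib, ← Finset.sum_mul]
  by_cases hsum : ∑ j, riskWeight Z β s τ e j = 0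
  · have hzero := (Finset.sum_eq_zero_iff_of_nonneg fun j _ => riskWeight_nonneg Z β s τ e j).mp
      hsum
    rw [hsum, zero_mul, sub_zero]
    exact Finset.sum_eq_zero fun j hj => by rw [hzero j hj, zero_mul]
  · rw [riskMean, mul_div_cancel₀ _ hsum, sub_eq_zero]
    exact Finset.sum_congr rfl fun j _ => mul_comm _ _

theorem sum_riskWeight_mul_exp_exponent_le {K : ℝ} (hZ : ∀ t e j, |Z t e j| ≤ K)
    (θ s : ℝ) (τ : ι → ℝ) (e : ι → E) :
    ∑ i, riskWeight Z β s τ e i * Real.exp (exponent Z β k θ (2 * K) s τ e i) ≤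
      ∑ i, riskWeight Z β s τ e i :=
  sum_mul_exp_mul_sub_sq_le Finset.univ θ (fun i _ => riskWeight_nonneg Z β s τ e i)
    (fun i _ => abs_sub_riskMean_le Z β k hZ s τ e i) (sum_riskWeight_mul_sub Z β k s τ e)

theorem exponent_le {K : ℝ} (hZ : ∀ t e j, |Z t e j| ≤ K)
    (θ b s : ℝ) (τ : ι → ℝ) (e : ι → E) (i : ι) :
    exponent Z β k θ b s τ e i ≤ |θ| * (2 * K) := by
  have hjump : θ * (Z s (e i) k - riskMean Z β k s τ e) ≤ |θ| * (2 * K) := by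
    refine (le_abs_self _).trans ?_
    rw [abs_mul]
    exact mul_le_mul_of_nonneg_left (abs_sub_riskMean_le Z β k hZ s τ e i) (abs_nonneg _)
  unfold exponent
  linarith [sq_nonneg (θ * b)]

theorem exponent_congr (θ b : ℝ) {s : ℝ} {τ τ' : ι → ℝ} (e : ι → E) (i : ι)
    (h : ∀ j, s ≤ τ j ↔ s ≤ τ' j) :
    exponent Z β k θ b s τ e i = exponent Z β k θ b s τ' e i := by
  simp only [exponent, riskMean, riskWeight, h]

theorem exponent_update_of_le [DecidableEq ι] (θ b : ℝ) {r s : ℝ} {τ : ι → ℝ} (e : ι → E) {i : ι}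
    (j : ι) (hrs : r ≤ s) (hs : s ≤ τ i) :
    exponent Z β k θ b r (Function.update τ i s) e j = exponent Z β k θ b r τ e j := by
  refine exponent_congr Z β k θ b e j fun l => ?_
  rcases eq_or_ne l i with rfl | hl
  · simp only [Function.update_self, hrs, hrs.trans hs]
  · rw [Function.update_of_ne hl]

theorem measurable_exponent [MeasurableSpace E] (hZ : Measurable fun q : ℝ × E => Z q.1 q.2)
    (θ b : ℝ) (i : ι) :
    Measurable fun q : ℝ × (ι → ℝ) × (ι → E) => exponent Z β k θ b q.1 q.2.1 q.2.2 i := by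
  have hcov : ∀ j l, Measurable fun q : ℝ × (ι → ℝ) × (ι → E) => Z q.1 (q.2.2 j) l :=
    fun j l => (measurable_pi_apply l).comp (hZ.comp (measurable_fst.prodMk
      ((measurable_pi_apply j).comp (measurable_snd.comp measurable_snd))))
  have hweight : ∀ j, Measurable fun q : ℝ × (ι → ℝ) × (ι → E) =>
      riskWeight Z β q.1 q.2.1 q.2.2 j := fun j => by
    refine (Measurable.ite (measurableSet_le measurable_fst (by fun_prop))
      measurable_const measurable_const).mul (Real.measurable_exp.comp ?_)
    exact Finset.measurable_fun_sum _ fun l _ => (hcov j l).const_mul _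
  refine (((hcov i k).sub (Measurable.div ?_ ?_)).const_mul θ).sub_const _
  · exact Finset.measurable_fun_sum _ fun j _ => (hcov j k).mul (hweight j)
  · exact Finset.measurable_fun_sum _ fun j _ => hweight j

end RiskMean

/-! ### The exponential supermartingale of the score -/

section PastProd

variable {ι Ω E : Type*} [Fintype ι] [DecidableEq ι] {p : ℕ} (X : Triple Ω p) (β : Fin p → ℝ)
  (π : Ω → E) (Z : ℝ → E → Fin p → ℝ) (k : Fin p) (θ b : ℝ)

/-- The left limit at time `s` of the exponential supermartingale, written so that the data of
individual `i` enter only through `s` and `x`: the failures before `s` of the other individuals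
contribute, with `i` declared to be at risk until `s` with covariate path `x`. -/
def pastProd (i : ι) (s : ℝ) (x : E) (ω : ι → Ω) : ℝ :=
  ∏ j ∈ Finset.univ.erase i, if X.time (ω j) < s then
    Real.exp (X.event (ω j) * exponent Z β k θ b (X.time (ω j))
      (Function.update (X.time ∘ ω) i s) (Function.update (π ∘ ω) i x) j)
    else 1

theorem pastProd_update (i : ι) (s : ℝ) (x : E) (ω : ι → Ω) (y : Ω) :
    pastProd X β π Z k θ b i s x (Function.update ω i y) = pastProd X β π Z k θ b i s x ω := by
  simp only [pastProd, Function.comp_update, Function.update_idem]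
  refine Finset.prod_congr rfl fun j hj => ?_
  rw [Function.update_of_ne (Finset.ne_of_mem_erase hj)]

theorem pastProd_nonneg (i : ι) (s : ℝ) (x : E) (ω : ι → Ω) :
    0 ≤ pastProd X β π Z k θ b i s x ω :=
  Finset.prod_nonneg fun j _ => by split_ifs <;> positivity

theorem pastProd_le {K : ℝ} (hZ : ∀ t e j, |Z t e j| ≤ K) (i : ι) (s : ℝ) (x : E) (ω : ι → Ω) :
    pastProd X β π Z k θ b i s x ω ≤ Real.exp (|θ| * (2 * K)) ^ Fintype.card ι := by
  have hK : 0 ≤ K := (abs_nonneg _).trans (hZ s x k)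
  have hone : (1 : ℝ) ≤ Real.exp (|θ| * (2 * K)) := Real.one_le_exp (by positivity)
  calc pastProd X β π Z k θ b i s x ω
      ≤ ∏ _j ∈ Finset.univ.erase i, Real.exp (|θ| * (2 * K)) := by
        refine Finset.prod_le_prod (fun j _ => by split_ifs <;> positivity) fun j _ => ?_
        split_ifs
        · refine Real.exp_le_exp.mpr ?_
          rcases event_eq_zero_or_one X (ω j) with hd | hd
          · rw [hd, zero_mul]; positivity
          · rw [hd, one_mul]; exact exponent_le Z β k hZ _ _ _ _ _ _
        · exact hone
    _ ≤ Real.exp (|θ| * (2 * K)) ^ Fintype.card ι := by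
        rw [Finset.prod_const]
        exact pow_le_pow_right₀ hone (Finset.card_le_univ _)

theorem pastProd_eq_of_le {i : ι} {s : ℝ} {ω : ι → Ω} (hs : s ≤ X.time (ω i)) :
    pastProd X β π Z k θ b i s (π (ω i)) ω = ∏ j, if X.time (ω j) < s then
      Real.exp (X.event (ω j) * exponent Z β k θ b (X.time (ω j)) (X.time ∘ ω) (π ∘ ω) j)
      else 1 := by
  rw [← Finset.mul_prod_erase _ _ (Finset.mem_univ i), if_neg (not_lt.mpr hs), one_mul]
  refine Finset.prod_congr rfl fun j _ => ?_
  split_ifs with hlt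
  · rw [← Function.comp_apply (f := π), Function.update_eq_self,
      exponent_update_of_le Z β k θ b _ j hlt.le hs]
  · rfl

/-- The growth factor of the exponential supermartingale when `i` fails at time `s` with covariate
path `x`; as in `pastProd`, the data of `i` enter only through `s` and `x`. -/
def jumpFactor (i : ι) (s : ℝ) (x : E) (ω : ι → Ω) : ℝ :=
  Real.exp (exponent Z β k θ b s (Function.update (X.time ∘ ω) i s) (Function.update (π ∘ ω) i x) i)

theorem jumpFactor_nonneg (i : ι) (s : ℝ) (x : E) (ω : ι → Ω) :
    0 ≤ jumpFactor X β π Z k θ b i s x ω :=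
  (Real.exp_pos _).le

theorem jumpFactor_update (i : ι) (s : ℝ) (x : E) (ω : ι → Ω) (y : Ω) :
    jumpFactor X β π Z k θ b i s x (Function.update ω i y) =
      jumpFactor X β π Z k θ b i s x ω := by
  simp only [jumpFactor, Function.comp_update, Function.update_idem]

theorem jumpFactor_eq_of_le {i : ι} {s : ℝ} {ω : ι → Ω} (hs : s ≤ X.time (ω i)) :
    jumpFactor X β π Z k θ b i s (π (ω i)) ω =
      Real.exp (exponent Z β k θ b s (X.time ∘ ω) (π ∘ ω) i) := by
  rw [jumpFactor, ← Function.comp_apply (f := π), Function.update_eq_self,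
    exponent_update_of_le Z β k θ b _ i le_rfl hs]

/-- The terminal value of the exponential supermartingale is `1` plus the sum of its jumps; the
negative parts are moved to the left so that the identity survives in `ENNReal`. -/
theorem prod_exp_exponent_add_sum {ω : ι → Ω} (hω : Function.Injective (X.time ∘ ω)) :
    ∏ j, Real.exp (X.event (ω j) * exponent Z β k θ b (X.time (ω j)) (X.time ∘ ω) (π ∘ ω) j) +
      ∑ i, X.event (ω i) * pastProd X β π Z k θ b i (X.time (ω i)) (π (ω i)) ω =
    1 + ∑ i, X.event (ω i) * (pastProd X β π Z k θ b i (X.time (ω i)) (π (ω i)) ω *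
      jumpFactor X β π Z k θ b i (X.time (ω i)) (π (ω i)) ω) := by
  rw [prod_eq_one_add_sum_prod_lt Finset.univ _ hω.injOn, add_assoc, ← Finset.sum_add_distrib]
  congr 1
  refine Finset.sum_congr rfl fun i _ => ?_
  rw [pastProd_eq_of_le X β π Z k θ b le_rfl, jumpFactor_eq_of_le X β π Z k θ b le_rfl]
  rcases event_eq_zero_or_one X (ω i) with hd | hd
  · simp only [hd, zero_mul, Real.exp_zero, sub_self, mul_zero, add_zero]
  · simp only [hd, one_mul, Function.comp_apply]; ring

theorem sum_atRisk_pastProd_mul_jumpFactor_le {K : ℝ} (hZ : ∀ t e j, |Z t e j| ≤ K) (s : ℝ)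
    {c : ℝ} (hc : 0 ≤ c) (ω : ι → Ω) :
    ∑ i, X.atRisk s (ω i) * (pastProd X β π Z k θ (2 * K) i s (π (ω i)) ω *
      jumpFactor X β π Z k θ (2 * K) i s (π (ω i)) ω * (c * Real.exp (β ⬝ᵥ Z s (π (ω i))))) ≤
    ∑ i, X.atRisk s (ω i) * (pastProd X β π Z k θ (2 * K) i s (π (ω i)) ω *
        (c * Real.exp (β ⬝ᵥ Z s (π (ω i))))) := by
  set W := ∏ j, if X.time (ω j) < s then Real.exp (X.event (ω j) *
    exponent Z β k θ (2 * K) (X.time (ω j)) (X.time ∘ ω) (π ∘ ω) j) else 1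
  have hW : 0 ≤ W := Finset.prod_nonneg fun j _ => by split_ifs <;> positivity
  have hfactor : ∀ (i : ι) (J J' : ℝ), (s ≤ X.time (ω i) → J = J') →
      X.atRisk s (ω i) * (pastProd X β π Z k θ (2 * K) i s (π (ω i)) ω * J *
        (c * Real.exp (β ⬝ᵥ Z s (π (ω i))))) =
      W * c * (riskWeight Z β s (X.time ∘ ω) (π ∘ ω) i * J') := fun i J J' hJ => by
    simp only [Triple.atRisk, riskWeight, Function.comp_apply]
    split_ifs with hs
    · rw [pastProd_eq_of_le X β π Z k θ (2 * K) hs, hJ hs]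
      ring
    · simp
  have hleft := fun i => hfactor i _ _ (jumpFactor_eq_of_le X β π Z k θ (2 * K))
  have hright := fun i => hfactor i 1 1 fun _ => rfl
  simp only [mul_one] at hright
  simp_rw [hleft, hright, ← Finset.mul_sum]
  exact mul_le_mul_of_nonneg_left (sum_riskWeight_mul_exp_exponent_le Z β k hZ θ s _ _)
    (mul_nonneg hW hc)

end PastProd

theorem ofReal_sum_mul {ι : Type*} (s : Finset ι) {f g : ι → ℝ} (hf : ∀ i, 0 ≤ f i)
    (hg : ∀ i, 0 ≤ g i) :
    ENNReal.ofReal (∑ i ∈ s, f i * g i) = ∑ i ∈ s, ENNReal.ofReal (f i) * ENNReal.ofReal (g i) := by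
  rw [ENNReal.ofReal_sum_of_nonneg fun i _ => mul_nonneg (hf i) (hg i)]
  exact Finset.sum_congr rfl fun i _ => ENNReal.ofReal_mul (hf i)

/-- A measurable functional of a time, of a covariate path and of a sample that does not depend on
the `i`-th sample point. It stands in for a predictable process: evaluating it at the data of
individual `i` is legitimate in the compensator formula. -/
structure OmitsCoord {ι Ω E : Type*} [MeasurableSpace Ω] [MeasurableSpace E] [DecidableEq ι] (i : ι)
    (Ψ : ℝ → E → (ι → Ω) → ENNReal) : Prop where
  measurable : Measurable fun q : ℝ × E × (ι → Ω) => Ψ q.1 q.2.1 q.2.2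
  update_eq : ∀ s x ω y, Ψ s x (Function.update ω i y) = Ψ s x ω

namespace IsRegular

variable {ι Ω E : Type*} [MeasurableSpace Ω] [MeasurableSpace E] {p n : ℕ}
  {X : Triple Ω p} {P : Measure Ω} {β : Fin p → ℝ} {K : ℝ} {π : Ω → E}
  {Z : ℝ → E → Fin p → ℝ} {I : Set ℝ} {haz : ℝ → ℝ}

theorem measurable_time (h : IsRegular X P β K π Z I haz) : Measurable X.time :=
  h.measurable_failure.min h.measurable_censor

theorem measurable_event (h : IsRegular X P β K π Z I haz) : Measurable X.event :=
  Measurable.ite (measurableSet_le h.measurable_failure h.measurable_censor)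
    measurable_const measurable_const

theorem measurable_atRisk (h : IsRegular X P β K π Z I haz) :
    Measurable fun q : ℝ × Ω => X.atRisk q.1 q.2 :=
  Measurable.ite (measurableSet_le measurable_fst (h.measurable_time.comp measurable_snd))
    measurable_const measurable_const

theorem measurable_rate (h : IsRegular X P β K π Z I haz) :
    Measurable fun q : ℝ × E => ENNReal.ofReal (haz q.1 * Real.exp (β ⬝ᵥ Z q.1 q.2)) := by
  refine ((h.measurable_haz.comp measurable_fst).mul (Real.measurable_exp.comp ?_)).ennreal_ofReal
  exact Finset.measurable_fun_sum _ fun l _ =>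
    ((measurable_pi_apply l).comp h.measurable_cov).const_mul _

theorem zbar_eq_riskMean (h : IsRegular X P β K π Z I haz) (ω : Fin n → Ω) (s : ℝ) (k : Fin p) :
    zbar X ω s β k = riskMean Z β k s (X.time ∘ ω) (π ∘ ω) := by
  simp only [zbar, normWeight, riskMean, riskWeight, Triple.weight, Triple.atRisk,
    h.covariate_eq, Finset.sum_div, mul_div_assoc, Function.comp_apply]

section OmitsCoord

variable [DecidableEq ι]

theorem measurable_update_time_proj (h : IsRegular X P β K π Z I haz) (i : ι) :
    Measurable fun q : ℝ × E × (ι → Ω) =>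
      (Function.update (X.time ∘ q.2.2) i q.1, Function.update (π ∘ q.2.2) i q.2.1) := by
  have htime := h.measurable_time
  have hproj := h.measurable_proj
  refine Measurable.prodMk (measurable_pi_iff.mpr fun j => ?_) (measurable_pi_iff.mpr fun j => ?_)
  all_goals
    rcases eq_or_ne j i with rfl | hj
    · simp only [Function.update_self]; fun_prop
    · simp only [Function.update_of_ne hj, Function.comp_apply]; fun_prop

theorem measurable_event_mul (h : IsRegular X P β K π Z I haz) {i : ι}
    {Ψ : ℝ → E → (ι → Ω) → ENNReal} (hΨ : OmitsCoord i Ψ) :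
    Measurable fun ω : ι → Ω =>
      ENNReal.ofReal (X.event (ω i)) * Ψ (X.time (ω i)) (π (ω i)) ω :=
  ((h.measurable_event.comp (measurable_pi_apply i)).ennreal_ofReal).mul
    (hΨ.measurable.comp ((h.measurable_time.comp (measurable_pi_apply i)).prodMk
      ((h.measurable_proj.comp (measurable_pi_apply i)).prodMk measurable_id)))

theorem measurable_compensator_integrand (h : IsRegular X P β K π Z I haz) {i : ι}
    {Ψ : ℝ → E → (ι → Ω) → ENNReal} (hΨ : OmitsCoord i Ψ) :
    Measurable fun q : (ι → Ω) × ℝ => ENNReal.ofReal (X.atRisk q.2 (q.1 i)) *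
      (Ψ q.2 (π (q.1 i)) q.1 * ENNReal.ofReal (haz q.2 * Real.exp (β ⬝ᵥ Z q.2 (π (q.1 i))))) := by
  have hcoord : Measurable fun q : (ι → Ω) × ℝ => q.1 i := by fun_prop
  have hproj := h.measurable_proj.comp hcoord
  exact ((h.measurable_atRisk.comp (measurable_snd.prodMk hcoord)).ennreal_ofReal).mul
    ((hΨ.measurable.comp (measurable_snd.prodMk (hproj.prodMk measurable_fst))).mul
      (h.measurable_rate.comp (measurable_snd.prodMk hproj)))

variable [Fintype ι]

theorem measurable_pastProd (h : IsRegular X P β K π Z I haz) (k : Fin p) (θ b : ℝ) (i : ι) :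
    Measurable fun q : ℝ × E × (ι → Ω) => pastProd X β π Z k θ b i q.1 q.2.1 q.2.2 := by
  have htime : ∀ j, Measurable fun q : ℝ × E × (ι → Ω) => X.time (q.2.2 j) := fun j =>
    h.measurable_time.comp (by fun_prop)
  refine Finset.measurable_fun_prod _ fun j _ => Measurable.ite
    (measurableSet_lt (htime j) measurable_fst) ?_ measurable_const
  refine Real.measurable_exp.comp ((h.measurable_event.comp (by fun_prop)).mul ?_)
  exact (measurable_exponent Z β k h.measurable_cov θ b j).comp
    ((htime j).prodMk (h.measurable_update_time_proj i))

theorem omitsCoord_pastProd (h : IsRegular X P β K π Z I haz) (k : Fin p) (θ b : ℝ) (i : ι) :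
    OmitsCoord i fun s x ω => ENNReal.ofReal (pastProd X β π Z k θ b i s x ω) where
  measurable := (h.measurable_pastProd k θ b i).ennreal_ofReal
  update_eq s x ω y := by rw [pastProd_update]

theorem omitsCoord_pastProd_mul_jumpFactor (h : IsRegular X P β K π Z I haz) (k : Fin p)
    (θ b : ℝ) (i : ι) :
    OmitsCoord i fun s x ω => ENNReal.ofReal (pastProd X β π Z k θ b i s x ω *
      jumpFactor X β π Z k θ b i s x ω) where
  measurable := ((h.measurable_pastProd k θ b i).mul
    (Real.measurable_exp.comp ((measurable_exponent Z β k h.measurable_cov θ b i).comp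
      (measurable_fst.prodMk (h.measurable_update_time_proj i))))).ennreal_ofReal
  update_eq s x ω y := by rw [pastProd_update, jumpFactor_update]

variable [IsProbabilityMeasure P]

theorem lintegral_pi_event_mul (h : IsRegular X P β K π Z I haz) {i : ι}
    {Ψ : ℝ → E → (ι → Ω) → ENNReal} (hΨ : OmitsCoord i Ψ) :
    ∫⁻ ω, ENNReal.ofReal (X.event (ω i)) * Ψ (X.time (ω i)) (π (ω i)) ω
        ∂(Measure.pi fun _ => P) =
      ∫⁻ ω, (∫⁻ s in I, ENNReal.ofReal (X.atRisk s (ω i)) * (Ψ s (π (ω i)) ω *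
        ENNReal.ofReal (haz s * Real.exp (β ⬝ᵥ Z s (π (ω i)))))) ∂(Measure.pi fun _ => P) := by
  rw [lintegral_pi_eq_lintegral_update (fun _ => P) i (h.measurable_event_mul hΨ),
    lintegral_pi_eq_lintegral_update (fun _ => P) i
      (h.measurable_compensator_integrand hΨ).lintegral_prod_right']
  refine lintegral_congr fun ω => ?_
  simp only [Function.update_self, hΨ.update_eq]
  exact h.compensator (fun s e => Ψ s e ω)
    (hΨ.measurable.comp (measurable_fst.prodMk (measurable_snd.prodMk measurable_const)))

theorem lintegral_pi_sum_event_mul (h : IsRegular X P β K π Z I haz)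
    {Ψ : ι → ℝ → E → (ι → Ω) → ENNReal} (hΨ : ∀ i, OmitsCoord i (Ψ i)) :
    ∫⁻ ω, ∑ i, ENNReal.ofReal (X.event (ω i)) * Ψ i (X.time (ω i)) (π (ω i)) ω
        ∂(Measure.pi fun _ => P) =
      ∫⁻ ω, (∫⁻ s in I, ∑ i, ENNReal.ofReal (X.atRisk s (ω i)) * (Ψ i s (π (ω i)) ω *
        ENNReal.ofReal (haz s * Real.exp (β ⬝ᵥ Z s (π (ω i)))))) ∂(Measure.pi fun _ => P) := by
  have hmeas := fun i => h.measurable_compensator_integrand (hΨ i)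
  rw [lintegral_finsetSum _ fun i _ => h.measurable_event_mul (hΨ i),
    Finset.sum_congr rfl fun i _ => h.lintegral_pi_event_mul (hΨ i),
    ← lintegral_finsetSum _ fun i _ => (hmeas i).lintegral_prod_right']
  exact lintegral_congr fun ω =>
    (lintegral_finsetSum _ fun i _ => (hmeas i).comp measurable_prodMk_left).symm

/-- The expectation of a process starting at `1` that jumps from `Ψ₀` to `Ψ₁` at the failures, when
the compensator of its jumps is nonpositive. -/
theorem lintegral_le_one_of_compensator_le (h : IsRegular X P β K π Z I haz)
    {W : (ι → Ω) → ENNReal} {Ψ₀ Ψ₁ : ι → ℝ → E → (ι → Ω) → ENNReal}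
    (hΨ₀ : ∀ i, OmitsCoord i (Ψ₀ i)) (hΨ₁ : ∀ i, OmitsCoord i (Ψ₁ i))
    {C : NNReal} (hC : ∀ i s x ω, Ψ₀ i s x ω ≤ C)
    (hjumps : ∀ᵐ ω ∂(Measure.pi fun _ : ι => P),
      W ω + ∑ i, ENNReal.ofReal (X.event (ω i)) * Ψ₀ i (X.time (ω i)) (π (ω i)) ω =
      1 + ∑ i, ENNReal.ofReal (X.event (ω i)) * Ψ₁ i (X.time (ω i)) (π (ω i)) ω)
    (hle : ∀ ω s, ∑ i, ENNReal.ofReal (X.atRisk s (ω i)) * (Ψ₁ i s (π (ω i)) ω *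
        ENNReal.ofReal (haz s * Real.exp (β ⬝ᵥ Z s (π (ω i))))) ≤
      ∑ i, ENNReal.ofReal (X.atRisk s (ω i)) * (Ψ₀ i s (π (ω i)) ω *
        ENNReal.ofReal (haz s * Real.exp (β ⬝ᵥ Z s (π (ω i)))))) :
    ∫⁻ ω, W ω ∂(Measure.pi fun _ : ι => P) ≤ 1 := by
  have htotal := lintegral_congr_ae hjumps
  rw [lintegral_add_right _ (Finset.measurable_fun_sum _ fun i _ => h.measurable_event_mul (hΨ₀ i)),
    lintegral_add_right _ (Finset.measurable_fun_sum _ fun i _ => h.measurable_event_mul (hΨ₁ i)),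
    lintegral_const, measure_univ, mul_one] at htotal
  have hcomp : ∫⁻ ω, ∑ i, ENNReal.ofReal (X.event (ω i)) * Ψ₁ i (X.time (ω i)) (π (ω i)) ω
        ∂(Measure.pi fun _ : ι => P) ≤
      ∫⁻ ω, ∑ i, ENNReal.ofReal (X.event (ω i)) * Ψ₀ i (X.time (ω i)) (π (ω i)) ω
        ∂(Measure.pi fun _ : ι => P) := by
    rw [h.lintegral_pi_sum_event_mul hΨ₀, h.lintegral_pi_sum_event_mul hΨ₁]
    exact lintegral_mono fun ω => lintegral_mono fun s => hle ω s
  have hfin : ∫⁻ ω, ∑ i, ENNReal.ofReal (X.event (ω i)) * Ψ₀ i (X.time (ω i)) (π (ω i)) ω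
      ∂(Measure.pi fun _ : ι => P) ≠ ⊤ := by
    refine ne_top_of_le_ne_top (b := ∫⁻ _, ∑ _i : ι, (1 * C : ENNReal)
      ∂(Measure.pi fun _ : ι => P)) (by simp [ENNReal.mul_eq_top])
      (lintegral_mono fun ω => Finset.sum_le_sum fun i _ => mul_le_mul' ?_ (hC i _ _ ω))
    exact ENNReal.ofReal_le_one.mpr (event_le_one X (ω i))
  exact (ENNReal.add_le_add_iff_right hfin).mp (htotal.le.trans (add_le_add le_rfl hcomp))

end OmitsCoord

variable [Fintype ι]

theorem ae_time_ne [IsProbabilityMeasure P] (h : IsRegular X P β K π Z I haz) {i j : ι}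
    (hij : i ≠ j) :
    ∀ᵐ ω ∂(Measure.pi fun _ : ι => P), X.time (ω i) ≠ X.time (ω j) := by
  classical
  have hms : MeasurableSet {ω : ι → Ω | X.time (ω i) = X.time (ω j)} :=
    measurableSet_eq_fun (h.measurable_time.comp (measurable_pi_apply i))
      (h.measurable_time.comp (measurable_pi_apply j))
  have hslice : ∀ (ω : ι → Ω) x, {ω : ι → Ω | X.time (ω i) = X.time (ω j)}.indicator
      (1 : (ι → Ω) → ENNReal) (Function.update ω i x) =
      {x | X.time x = X.time (ω j)}.indicator 1 x := fun ω x => by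
    simp [Set.indicator, Function.update_of_ne hij.symm]
  simp only [ae_iff, ne_eq, not_not]
  rw [← lintegral_indicator_one hms,
    lintegral_pi_eq_lintegral_update (fun _ => P) i (measurable_one.indicator hms)]
  refine (lintegral_congr fun ω => ?_).trans lintegral_zero
  simp_rw [hslice]
  rw [lintegral_indicator_one (measurableSet_eq_fun h.measurable_time measurable_const)]
  exact h.measure_time_eq _

theorem ae_injective_time [IsProbabilityMeasure P] (h : IsRegular X P β K π Z I haz) :
    ∀ᵐ ω ∂(Measure.pi fun _ : ι => P), Function.Injective (X.time ∘ ω) := by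
  have hne : ∀ᵐ ω ∂(Measure.pi fun _ : ι => P), ∀ i j, i ≠ j → X.time (ω i) ≠ X.time (ω j) :=
    ae_all_iff.mpr fun i => ae_all_iff.mpr fun j => ae_all_iff.mpr fun hij => h.ae_time_ne hij
  filter_upwards [hne] with ω hω i j hij
  by_contra hne
  exact hω i j hne hij

theorem lintegral_prod_exp_exponent_le_one [IsProbabilityMeasure P]
    (h : IsRegular X P β K π Z I haz) (k : Fin p) (θ : ℝ) :
    ∫⁻ ω, ENNReal.ofReal (∏ j, Real.exp (X.event (ω j) * exponent Z β k θ (2 * K)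
      (X.time (ω j)) (X.time ∘ ω) (π ∘ ω) j)) ∂(Measure.pi fun _ : ι => P) ≤ 1 := by
  classical
  have hpast := pastProd_nonneg (ι := ι) X β π Z k θ (2 * K)
  have hjump := jumpFactor_nonneg (ι := ι) X β π Z k θ (2 * K)
  refine h.lintegral_le_one_of_compensator_le (h.omitsCoord_pastProd k θ (2 * K))
    (h.omitsCoord_pastProd_mul_jumpFactor k θ (2 * K))
    (fun i s x ω => ENNReal.ofReal_le_ofReal (pastProd_le X β π Z k θ (2 * K) h.bound i s x ω)) ?_
    fun ω s => ?_
  · filter_upwards [h.ae_injective_time (ι := ι)] with ω hω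
    have hevent := fun i => event_nonneg X (ω i)
    have hjumps := congrArg ENNReal.ofReal (prod_exp_exponent_add_sum X β π Z k θ (2 * K) hω)
    rwa [ENNReal.ofReal_add (Finset.prod_nonneg fun j _ => (Real.exp_pos _).le)
        (Finset.sum_nonneg fun i _ => mul_nonneg (hevent i) (hpast _ _ _ _)),
      ENNReal.ofReal_add zero_le_one (Finset.sum_nonneg fun i _ =>
        mul_nonneg (hevent i) (mul_nonneg (hpast _ _ _ _) (hjump _ _ _ _))),
      ofReal_sum_mul _ hevent fun i => hpast _ _ _ _,
      ofReal_sum_mul _ hevent fun i => mul_nonneg (hpast _ _ _ _) (hjump _ _ _ _),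
      ENNReal.ofReal_one] at hjumps
  · have hrate : ∀ i, 0 ≤ haz s * Real.exp (β ⬝ᵥ Z s (π (ω i))) := fun i =>
      mul_nonneg (h.haz_nonneg s) (Real.exp_pos _).le
    have hrisk := ENNReal.ofReal_le_ofReal
      (sum_atRisk_pastProd_mul_jumpFactor_le X β π Z k θ h.bound s (h.haz_nonneg s) ω)
    rw [ofReal_sum_mul _ (fun i => atRisk_nonneg X s (ω i)) fun i =>
        mul_nonneg (mul_nonneg (hpast _ _ _ _) (hjump _ _ _ _)) (hrate i),
      ofReal_sum_mul _ (fun i => atRisk_nonneg X s (ω i)) fun i =>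
        mul_nonneg (hpast _ _ _ _) (hrate i)] at hrisk
    simpa only [ENNReal.ofReal_mul (mul_nonneg (hpast _ _ _ _) (hjump _ _ _ _)),
      ENNReal.ofReal_mul (hpast _ _ _ _)] using hrisk

theorem natCast_mul_score_eq (h : IsRegular X P β K π Z I haz) (ω : Fin n → Ω) (k : Fin p) :
    n * score X ω β k = ∑ i, X.event (ω i) * (Z (X.time (ω i)) (π (ω i)) k -
      riskMean Z β k (X.time (ω i)) (X.time ∘ ω) (π ∘ ω)) := by
  rcases Nat.eq_zero_or_pos n with rfl | hn
  · simp
  have hn' : (n : ℝ) ≠ 0 := by positivity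
  simp only [score, Triple.integralN, h.zbar_eq_riskMean, h.covariate_eq]
  field_simp

theorem lintegral_exp_score_le_one [IsProbabilityMeasure P]
    (h : IsRegular X P β K π Z I haz) (k : Fin p) (θ : ℝ) :
    ∫⁻ ω, ENNReal.ofReal (Real.exp (θ * (n * score X ω β k) - n * ((θ * (2 * K)) ^ 2 / 2)))
      ∂(Measure.pi fun _ : Fin n => P) ≤ 1 := by
  refine (lintegral_mono fun ω => ENNReal.ofReal_le_ofReal ?_).trans
    (h.lintegral_prod_exp_exponent_le_one k θ)
  have hconst : (n : ℝ) * ((θ * (2 * K)) ^ 2 / 2) = ∑ _i : Fin n, (θ * (2 * K)) ^ 2 / 2 := by simp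
  rw [← Real.exp_sum, Real.exp_le_exp, h.natCast_mul_score_eq, hconst, Finset.mul_sum,
    ← Finset.sum_sub_distrib]
  refine Finset.sum_le_sum fun i _ => ?_
  have hsq := sq_nonneg (θ * (2 * K))
  simp only [exponent, Function.comp_apply]
  rcases event_eq_zero_or_one X (ω i) with hd | hd <;> rw [hd] <;> linarith

end IsRegular

/-! ### A regular version of the covariate process -/

/-- The sample space with the σ-algebra generated by the covariate process. It is a separate type,
so that the canonical map into it generates that σ-algebra on the original sample space. -/
structure CovSpace {Ω : Type*} {p : ℕ} [MeasurableSpace Ω] (X : Triple Ω p) (P : Measure Ω) where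
  toCov ::
  point : Ω

instance {Ω : Type*} {p : ℕ} [MeasurableSpace Ω] (X : Triple Ω p) (P : Measure Ω) :
    MeasurableSpace (CovSpace X P) :=
  MeasurableSpace.comap CovSpace.point (X.covariateSigma P)

/-- Truncation to `[-K, K]`. -/
def clip (K x : ℝ) : ℝ := max (-K) (min K x)

theorem abs_clip_le {K : ℝ} (hK : 0 ≤ K) (x : ℝ) : |clip K x| ≤ K :=
  abs_le.mpr ⟨le_max_left _ _, max_le (by linarith) (min_le_left _ _)⟩

theorem clip_of_abs_le {K x : ℝ} (h : |x| ≤ K) : clip K x = x := by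
  rw [clip, min_eq_right (abs_le.mp h).2, max_eq_right (abs_le.mp h).1]

theorem continuous_clip (K : ℝ) : Continuous (clip K) :=
  continuous_const.max (continuous_const.min continuous_id)

theorem tendsto_natFloor_mul_add_one_div {t : ℝ} (ht : 0 ≤ t) :
    Tendsto (fun m : ℕ => (⌊t * ((m : ℝ) + 1)⌋₊ : ℝ) / ((m : ℝ) + 1)) atTop (𝓝 t) :=
  (tendsto_nat_floor_mul_div_atTop ht).comp
    (tendsto_atTop_add_const_right _ _ tendsto_natCast_atTop_atTop)

section Triple

variable {Ω : Type*} [MeasurableSpace Ω] {p : ℕ} {X : Triple Ω p} {P : Measure Ω}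

/-- Almost surely, the covariate paths are left-continuous on the time index set. -/
def Triple.LeftContinuousCovariates (X : Triple Ω p) (P : Measure Ω) : Prop :=
  ∀ᵐ ω ∂P, ∀ t ∈ X.timeSet P,
    ContinuousWithinAt (fun s => X.covariate s ω) (X.timeSet P ∩ Set.Iic t) t

theorem Triple.LipschitzCovariates.leftContinuousCovariates {L : ℝ}
    (hL : X.LipschitzCovariates P L) : X.LeftContinuousCovariates P := by
  filter_upwards [hL] with ω hω t ht
  refine continuousWithinAt_pi.mpr fun j => ?_
  rw [ContinuousWithinAt, tendsto_iff_dist_tendsto_zero]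
  have hbound : Tendsto (fun s : ℝ => L * |s - t|) (𝓝[X.timeSet P ∩ Set.Iic t] t) (𝓝 0) := by
    refine (Continuous.tendsto' ?_ t 0 (by simp)).mono_left nhdsWithin_le_nhds
    fun_prop
  refine squeeze_zero' (Eventually.of_forall fun _ => dist_nonneg) ?_ hbound
  filter_upwards [self_mem_nhdsWithin] with s hs
  exact hω s hs.1 t ht j

theorem Triple.BoundedDensity.measure_time_eq {C : ℝ} (hD : X.BoundedDensity P C)
    (hm : Measurable X.time) (t : ℝ) : P {ω | X.time ω = t} = 0 := by
  obtain ⟨f, -, -, hmap⟩ := hD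
  have hsingleton : P {ω | X.time ω = t} = P.map X.time {t} :=
    (Measure.map_apply hm (measurableSet_singleton t)).symm
  rw [hsingleton, hmap]
  exact withDensity_absolutelyContinuous _ _ (by simp)

theorem Triple.IsCoxModel.measurable_time {β : Fin p → ℝ} {haz : ℝ → ℝ}
    (hX : X.IsCoxModel P β haz) : Measurable X.time :=
  hX.measurable_failure.min hX.measurable_censor

theorem Triple.IsCoxModel.time_nonneg {β : Fin p → ℝ} {haz : ℝ → ℝ}
    (hX : X.IsCoxModel P β haz) (ω : Ω) : 0 ≤ X.time ω :=
  le_min (hX.failure_nonneg ω) (hX.censor_nonneg ω)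

theorem mem_timeSet_of_le {s t : ℝ} (ht : t ∈ X.timeSet P) (hs : 0 ≤ s) (hst : s ≤ t) :
    s ∈ X.timeSet P :=
  ⟨hs, (EReal.coe_le_coe_iff.mpr hst).trans ht.2⟩

theorem ico_tPlus_subset_timeSet : ico (X.tPlus P) ⊆ X.timeSet P := fun _ h => ⟨h.1, h.2.le⟩

variable (X P) in
theorem ae_time_le_tPlus [IsProbabilityMeasure P] (hm : Measurable X.time) :
    ∀ᵐ ω ∂P, (X.time ω : EReal) ≤ X.tPlus P := by
  have hrat : ∀ᵐ ω ∂P, ∀ q : {q : ℚ // X.tPlus P < ((q : ℝ) : EReal)}, X.time ω ≤ (q : ℚ) := by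
    refine ae_all_iff.mpr fun q => ?_
    obtain ⟨_, ⟨t, ⟨-, ht⟩, rfl⟩, htq⟩ := sInf_lt_iff.mp q.2
    have hle : ∀ᵐ ω ∂P, ω ∈ {ω | X.time ω ≤ t} :=
      (mem_ae_iff_prob_eq_one (measurableSet_le hm measurable_const)).mpr ht
    filter_upwards [hle] with ω hω using hω.trans (EReal.coe_le_coe_iff.mp htq.le)
  filter_upwards [hrat] with ω hω
  by_contra hlt
  obtain ⟨q, hq, hqtime⟩ := EReal.exists_rat_btwn_of_lt (not_le.mp hlt)
  exact (EReal.coe_lt_coe_iff.mp hqtime).not_ge (hω ⟨q, hq⟩)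

variable (X P) in
theorem ae_time_mem_ico [IsProbabilityMeasure P] (hm : Measurable X.time)
    (h0 : ∀ ω, 0 ≤ X.time ω) (hna : ∀ t, P {ω | X.time ω = t} = 0) :
    ∀ᵐ ω ∂P, X.time ω ∈ ico (X.tPlus P) := by
  have hne : ∀ᵐ ω ∂P, X.time ω ≠ (X.tPlus P).toReal := by
    rw [ae_iff]; simpa using hna _
  filter_upwards [ae_time_le_tPlus X P hm, hne] with ω hle hne
  exact ⟨h0 ω, lt_of_le_of_ne hle fun h => hne (by rw [← h, EReal.toReal_coe])⟩

end Triple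

section RegularCovariates

variable {Ω : Type*} [MeasurableSpace Ω] {p : ℕ} (X : Triple Ω p) (P : Measure Ω) (K : ℝ)

open Classical in
/-- The truncated covariate process at the grid point `k / (m + 1)`, and `0` if that point is not
in the time index set. -/
def gridCov (m : ℕ) (j : Fin p) (k : ℕ) (e : CovSpace X P) : ℝ :=
  if ((k : ℝ) / (m + 1)) ∈ X.timeSet P then
    clip K (X.covariate ((k : ℝ) / (m + 1)) e.point j) else 0

/-- A version of the covariate process that is bounded everywhere and jointly measurable for the
σ-algebra that the process generates: the limit of the process along the grid points to the left
of `s`. -/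
def regCov (s : ℝ) (e : CovSpace X P) (j : Fin p) : ℝ :=
  clip K (limsup (fun m : ℕ => gridCov X P K m j ⌊s * (m + 1)⌋₊ e) atTop)

theorem measurable_gridCov (m : ℕ) (j : Fin p) (k : ℕ) : Measurable (gridCov X P K m j k) := by
  unfold gridCov
  split_ifs with hk
  · have hcov : Measurable[X.covariateSigma P] (X.covariate ((k : ℝ) / (m + 1))) :=
      Measurable.of_comap_le (le_iSup₂_of_le (f := fun t (_ : t ∈ X.timeSet P) =>
        MeasurableSpace.comap (X.covariate t) inferInstance) _ hk le_rfl)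
    exact (continuous_clip K).measurable.comp
      ((measurable_pi_apply j).comp fun s hs => ⟨_, hcov hs, rfl⟩)
  · exact measurable_const

theorem measurable_regCov : Measurable fun q : ℝ × CovSpace X P => regCov X P K q.1 q.2 := by
  refine measurable_pi_iff.mpr fun j =>
    (continuous_clip K).measurable.comp (Measurable.limsup fun m => ?_)
  have hgrid : Measurable (Function.uncurry (gridCov X P K m j)) :=
    measurable_from_prod_countable_right (measurable_gridCov X P K m j)
  exact hgrid.comp ((measurable_fst.mul_const _).nat_floor.prodMk measurable_snd)

theorem abs_regCov_le (hK : 0 ≤ K) (s : ℝ) (e : CovSpace X P) (j : Fin p) :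
    |regCov X P K s e j| ≤ K := abs_clip_le hK _

variable {X P K}

theorem ae_abs_covariate_grid_le (hB : X.BoundedCovariates P K) :
    ∀ᵐ ω ∂P, ∀ m k : ℕ, ((k : ℝ) / (m + 1)) ∈ X.timeSet P →
      ∀ j, |X.covariate ((k : ℝ) / (m + 1)) ω j| ≤ K :=
  ae_all_iff.mpr fun _ => ae_all_iff.mpr fun _ => eventually_imp_distrib_left.mpr (hB _)

theorem ae_regCov_eq (hB : X.BoundedCovariates P K) (hL : X.LeftContinuousCovariates P) :
    ∀ᵐ ω ∂P, ∀ t ∈ X.timeSet P, regCov X P K t ⟨ω⟩ = X.covariate t ω := by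
  filter_upwards [ae_abs_covariate_grid_le hB, hL] with ω hbound hleft t ht
  funext j
  set q : ℕ → ℝ := fun m => (⌊t * ((m : ℝ) + 1)⌋₊ : ℝ) / ((m : ℝ) + 1) with hq
  have hq_le (m : ℕ) : q m ≤ t := by
    rw [hq, div_le_iff₀ (by positivity)]
    exact Nat.floor_le (mul_nonneg ht.1 (by positivity))
  have hq_mem (m : ℕ) : q m ∈ X.timeSet P := mem_timeSet_of_le ht (by positivity) (hq_le m)
  have hlim : Tendsto (fun m => X.covariate (q m) ω j) atTop (𝓝 (X.covariate t ω j)) :=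
    (tendsto_pi_nhds.mp (hleft t ht) j).comp (tendsto_nhdsWithin_iff.mpr
      ⟨tendsto_natFloor_mul_add_one_div ht.1, Eventually.of_forall fun m => ⟨hq_mem m, hq_le m⟩⟩)
  have hK : |X.covariate t ω j| ≤ K := le_of_tendsto' hlim.abs fun m => hbound m _ (hq_mem m) j
  have hgrid (m : ℕ) : gridCov X P K m j ⌊t * ((m : ℝ) + 1)⌋₊ ⟨ω⟩ = X.covariate (q m) ω j := by
    rw [gridCov, if_pos (hq_mem m), clip_of_abs_le (hbound m _ (hq_mem m) j)]
  simp_rw [regCov, hgrid]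
  rw [hlim.limsup_eq, clip_of_abs_le hK]

end RegularCovariates

section RegularModel

variable {Ω : Type*} [MeasurableSpace Ω] {p : ℕ} {X : Triple Ω p} {P : Measure Ω} {K : ℝ}
  {β : Fin p → ℝ} {haz haz' : ℝ → ℝ}

theorem comap_toCov :
    MeasurableSpace.comap (CovSpace.toCov (X := X) (P := P)) inferInstance =
      X.covariateSigma P := by
  change MeasurableSpace.comap _ (MeasurableSpace.comap CovSpace.point _) = _
  rw [MeasurableSpace.comap_comp]
  exact MeasurableSpace.comap_id

theorem Triple.IsCoxModel.measurable_toCov (hX : X.IsCoxModel P β haz) :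
    Measurable (CovSpace.toCov (X := X) (P := P)) := by
  rw [measurable_iff_comap_le, comap_toCov]
  exact iSup₂_le fun t _ =>
    Measurable.comap_le (hX.measurable_covariate.comp measurable_prodMk_left)

theorem exists_measurable_hazard {τ : EReal} (h0 : ∀ t, 0 ≤ haz t)
    (hinteg : ∀ t ∈ ico τ, IntegrableOn haz (Set.Icc 0 t)) :
    ∃ haz' : ℝ → ℝ, Measurable haz' ∧ (∀ t, 0 ≤ haz' t) ∧
      haz' =ᵐ[volume.restrict (ico τ)] haz := by
  have hae : AEMeasurable haz (volume.restrict (ico τ)) := by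
    rw [ico_eq_iUnion, aemeasurable_iUnion_iff]
    exact fun q => (hinteg _ q.2).aemeasurable
  refine ⟨fun t => max 0 (hae.mk haz t), measurable_const.max hae.measurable_mk,
    fun t => le_max_left _ _, ?_⟩
  filter_upwards [hae.ae_eq_mk] with t ht
  rw [← ht, max_eq_right (h0 t)]

variable (X P β) in
theorem measurable_dotProduct_regCov :
    Measurable fun q : ℝ × CovSpace X P => β ⬝ᵥ regCov X P K q.1 q.2 :=
  Finset.measurable_fun_sum _ fun l _ =>
    ((measurable_pi_apply l).comp (measurable_regCov X P K)).const_mul _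

theorem integrableOn_mul_exp_dotProduct_regCov (hK : 0 ≤ K) {s : Set ℝ}
    (hinteg : IntegrableOn haz s) (e : CovSpace X P) :
    IntegrableOn (fun t => haz t * Real.exp (β ⬝ᵥ regCov X P K t e)) s := by
  refine Integrable.mul_bdd (c := Real.exp (l1 β * K)) hinteg ?_ (Eventually.of_forall fun t => ?_)
  · exact (Real.continuous_exp.measurable.comp
      ((measurable_dotProduct_regCov X P β).comp measurable_prodMk_right)).aestronglyMeasurable
  · rw [Real.norm_of_nonneg (Real.exp_pos _).le]
    exact Real.exp_le_exp.mpr ((le_abs_self _).trans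
      (abs_dotProduct_le β (abs_regCov_le X P K hK t e)))

theorem Triple.IsCoxModel.condExp_failure_gt_eq_exp_regCov (hX : X.IsCoxModel P β haz)
    (hreg : ∀ᵐ ω ∂P, ∀ t ∈ X.timeSet P, regCov X P K t ⟨ω⟩ = X.covariate t ω)
    (hhaz : haz' =ᵐ[volume.restrict (ico (X.tPlus P))] haz) {t : ℝ} (ht : t ∈ ico (X.tPlus P)) :
    P[{ω | t < X.failure ω}.indicator (fun _ => (1 : ℝ)) | X.covariateSigma P] =ᵐ[P]
      fun ω => Real.exp (-∫ s in (0 : ℝ)..t, haz' s * Real.exp (β ⬝ᵥ regCov X P K s ⟨ω⟩)) := by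
  filter_upwards [hX.hazard t ht.1 ht.2, hreg] with ω hsurv hcov
  rw [hsurv]
  congr 2
  refine intervalIntegral.integral_congr_ae ?_
  rw [Set.uIoc_of_le ht.1]
  have hsub : Set.Ioc 0 t ⊆ ico (X.tPlus P) := Set.Ioc_subset_Icc_self.trans (Icc_subset_ico ht)
  filter_upwards [(ae_restrict_iff' (measurableSet_ico _)).mp hhaz] with s hs hst
  rw [hs (hsub hst), hcov s (ico_tPlus_subset_timeSet (hsub hst))]

theorem lintegral_event_mul_eq_lintegral_indicator [IsProbabilityMeasure P]
    (hX : X.IsCoxModel P β haz) (hna : ∀ t, P {ω | X.time ω = t} = 0) (g : ℝ → Ω → ENNReal) :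
    ∫⁻ ω, ENNReal.ofReal (X.event ω) * g (X.time ω) ω ∂P =
      ∫⁻ ω, {ω | X.failure ω ≤ X.censor ω ∧ X.failure ω ∈ ico (X.tPlus P)}.indicator
        (fun ω => g (X.failure ω) ω) ω ∂P := by
  refine lintegral_congr_ae ?_
  filter_upwards [ae_time_mem_ico X P hX.measurable_time hX.time_nonneg hna] with ω hω
  simp only [Triple.event, Triple.time, Set.indicator, Set.mem_ofPred_eq] at hω ⊢
  by_cases hle : X.failure ω ≤ X.censor ω
  · rw [min_eq_left hle] at hω ⊢
    simp [hle, hω]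
  · simp [hle]

variable (X P K) in
/-- The triple with the regular version `regCov` of the covariate process. -/
def regTriple : Triple Ω p where
  failure := X.failure
  censor := X.censor
  covariate := fun t ω => regCov X P K t ⟨ω⟩

theorem lintegral_event_mul_regTriple [IsProbabilityMeasure P] (hK : 0 ≤ K)
    (hX : X.IsCoxModel P β haz) (hna : ∀ t, P {ω | X.time ω = t} = 0)
    (hreg : ∀ᵐ ω ∂P, ∀ t ∈ X.timeSet P, regCov X P K t ⟨ω⟩ = X.covariate t ω)
    (hm : Measurable haz') (h0 : ∀ t, 0 ≤ haz' t)
    (hhaz : haz' =ᵐ[volume.restrict (ico (X.tPlus P))] haz)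
    {g : ℝ → CovSpace X P → ENNReal} (hg : Measurable (Function.uncurry g)) :
    ∫⁻ ω, ENNReal.ofReal ((regTriple X P K).event ω) * g ((regTriple X P K).time ω) ⟨ω⟩ ∂P =
      ∫⁻ ω, (∫⁻ s in ico (X.tPlus P), ENNReal.ofReal ((regTriple X P K).atRisk s ω) *
        (g s ⟨ω⟩ * ENNReal.ofReal (haz' s * Real.exp (β ⬝ᵥ regCov X P K s ⟨ω⟩)))) ∂P := by
  have hrate : Measurable (Function.uncurry fun (s : ℝ) (e : CovSpace X P) =>
      haz' s * Real.exp (β ⬝ᵥ regCov X P K s e)) :=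
    (hm.comp measurable_fst).mul
      (Real.continuous_exp.measurable.comp (measurable_dotProduct_regCov X P β))
  have hinteg (e : CovSpace X P) (t : ℝ) (ht : t ∈ ico (X.tPlus P)) : IntegrableOn
      (fun s => haz' s * Real.exp (β ⬝ᵥ regCov X P K s e)) (Set.Icc 0 t) :=
    integrableOn_mul_exp_dotProduct_regCov hK ((hX.haz_integrable t ht.1 ht.2).congr
      (EventuallyEq.symm (ae_restrict_of_ae_restrict_of_subset (Icc_subset_ico ht) hhaz))) e
  refine (lintegral_event_mul_eq_lintegral_indicator hX hna fun s ω => g s ⟨ω⟩).trans ?_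
  rw [lintegral_event_eq_lintegral_hazard hX.measurable_toCov hX.measurable_failure
    hX.measurable_censor hX.failure_nonneg hrate
    (fun s e => mul_nonneg (h0 s) (Real.exp_pos _).le) hinteg
    (by rw [comap_toCov]; exact hX.condIndep)
    (by rw [comap_toCov]; exact fun t ht => hX.condExp_failure_gt_eq_exp_regCov hreg hhaz ht) hg]
  refine lintegral_congr fun ω => lintegral_congr fun s => ?_
  simp only [Set.indicator, Set.mem_ofPred_eq, Triple.atRisk, Triple.time, regTriple, le_min_iff]
  split_ifs <;> simp

theorem exists_isRegular_regTriple [IsProbabilityMeasure P] (hK : 0 ≤ K)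
    (hX : X.IsCoxModel P β haz) (hB : X.BoundedCovariates P K)
    (hL : X.LeftContinuousCovariates P) (hna : ∀ t, P {ω | X.time ω = t} = 0) :
    ∃ haz' : ℝ → ℝ, IsRegular (regTriple X P K) P β K (CovSpace.toCov (X := X) (P := P))
      (regCov X P K) (ico (X.tPlus P)) haz' := by
  obtain ⟨haz', hm, h0, hhaz⟩ := exists_measurable_hazard hX.haz_nonneg
    fun t (ht : t ∈ ico (X.tPlus P)) => hX.haz_integrable t ht.1 ht.2
  exact ⟨haz', hX.measurable_failure, hX.measurable_censor, hX.measurable_toCov,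
    measurable_regCov X P K, fun _ _ => rfl, abs_regCov_le X P K hK, hna, hm, h0,
    fun _ hg => lintegral_event_mul_regTriple hK hX hna (ae_regCov_eq hB hL) hm h0 hhaz hg⟩

end RegularModel

/-! ### Sub-Gaussian tail bounds -/

theorem measure_lt_le_of_lintegral_exp_le_one {S : Type*} [MeasurableSpace S] {Q : Measure S}
    {f : S → ℝ} (hf : Measurable f) (h : ∫⁻ ω, ENNReal.ofReal (Real.exp (f ω)) ∂Q ≤ 1) (a : ℝ) :
    Q {ω | a < f ω} ≤ ENNReal.ofReal (Real.exp (-a)) := by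
  have hm : Measurable fun ω => ENNReal.ofReal (Real.exp (f ω)) :=
    (Real.continuous_exp.measurable.comp hf).ennreal_ofReal
  have hpos : ENNReal.ofReal (Real.exp a) ≠ 0 := by simp [Real.exp_pos]
  calc Q {ω | a < f ω}
      ≤ Q {ω | ENNReal.ofReal (Real.exp a) ≤ ENNReal.ofReal (Real.exp (f ω))} :=
        measure_mono fun ω (hω : a < f ω) =>
          ENNReal.ofReal_le_ofReal (Real.exp_le_exp.mpr hω.le)
    _ ≤ (∫⁻ ω, ENNReal.ofReal (Real.exp (f ω)) ∂Q) / ENNReal.ofReal (Real.exp a) :=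
        meas_ge_le_lintegral_div hm.aemeasurable hpos ENNReal.ofReal_ne_top
    _ ≤ 1 / ENNReal.ofReal (Real.exp a) := by gcongr
    _ = ENNReal.ofReal (Real.exp (-a)) := by
        rw [one_div, ← ENNReal.ofReal_inv_of_pos (Real.exp_pos a), Real.exp_neg]

theorem measure_exists_le_card_mul {S ι : Type*} [MeasurableSpace S] [Fintype ι] {Q : Measure S}
    {A : ι → S → Prop} {c : ENNReal} (h : ∀ i, Q {ω | A i ω} ≤ c) :
    Q {ω | ∃ i, A i ω} ≤ Fintype.card ι * c := by
  rw [Set.ofPred_exists]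
  refine (measure_iUnion_fintype_le _ _).trans ((Finset.sum_le_sum fun i _ => h i).trans ?_)
  simp

/-- A self-normalised sub-Gaussian tail: `V` is a random proxy for the variance of `f`. -/
theorem measure_le_and_lt_abs_le {S : Type*} [MeasurableSpace S] {Q : Measure S} {f V : S → ℝ}
    (hf : Measurable f) (hV : Measurable V)
    (h : ∀ θ : ℝ, ∫⁻ ω, ENNReal.ofReal (Real.exp (θ * f ω - θ ^ 2 / 2 * V ω)) ∂Q ≤ 1)
    {v ℓ : ℝ} (hv : 0 < v) (hℓ : 0 < ℓ) (a : ℝ) :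
    Q {ω | V ω ≤ v ∧ (a + 1 / 2) * √(v * ℓ) < |f ω|} ≤
      2 * ENNReal.ofReal (Real.exp (-(a * ℓ))) := by
  -- the value that optimises `θ x - θ² v / 2` at `x = √(v ℓ)`
  set θ := √(ℓ / v)
  have hθ : 0 < θ := Real.sqrt_pos.mpr (by positivity)
  have hθsq : θ ^ 2 / 2 * v = ℓ / 2 := by
    rw [Real.sq_sqrt (by positivity)]; field_simp
  have hθr : θ * √(v * ℓ) = ℓ := by
    rw [← Real.sqrt_mul (by positivity), show ℓ / v * (v * ℓ) = ℓ * ℓ by field_simp,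
      Real.sqrt_mul_self hℓ.le]
  have htail (θ' : ℝ) := measure_lt_le_of_lintegral_exp_le_one
    ((hf.const_mul θ').sub (hV.const_mul (θ' ^ 2 / 2))) (h θ') (a * ℓ)
  refine (measure_mono fun ω hω => ?_).trans ((measure_union_le _ _).trans
    ((add_le_add (htail θ) (htail (-θ))).trans (two_mul _).ge))
  have hvar : θ ^ 2 / 2 * V ω ≤ ℓ / 2 := hθsq ▸ mul_le_mul_of_nonneg_left hω.1 (by positivity)
  have hdev {x : ℝ} (hx : (a + 1 / 2) * √(v * ℓ) < x) : (a + 1 / 2) * ℓ < θ * x := by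
    calc (a + 1 / 2) * ℓ = θ * ((a + 1 / 2) * √(v * ℓ)) := by rw [mul_left_comm, hθr]
      _ < θ * x := mul_lt_mul_of_pos_left hx hθ
  rcases lt_abs.mp hω.2 with hpos | hneg
  · left
    change a * ℓ < θ * f ω - θ ^ 2 / 2 * V ω
    linarith [hdev hpos]
  · right
    change a * ℓ < -θ * f ω - (-θ) ^ 2 / 2 * V ω
    rw [neg_sq]
    linarith [hdev hneg]

theorem lintegral_pi_exp_sum_le_one {ι : Type*} [Fintype ι] {Ω : ι → Type*}
    [∀ i, MeasurableSpace (Ω i)] (P : ∀ i, Measure (Ω i)) [∀ i, IsProbabilityMeasure (P i)]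
    (A : Finset ι) {f : ∀ i, Ω i → ℝ} (hf : ∀ i, Measurable (f i))
    (h : ∀ i, ∫⁻ x, ENNReal.ofReal (Real.exp (f i x)) ∂P i ≤ 1) :
    ∫⁻ ω, ENNReal.ofReal (Real.exp (∑ j ∈ A, f j (ω j))) ∂Measure.pi P ≤ 1 := by
  classical
  have hprod (ω : ∀ i, Ω i) : ENNReal.ofReal (Real.exp (∑ j ∈ A, f j (ω j))) =
      ∏ j, (fun x => if j ∈ A then ENNReal.ofReal (Real.exp (f j x)) else 1) (ω j) := by
    rw [Real.exp_sum, ENNReal.ofReal_prod_of_nonneg fun _ _ => (Real.exp_pos _).le,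
      Finset.prod_ite_mem, Finset.univ_inter]
  simp_rw [hprod]
  rw [lintegral_pi_prod P (f := fun j x => if j ∈ A then ENNReal.ofReal (Real.exp (f j x)) else 1)]
  · refine Finset.prod_le_one' fun j _ => ?_
    split_ifs
    · exact h j
    · simp
  · intro j
    split_ifs
    · exact (Real.continuous_exp.measurable.comp (hf j)).ennreal_ofReal
    · exact measurable_const

section IndependentCopies

variable {ι Ω : Type*} [Fintype ι] [MeasurableSpace Ω] {P : Measure Ω} [IsProbabilityMeasure P]

theorem measure_pi_lt_abs_sum_sub_integral_le [Nonempty ι] {f : Ω → ℝ} (hf : Measurable f) {b : ℝ}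
    (hb : 0 < b) (hfb : ∀ x, |f x| ≤ b) {ℓ : ℝ} (hℓ : 0 < ℓ) (a : ℝ) :
    (Measure.pi fun _ : ι => P) {ω | (2 * a + 1) * b * √(Fintype.card ι * ℓ) <
        |∑ i, (f (ω i) - ∫ x, f x ∂P)|} ≤ 2 * ENNReal.ofReal (Real.exp (-(a * ℓ))) := by
  set m := ∫ x, f x ∂P with hm
  have hInt : Integrable f P :=
    Integrable.of_bound hf.aestronglyMeasurable b (Eventually.of_forall hfb)
  have hmean : |m| ≤ b := by
    simpa using norm_integral_le_of_norm_le_const (μ := P) (f := f) (C := b)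
      (Eventually.of_forall hfb)
  have hexp (θ : ℝ) := lintegral_exp_mul_sub_sq_le_one (P := P) (ξ := fun x => f x - m)
    (Y := fun _ => 1) (b := 2 * b) θ (hf.sub_const m) (fun _ => Or.inr rfl)
    (fun x => by linarith [abs_sub (f x) m, hfb x])
    (by rw [integral_sub hInt (integrable_const m)]; simp [← hm])
  refine (measure_mono fun ω hω => ?_).trans (measure_le_and_lt_abs_le
    (f := fun ω : ι → Ω => ∑ i, (f (ω i) - m)) (V := fun _ => Fintype.card ι * (2 * b) ^ 2)
    (Finset.measurable_fun_sum _ fun i _ =>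
      (hf.sub_const m).comp (measurable_pi_apply i)) measurable_const (fun θ => ?_)
    (v := Fintype.card ι * (2 * b) ^ 2) (by positivity) hℓ a)
  · refine ⟨le_rfl, lt_of_eq_of_lt ?_ hω⟩
    rw [mul_right_comm, Real.sqrt_mul (by positivity), Real.sqrt_sq (by positivity)]
    ring
  · refine le_of_eq_of_le (lintegral_congr fun ω => ?_) (lintegral_pi_exp_sum_le_one (fun _ => P)
      Finset.univ (fun _ => ((hf.sub_const m).const_mul θ).sub_const _) fun _ => hexp θ)
    congr 2
    simp only [Finset.sum_sub_distrib, ← Finset.mul_sum, Finset.sum_const, Finset.card_univ,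
      nsmul_eq_mul]
    ring

/-- Given individual `i`, the other individuals still form an independent sample, so `t` may be
replaced by the random `T (ω i)`. -/
theorem lintegral_pi_exp_sum_erase_le_one [DecidableEq ι] {T : Ω → ℝ} (hT : Measurable T) (i : ι)
    {g : ℝ → Ω → ℝ} (hg : Measurable fun q : ℝ × Ω => g q.1 q.2)
    (h : ∀ t, ∫⁻ x, ENNReal.ofReal (Real.exp (g t x)) ∂P ≤ 1) :
    ∫⁻ ω, ENNReal.ofReal (Real.exp (∑ j ∈ Finset.univ.erase i, g (T (ω i)) (ω j)))
      ∂(Measure.pi fun _ : ι => P) ≤ 1 := by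
  have hm : Measurable fun q : (ι → Ω) × Ω => ENNReal.ofReal (Real.exp
      (∑ j ∈ Finset.univ.erase i, g (T q.2) (q.1 j))) :=
    (Real.continuous_exp.measurable.comp (Finset.measurable_fun_sum _ fun j _ => hg.comp
      ((hT.comp measurable_snd).prodMk
        ((measurable_pi_apply j).comp measurable_fst)))).ennreal_ofReal
  have hupdate (ω : ι → Ω) (x : Ω) : ∑ j ∈ Finset.univ.erase i,
      g (T (Function.update ω i x i)) (Function.update ω i x j) =
      ∑ j ∈ Finset.univ.erase i, g (T x) (ω j) :=
    Finset.sum_congr rfl fun j hj => by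
      rw [Function.update_self, Function.update_of_ne (Finset.ne_of_mem_erase hj)]
  have hm' : Measurable fun ω : ι → Ω => ENNReal.ofReal (Real.exp
      (∑ j ∈ Finset.univ.erase i, g (T (ω i)) (ω j))) :=
    hm.comp (measurable_id.prodMk (measurable_pi_apply i))
  rw [lintegral_pi_eq_lintegral_update _ i hm']
  simp only [hupdate]
  rw [lintegral_lintegral_swap hm.aemeasurable]
  refine (lintegral_mono fun x => lintegral_pi_exp_sum_le_one (fun _ => P) (Finset.univ.erase i)
    (fun _ => hg.comp measurable_prodMk_left) fun _ => h (T x)).trans ?_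
  simp

theorem measure_pi_lt_abs_sum_erase_le [DecidableEq ι] {T : Ω → ℝ} (hT : Measurable T) (i : ι)
    {ξ Y : ℝ → Ω → ℝ} (hξ : Measurable fun q : ℝ × Ω => ξ q.1 q.2)
    (hY : Measurable fun q : ℝ × Ω => Y q.1 q.2) (hY01 : ∀ t x, Y t x = 0 ∨ Y t x = 1) {b : ℝ}
    (hb : 0 < b) (hξb : ∀ t x, |ξ t x| ≤ b * Y t x) (hmean : ∀ t, ∫ x, ξ t x ∂P = 0) {v ℓ : ℝ}
    (hv : 0 < v) (hℓ : 0 < ℓ) (a : ℝ) :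
    (Measure.pi fun _ : ι => P) {ω | ∑ j ∈ Finset.univ.erase i, Y (T (ω i)) (ω j) ≤ v ∧
        (a + 1 / 2) * b * √(v * ℓ) < |∑ j ∈ Finset.univ.erase i, ξ (T (ω i)) (ω j)|} ≤
      2 * ENNReal.ofReal (Real.exp (-(a * ℓ))) := by
  have hpair (j : ι) : Measurable fun ω : ι → Ω => (T (ω i), ω j) :=
    (hT.comp (measurable_pi_apply i)).prodMk (measurable_pi_apply j)
  refine (measure_mono fun ω hω => ?_).trans (measure_le_and_lt_abs_le
    (f := fun ω : ι → Ω => ∑ j ∈ Finset.univ.erase i, ξ (T (ω i)) (ω j))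
    (V := fun ω => b ^ 2 * ∑ j ∈ Finset.univ.erase i, Y (T (ω i)) (ω j))
    (Finset.measurable_fun_sum _ fun j _ => hξ.comp (hpair j))
    ((Finset.measurable_fun_sum _ fun j _ => hY.comp (hpair j)).const_mul _) (fun θ => ?_)
    (v := b ^ 2 * v) (by positivity) hℓ a)
  · refine ⟨mul_le_mul_of_nonneg_left hω.1 (by positivity), lt_of_eq_of_lt ?_ hω.2⟩
    rw [mul_assoc (b ^ 2), Real.sqrt_mul (by positivity), Real.sqrt_sq hb.le, mul_assoc]
  · refine le_of_eq_of_le (lintegral_congr fun ω => ?_) (lintegral_pi_exp_sum_erase_le_one hT i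
      (g := fun t x => θ * ξ t x - (θ * b) ^ 2 / 2 * Y t x)
      ((hξ.const_mul θ).sub (hY.const_mul _)) fun t => lintegral_exp_mul_sub_sq_le_one θ
        (hξ.comp measurable_prodMk_left) (hY01 t) (hξb t) (hmean t))
    congr 2
    simp only [Finset.sum_sub_distrib, ← Finset.mul_sum]
    ring

end IndependentCopies

/-! ### Concentration of the score and of the variance estimator -/

section BoundedCovariates

variable {Ω : Type*} {p n : ℕ} {X : Triple Ω p} {K : ℝ}

theorem weight_nonneg (X : Triple Ω p) (t : ℝ) (β : Fin p → ℝ) (ω : Ω) : 0 ≤ X.weight t β ω :=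
  mul_nonneg (atRisk_nonneg X t ω) (Real.exp_pos _).le

theorem weight_le (hX : ∀ t ω k, |X.covariate t ω k| ≤ K) (t : ℝ) (β : Fin p → ℝ) (ω : Ω) :
    X.weight t β ω ≤ Real.exp (l1 β * K) * X.atRisk t ω := by
  rw [Triple.weight, mul_comm]
  exact mul_le_mul_of_nonneg_right (Real.exp_le_exp.mpr
    ((le_abs_self _).trans (abs_dotProduct_le β (hX t ω)))) (atRisk_nonneg X t ω)

theorem le_weight (hX : ∀ t ω k, |X.covariate t ω k| ≤ K) (t : ℝ) (β : Fin p → ℝ) (ω : Ω) :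
    Real.exp (-(l1 β * K)) * X.atRisk t ω ≤ X.weight t β ω := by
  rw [Triple.weight, mul_comm]
  exact mul_le_mul_of_nonneg_left (Real.exp_le_exp.mpr
    (abs_le.mp (abs_dotProduct_le β (hX t ω))).1) (atRisk_nonneg X t ω)

theorem normWeight_nonneg (X : Triple Ω p) (ω : Fin n → Ω) (s : ℝ) (β : Fin p → ℝ) (i : Fin n) :
    0 ≤ normWeight X ω s β i :=
  div_nonneg (weight_nonneg X _ _ _) (Finset.sum_nonneg fun _ _ => weight_nonneg X _ _ _)

theorem sum_normWeight_le_one (X : Triple Ω p) (ω : Fin n → Ω) (s : ℝ) (β : Fin p → ℝ) :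
    ∑ i, normWeight X ω s β i ≤ 1 := by
  simp only [normWeight, ← Finset.sum_div]
  exact div_self_le_one _

theorem abs_zbar_le (hK : 0 ≤ K) (hX : ∀ t ω k, |X.covariate t ω k| ≤ K) (β : Fin p → ℝ)
    (ω : Fin n → Ω) (s : ℝ) (k : Fin p) : |zbar X ω s β k| ≤ K := by
  calc |zbar X ω s β k| ≤ ∑ i, |X.covariate s (ω i) k * normWeight X ω s β i| :=
        Finset.abs_sum_le_sum_abs _ _
    _ ≤ ∑ i, K * normWeight X ω s β i := by
        refine Finset.sum_le_sum fun i _ => ?_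
        rw [abs_mul, abs_of_nonneg (normWeight_nonneg X ω s β i)]
        exact mul_le_mul_of_nonneg_right (hX _ _ _) (normWeight_nonneg X ω s β i)
    _ ≤ K := by
        rw [← Finset.mul_sum]
        exact mul_le_of_le_one_right hK (sum_normWeight_le_one X ω s β)

theorem abs_event_mul_le (X : Triple Ω p) (ω : Ω) (x : ℝ) : |X.event ω * x| ≤ |x| := by
  rcases event_eq_zero_or_one X ω with h | h <;> simp [h]

/-- The number of individuals at risk at the observed time of individual `i`. -/
def riskCount (X : Triple Ω p) (ω : Fin n → Ω) (i : Fin n) : ℕ :=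
  (Finset.univ.filter fun j => X.time (ω i) ≤ X.time (ω j)).card

theorem sum_atRisk_eq_riskCount (X : Triple Ω p) (ω : Fin n → Ω) (i : Fin n) :
    ∑ j, X.atRisk (X.time (ω i)) (ω j) = riskCount X ω i := by
  simp [Triple.atRisk, riskCount]

theorem riskCount_pos (X : Triple Ω p) (ω : Fin n → Ω) (i : Fin n) : 0 < riskCount X ω i :=
  Finset.card_pos.mpr ⟨i, by simp⟩

theorem riskCount_le (X : Triple Ω p) (ω : Fin n → Ω) (i : Fin n) : riskCount X ω i ≤ n :=
  (Finset.card_le_univ _).trans_eq (Fintype.card_fin n)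

theorem exp_neg_mul_riskCount_le_sum_weight (hX : ∀ t ω k, |X.covariate t ω k| ≤ K)
    (β : Fin p → ℝ) (ω : Fin n → Ω) (i : Fin n) :
    Real.exp (-(l1 β * K)) * riskCount X ω i ≤ ∑ j, X.weight (X.time (ω i)) β (ω j) := by
  rw [← sum_atRisk_eq_riskCount, Finset.mul_sum]
  exact Finset.sum_le_sum fun j _ => le_weight hX _ _ _

variable [MeasurableSpace Ω]

/-- The summand `{Zₖ(t) - μₖ(t)} Y(t) exp(βᵀ Z(t))` of the numerator of `Z̄ₖ(t) - μₖ(t)`, which has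
mean zero for each fixed `t`. -/
def centred (X : Triple Ω p) (P : Measure Ω) (β : Fin p → ℝ) (k : Fin p) (t : ℝ) (ω : Ω) : ℝ :=
  (X.covariate t ω k - X.mu P t β k) * X.weight t β ω

theorem zbar_sub_mu_eq (X : Triple Ω p) (P : Measure Ω) (β : Fin p → ℝ) (k : Fin p)
    (ω : Fin n → Ω) (i : Fin n) :
    zbar X ω (X.time (ω i)) β k - X.mu P (X.time (ω i)) β k =
      (∑ j, centred X P β k (X.time (ω i)) (ω j)) / ∑ j, X.weight (X.time (ω i)) β (ω j) := by
  have hW := (sum_weight_pos X ω β i).ne'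
  simp only [centred, sub_mul, Finset.sum_sub_distrib, ← Finset.mul_sum, sub_div,
    mul_div_cancel_right₀ _ hW]
  simp only [zbar, normWeight, Finset.sum_div, mul_div_assoc]

theorem abs_zbar_sub_mu_le (hX : ∀ t ω k, |X.covariate t ω k| ≤ K) (P : Measure Ω)
    (β : Fin p → ℝ) (k : Fin p) (ω : Fin n → Ω) (i : Fin n) :
    |zbar X ω (X.time (ω i)) β k - X.mu P (X.time (ω i)) β k| ≤ Real.exp (l1 β * K) *
      |∑ j, centred X P β k (X.time (ω i)) (ω j)| / riskCount X ω i := by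
  have hR : (0 : ℝ) < riskCount X ω i := by exact_mod_cast riskCount_pos X ω i
  rw [zbar_sub_mu_eq, abs_div, abs_of_pos (sum_weight_pos X ω β i)]
  calc _ ≤ |∑ j, centred X P β k (X.time (ω i)) (ω j)| /
          (Real.exp (-(l1 β * K)) * riskCount X ω i) := by
        gcongr
        exact exp_neg_mul_riskCount_le_sum_weight hX β ω i
    _ = _ := by rw [Real.exp_neg]; field_simp

/-- The summand `∫ {Zₖ(s) - μₖ(s)} {Zₗ(s) - μₗ(s)} dN(s)` of the variance estimator centred at the
population mean, whose expectation is `Σₖₗ`. -/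
def popTerm (X : Triple Ω p) (P : Measure Ω) (β : Fin p → ℝ) (k l : Fin p) (ω : Ω) : ℝ :=
  X.integralN (fun s => (X.covariate s ω k - X.mu P s β k) *
    (X.covariate s ω l - X.mu P s β l)) ω

theorem abs_mul_sub_mul_le {x y a b c d M : ℝ} (hx : |x - c| ≤ M) (hy : |y - b| ≤ M) :
    |(x - a) * (y - b) - (x - c) * (y - d)| ≤ M * (|a - c| + |b - d|) := by
  calc |(x - a) * (y - b) - (x - c) * (y - d)|
      = |-((a - c) * (y - b)) - (x - c) * (b - d)| := by congr 1; ring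
    _ ≤ |a - c| * |y - b| + |x - c| * |b - d| := by
        simpa only [abs_neg, abs_mul] using abs_sub (-((a - c) * (y - b))) ((x - c) * (b - d))
    _ ≤ |a - c| * M + M * |b - d| := by gcongr
    _ = M * (|a - c| + |b - d|) := by ring

-- The error rate `1 / √(riskCount)` of `Z̄` degrades at late times, but its average does not.
theorem abs_vhat_sub_average_popTerm_le (hK : 0 ≤ K) (hX : ∀ t ω k, |X.covariate t ω k| ≤ K)
    {P : Measure Ω} {β : Fin p → ℝ} (hμ : ∀ t k, |X.mu P t β k| ≤ K) {ω : Fin n → Ω} {c : ℝ}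
    (hc : 0 ≤ c) (hz : ∀ i k, |zbar X ω (X.time (ω i)) β k - X.mu P (X.time (ω i)) β k| ≤
      c * (1 / √(riskCount X ω i))) (k l : Fin p) :
    |vhat X ω β k l - 1 / (n : ℝ) * ∑ i, popTerm X P β k l (ω i)| ≤ 8 * K * c / √n := by
  rw [vhat, Matrix.of_apply, ← mul_sub, ← Finset.sum_sub_distrib, abs_mul,
    abs_of_nonneg (by positivity)]
  have hterm (i : Fin n) : |X.integralN (fun s => (X.covariate s (ω i) k - zbar X ω s β k) *
      (X.covariate s (ω i) l - zbar X ω s β l)) (ω i) - popTerm X P β k l (ω i)| ≤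
      4 * K * c * (1 / √(riskCount X ω i)) := by
    rw [popTerm, Triple.integralN, Triple.integralN, ← mul_sub]
    set t := X.time (ω i)
    have hμk : |X.covariate t (ω i) k - X.mu P t β k| ≤ 2 * K :=
      (abs_sub _ _).trans (by linarith [hX t (ω i) k, hμ t k])
    have hzl : |X.covariate t (ω i) l - zbar X ω t β l| ≤ 2 * K :=
      (abs_sub _ _).trans (by linarith [hX t (ω i) l, abs_zbar_le hK hX β ω t l])
    refine (abs_event_mul_le X _ _).trans ((abs_mul_sub_mul_le hμk hzl).trans ?_)
    nlinarith [hz i k, hz i l]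
  calc 1 / (n : ℝ) * |∑ i, _| ≤ 1 / (n : ℝ) * ∑ i, 4 * K * c * (1 / √(riskCount X ω i)) := by
        gcongr
        exact (Finset.abs_sum_le_sum_abs _ _).trans (Finset.sum_le_sum fun i _ => hterm i)
    _ ≤ 1 / (n : ℝ) * (4 * K * c * (2 * √n)) := by
        rw [← Finset.mul_sum]
        gcongr
        simpa only [Fintype.card_fin, riskCount] using
          sum_one_div_sqrt_card_filter_le fun i => X.time (ω i)
    _ = 8 * K * c * (√n / n) := by ring
    _ = 8 * K * c / √n := by rw [Real.sqrt_div_self, div_eq_mul_inv]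

end BoundedCovariates

namespace IsRegular

variable {Ω E : Type*} [MeasurableSpace Ω] [MeasurableSpace E] {p n : ℕ} {X : Triple Ω p}
  {P : Measure Ω} {β : Fin p → ℝ} {K : ℝ} {π : Ω → E} {Z : ℝ → E → Fin p → ℝ} {I : Set ℝ}
  {haz : ℝ → ℝ}

theorem abs_covariate_le (h : IsRegular X P β K π Z I haz) (t : ℝ) (ω : Ω) (k : Fin p) :
    |X.covariate t ω k| ≤ K :=
  h.covariate_eq t ω ▸ h.bound t (π ω) k

theorem measurable_covariate (h : IsRegular X P β K π Z I haz) (k : Fin p) :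
    Measurable fun q : ℝ × Ω => X.covariate q.1 q.2 k := by
  simp only [h.covariate_eq]
  exact (measurable_pi_apply k).comp
    (h.measurable_cov.comp (measurable_fst.prodMk (h.measurable_proj.comp measurable_snd)))

theorem measurable_weight (h : IsRegular X P β K π Z I haz) :
    Measurable fun q : ℝ × Ω => X.weight q.1 β q.2 :=
  h.measurable_atRisk.mul (Real.measurable_exp.comp
    (Finset.measurable_fun_sum _ fun l _ => (h.measurable_covariate l).const_mul _))

theorem measurable_time_prodMk (h : IsRegular X P β K π Z I haz) (i j : Fin n) :
    Measurable fun ω : Fin n → Ω => (X.time (ω i), ω j) :=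
  (h.measurable_time.comp (measurable_pi_apply i)).prodMk (measurable_pi_apply j)

theorem measurable_zbar_time (h : IsRegular X P β K π Z I haz) (k : Fin p) (i : Fin n) :
    Measurable fun ω : Fin n → Ω => zbar X ω (X.time (ω i)) β k :=
  Finset.measurable_fun_sum _ fun j _ =>
    ((h.measurable_covariate k).comp (h.measurable_time_prodMk i j)).mul
      ((h.measurable_weight.comp (h.measurable_time_prodMk i j)).div
        (Finset.measurable_fun_sum _ fun l _ =>
          h.measurable_weight.comp (h.measurable_time_prodMk i l)))

theorem measurable_score (h : IsRegular X P β K π Z I haz) (k : Fin p) :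
    Measurable fun ω : Fin n → Ω => score X ω β k :=
  (Finset.measurable_fun_sum _ fun i _ =>
    (h.measurable_event.comp (measurable_pi_apply i)).mul
      (((h.measurable_covariate k).comp (h.measurable_time_prodMk i i)).sub
        (h.measurable_zbar_time k i))).const_mul _

variable [IsProbabilityMeasure P]

theorem measure_pi_lt_abs_score_le (h : IsRegular X P β K π Z I haz) (hK : 0 < K) (hn : 0 < n)
    {ℓ : ℝ} (hℓ : 0 < ℓ) :
    (Measure.pi fun _ : Fin n => P) {ω | ∃ k, 5 * K * (√ℓ / √n) < |score X ω β k|} ≤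
      p * (2 * ENNReal.ofReal (Real.exp (-(2 * ℓ)))) := by
  have hn' : (0 : ℝ) < n := by exact_mod_cast hn
  have hscale : (2 + 1 / 2) * √(n * (2 * K) ^ 2 * ℓ) = n * (5 * K * (√ℓ / √n)) := by
    rw [mul_right_comm, Real.sqrt_mul (by positivity), Real.sqrt_sq (by positivity),
      Real.sqrt_mul hn'.le]
    have hsqrt : √(n : ℝ) ^ 2 = n := Real.sq_sqrt hn'.le
    field_simp
    rw [hsqrt]
    ring
  have htail (k : Fin p) := measure_le_and_lt_abs_le (Q := Measure.pi fun _ : Fin n => P)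
    (f := fun ω => n * score X ω β k) (V := fun _ => n * (2 * K) ^ 2)
    ((h.measurable_score k).const_mul _) measurable_const
    (fun θ => le_of_eq_of_le (lintegral_congr fun ω => by ring_nf)
      (h.lintegral_exp_score_le_one k θ)) (v := n * (2 * K) ^ 2) (by positivity) hℓ 2
  refine (measure_mono ?_).trans ((measure_exists_le_card_mul htail).trans_eq (by simp))
  rintro ω ⟨k, hk⟩
  refine ⟨k, le_rfl, ?_⟩
  rw [hscale, abs_mul, abs_of_pos hn']
  exact mul_lt_mul_of_pos_left hk hn'

theorem integrable_weight (h : IsRegular X P β K π Z I haz) (t : ℝ) :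
    Integrable (X.weight t β) P := by
  refine Integrable.of_bound (h.measurable_weight.comp measurable_prodMk_left).aestronglyMeasurable
    (Real.exp (l1 β * K)) (Eventually.of_forall fun ω => ?_)
  rw [Real.norm_of_nonneg (weight_nonneg X t β ω)]
  refine (weight_le h.abs_covariate_le t β ω).trans (mul_le_of_le_one_right (Real.exp_pos _).le ?_)
  rcases atRisk_eq_zero_or_one X t ω with hY | hY <;> simp [hY]

theorem integrable_covariate_mul_weight (h : IsRegular X P β K π Z I haz) (t : ℝ) (k : Fin p) :
    Integrable (fun ω => X.covariate t ω k * X.weight t β ω) P :=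
  (h.integrable_weight t).bdd_mul (c := K)
    ((h.measurable_covariate k).comp measurable_prodMk_left).aestronglyMeasurable
    (Eventually.of_forall fun ω => h.abs_covariate_le t ω k)

theorem abs_mu_le (h : IsRegular X P β K π Z I haz) (hK : 0 ≤ K) (t : ℝ) (k : Fin p) :
    |X.mu P t β k| ≤ K := by
  have hW : 0 ≤ ∫ ω, X.weight t β ω ∂P := integral_nonneg fun ω => weight_nonneg X t β ω
  rw [Triple.mu, abs_div, abs_of_nonneg hW]
  refine div_le_of_le_mul₀ hW hK ?_
  rw [← integral_const_mul]
  refine abs_integral_le_integral_abs.trans (integral_mono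
    (h.integrable_covariate_mul_weight t k).abs ((h.integrable_weight t).const_mul K) fun ω => ?_)
  simp only [abs_mul, abs_of_nonneg (weight_nonneg X t β ω)]
  exact mul_le_mul_of_nonneg_right (h.abs_covariate_le t ω k) (weight_nonneg X t β ω)

theorem abs_covariate_sub_mu_le (h : IsRegular X P β K π Z I haz) (hK : 0 ≤ K) (k : Fin p) (t : ℝ)
    (ω : Ω) : |X.covariate t ω k - X.mu P t β k| ≤ 2 * K :=
  (abs_sub _ _).trans (by linarith [h.abs_covariate_le t ω k, h.abs_mu_le hK t k])

theorem measurable_mu (h : IsRegular X P β K π Z I haz) (k : Fin p) :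
    Measurable fun t => X.mu P t β k :=
  (((h.measurable_covariate k).mul h.measurable_weight).stronglyMeasurable
    |>.integral_prod_right').measurable.div
      h.measurable_weight.stronglyMeasurable.integral_prod_right'.measurable

theorem measurable_centred (h : IsRegular X P β K π Z I haz) (k : Fin p) :
    Measurable fun q : ℝ × Ω => centred X P β k q.1 q.2 :=
  ((h.measurable_covariate k).sub ((h.measurable_mu k).comp measurable_fst)).mul
    h.measurable_weight

theorem abs_centred_le (h : IsRegular X P β K π Z I haz) (hK : 0 ≤ K) (k : Fin p) (t : ℝ) (ω : Ω) :
    |centred X P β k t ω| ≤ 2 * K * Real.exp (l1 β * K) * X.atRisk t ω := by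
  rw [centred, abs_mul, abs_of_nonneg (weight_nonneg X t β ω), mul_assoc (2 * K)]
  exact mul_le_mul (h.abs_covariate_sub_mu_le hK k t ω) (weight_le h.abs_covariate_le t β ω)
    (weight_nonneg X t β ω) (by linarith)

theorem integral_centred (h : IsRegular X P β K π Z I haz) (k : Fin p) (t : ℝ) :
    ∫ ω, centred X P β k t ω ∂P = 0 := by
  simp only [centred, sub_mul]
  rw [integral_sub (h.integrable_covariate_mul_weight t k)
    ((h.integrable_weight t).const_mul _), integral_const_mul]
  by_cases hW : ∫ ω, X.weight t β ω ∂P = 0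
  · have hae := (integral_eq_zero_iff_of_nonneg (fun ω => weight_nonneg X t β ω)
      (h.integrable_weight t)).mp hW
    rw [hW, mul_zero, sub_zero]
    refine integral_eq_zero_of_ae ?_
    filter_upwards [hae] with ω hω
    simp only [Pi.zero_apply] at hω ⊢
    rw [hω, mul_zero]
  · rw [Triple.mu, div_mul_cancel₀ _ hW, sub_self]

/-- Slicing over the possible values of the random risk set size makes the deviation of the order
of its square root. -/
theorem measure_pi_lt_abs_sum_centred_le (h : IsRegular X P β K π Z I haz) (hK : 0 < K) {ℓ : ℝ}
    (hℓ : 1 ≤ ℓ) (i : Fin n) (k : Fin p) :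
    (Measure.pi fun _ : Fin n => P) {ω | 9 / 2 * (2 * K * Real.exp (l1 β * K)) *
        √(riskCount X ω i * ℓ) < |∑ j, centred X P β k (X.time (ω i)) (ω j)|} ≤
      n * (2 * ENNReal.ofReal (Real.exp (-(3 * ℓ)))) := by
  set b := 2 * K * Real.exp (l1 β * K)
  have hb : 0 < b := by positivity
  have hslice (m : Fin n) := measure_pi_lt_abs_sum_erase_le (P := P) h.measurable_time i
    (h.measurable_centred k) h.measurable_atRisk (atRisk_eq_zero_or_one X) hb
    (h.abs_centred_le hK.le k) (h.integral_centred k) (v := ((m + 1 : ℕ) : ℝ)) (by positivity)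
    (zero_lt_one.trans_le hℓ) 3
  refine (measure_mono fun ω hω => ?_).trans
    ((measure_exists_le_card_mul hslice).trans_eq (by simp))
  have hR := riskCount_pos X ω i
  have hR1 : (1 : ℝ) ≤ riskCount X ω i := by exact_mod_cast hR
  refine ⟨⟨riskCount X ω i - 1, by have := riskCount_le X ω i; omega⟩, ?_⟩
  rw [Nat.sub_add_cancel hR]
  constructor
  · rw [← sum_atRisk_eq_riskCount]
    exact Finset.sum_le_sum_of_subset_of_nonneg (Finset.subset_univ _) fun j _ _ =>
      atRisk_nonneg X _ _
  have hroot : 1 ≤ √(riskCount X ω i * ℓ) :=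
    Real.one_le_sqrt.mpr (one_le_mul_of_one_le_of_one_le hR1 hℓ)
  have hown : |centred X P β k (X.time (ω i)) (ω i)| ≤ b := by
    simpa [Triple.atRisk] using h.abs_centred_le hK.le k (X.time (ω i)) (ω i)
  have htri : |∑ j, centred X P β k (X.time (ω i)) (ω j)| ≤ b +
      |∑ j ∈ Finset.univ.erase i, centred X P β k (X.time (ω i)) (ω j)| := by
    rw [← Finset.add_sum_erase _ _ (Finset.mem_univ i)]
    exact (abs_add_le _ _).trans (by linarith)
  have hω' : 9 / 2 * b * √(riskCount X ω i * ℓ) <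
      |∑ j, centred X P β k (X.time (ω i)) (ω j)| := hω
  nlinarith

theorem measurable_popTerm (h : IsRegular X P β K π Z I haz) (k l : Fin p) :
    Measurable (popTerm X P β k l) := by
  have hdiff (k : Fin p) :
      Measurable fun ω => X.covariate (X.time ω) ω k - X.mu P (X.time ω) β k :=
    ((h.measurable_covariate k).comp (h.measurable_time.prodMk measurable_id)).sub
      ((h.measurable_mu k).comp h.measurable_time)
  exact h.measurable_event.mul ((hdiff k).mul (hdiff l))

theorem abs_popTerm_le (h : IsRegular X P β K π Z I haz) (hK : 0 ≤ K) (k l : Fin p) (ω : Ω) :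
    |popTerm X P β k l ω| ≤ 4 * K ^ 2 := by
  refine (abs_event_mul_le X ω _).trans ?_
  rw [abs_mul]
  refine (mul_le_mul (h.abs_covariate_sub_mu_le hK k _ ω) (h.abs_covariate_sub_mu_le hK l _ ω)
    (abs_nonneg _) (by linarith)).trans_eq ?_
  ring

theorem measure_pi_lt_abs_sum_popTerm_sub_le (h : IsRegular X P β K π Z I haz) (hK : 0 < K)
    (hn : 0 < n) {ℓ : ℝ} (hℓ : 0 < ℓ) (k l : Fin p) :
    (Measure.pi fun _ : Fin n => P) {ω | 28 * K ^ 2 * √(n * ℓ) <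
        |∑ i, (popTerm X P β k l (ω i) - X.sigma P β k l)|} ≤
      2 * ENNReal.ofReal (Real.exp (-(3 * ℓ))) := by
  have : Nonempty (Fin n) := ⟨⟨0, hn⟩⟩
  have htail := measure_pi_lt_abs_sum_sub_integral_le (ι := Fin n) (P := P)
    (h.measurable_popTerm k l) (by positivity) (h.abs_popTerm_le hK.le k l) hℓ 3
  rw [Fintype.card_fin, show (2 * 3 + 1) * (4 * K ^ 2) = 28 * K ^ 2 by ring] at htail
  exact htail

theorem abs_vhat_sub_sigma_le (h : IsRegular X P β K π Z I haz) (hK : 0 < K) (hn : 0 < n)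
    {ℓ : ℝ} {ω : Fin n → Ω}
    (hcentred : ∀ i k, |∑ j, centred X P β k (X.time (ω i)) (ω j)| ≤
      9 / 2 * (2 * K * Real.exp (l1 β * K)) * √(riskCount X ω i * ℓ)) {k l : Fin p}
    (hpop : |∑ i, (popTerm X P β k l (ω i) - X.sigma P β k l)| ≤ 28 * K ^ 2 * √(n * ℓ)) :
    |vhat X ω β k l - X.sigma P β k l| ≤
      (72 * K ^ 2 * Real.exp (l1 β * K) ^ 2 + 28 * K ^ 2) * (√ℓ / √n) := by
  have hn' : (0 : ℝ) < n := by exact_mod_cast hn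
  set c := 9 * K * Real.exp (l1 β * K) ^ 2 * √ℓ
  have hz (i : Fin n) (k : Fin p) : |zbar X ω (X.time (ω i)) β k - X.mu P (X.time (ω i)) β k| ≤
      c * (1 / √(riskCount X ω i)) := by
    calc _ ≤ Real.exp (l1 β * K) * (9 / 2 * (2 * K * Real.exp (l1 β * K)) *
          √(riskCount X ω i * ℓ)) / riskCount X ω i :=
          (abs_zbar_sub_mu_le h.abs_covariate_le P β k ω i).trans (by gcongr; exact hcentred i k)
      _ = c * (√(riskCount X ω i) / riskCount X ω i) := by
          rw [Real.sqrt_mul (Nat.cast_nonneg _)]; ring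
      _ = _ := by rw [Real.sqrt_div_self, one_div]
  have hemp := abs_vhat_sub_average_popTerm_le hK.le h.abs_covariate_le (h.abs_mu_le hK.le)
    (by positivity) hz k l
  have hmean : |1 / (n : ℝ) * ∑ i, popTerm X P β k l (ω i) - X.sigma P β k l| ≤
      28 * K ^ 2 * (√ℓ / √n) := by
    calc _ = |1 / (n : ℝ) * ∑ i, (popTerm X P β k l (ω i) - X.sigma P β k l)| := by
          rw [Finset.sum_sub_distrib, Finset.sum_const, Finset.card_univ, Fintype.card_fin,
            nsmul_eq_mul, mul_sub]
          congr 2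
          field_simp
      _ ≤ 1 / (n : ℝ) * (28 * K ^ 2 * √(n * ℓ)) := by
          rw [abs_mul, abs_of_pos (by positivity)]
          gcongr
      _ = 28 * K ^ 2 * √ℓ * (√n / n) := by rw [Real.sqrt_mul hn'.le]; ring
      _ = 28 * K ^ 2 * (√ℓ / √n) := by rw [Real.sqrt_div_self]; ring
  calc |vhat X ω β k l - X.sigma P β k l|
      ≤ 8 * K * c / √n + 28 * K ^ 2 * (√ℓ / √n) :=
        (abs_sub_le _ _ _).trans (add_le_add hemp hmean)
    _ = _ := by ring

theorem measure_pi_lt_abs_vhat_sub_sigma_le (h : IsRegular X P β K π Z I haz) (hK : 0 < K)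
    (hn : 0 < n) {ℓ : ℝ} (hℓ : 1 ≤ ℓ) :
    (Measure.pi fun _ : Fin n => P) {ω | ∃ k l,
        (72 * K ^ 2 * Real.exp (l1 β * K) ^ 2 + 28 * K ^ 2) * (√ℓ / √n) <
          |vhat X ω β k l - X.sigma P β k l|} ≤
      (n * p * n + p * p : ℕ) * (2 * ENNReal.ofReal (Real.exp (-(3 * ℓ)))) := by
  have hℓ0 : 0 < ℓ := zero_lt_one.trans_le hℓ
  have hcentred := measure_exists_le_card_mul fun i => measure_exists_le_card_mul
    (h.measure_pi_lt_abs_sum_centred_le (n := n) hK hℓ i)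
  have hpop := measure_exists_le_card_mul fun k => measure_exists_le_card_mul
    (h.measure_pi_lt_abs_sum_popTerm_sub_le hK hn hℓ0 k)
  refine (measure_mono fun ω hω => ?_).trans ((measure_union_le _ _).trans
    ((add_le_add hcentred hpop).trans_eq (by simp; ring)))
  by_contra hgood
  simp only [Set.mem_union, Set.mem_ofPred_eq, not_or, not_exists, not_lt] at hgood hω
  obtain ⟨k, l, hkl⟩ := hω
  exact hkl.not_ge (h.abs_vhat_sub_sigma_le hK hn hgood.1 (hgood.2 k l))

end IsRegular

/-! ### Passing to the regular version of the covariates -/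

section Transfer

variable {Ω : Type*} {p n : ℕ} {X Y : Triple Ω p} {ω : Fin n → Ω}

/-- `X` and `Y` agree on the sample `ω` in everything the estimators see: the observed times, the
failure indicators, and the covariates at the observed times. -/
structure Agree (X Y : Triple Ω p) (ω : Fin n → Ω) : Prop where
  time_eq : Y.time = X.time
  event_eq : Y.event = X.event
  covariate_eq : ∀ i j, Y.covariate (X.time (ω i)) (ω j) = X.covariate (X.time (ω i)) (ω j)

namespace Agree

theorem weight_eq (h : Agree X Y ω) (β : Fin p → ℝ) (i j : Fin n) :
    Y.weight (X.time (ω i)) β (ω j) = X.weight (X.time (ω i)) β (ω j) := by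
  simp only [Triple.weight, Triple.atRisk, h.time_eq, h.covariate_eq]

theorem normWeight_eq (h : Agree X Y ω) (β : Fin p → ℝ) (i j : Fin n) :
    normWeight Y ω (X.time (ω i)) β j = normWeight X ω (X.time (ω i)) β j := by
  simp only [normWeight, h.weight_eq]

theorem zbar_eq (h : Agree X Y ω) (β : Fin p → ℝ) (i : Fin n) :
    zbar Y ω (X.time (ω i)) β = zbar X ω (X.time (ω i)) β := by
  funext k
  simp only [zbar, h.normWeight_eq, h.covariate_eq]

theorem logLik_eq (h : Agree X Y ω) : logLik Y ω = logLik X ω := by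
  funext β
  simp only [logLik, Triple.integralN, h.time_eq, h.event_eq, h.covariate_eq, h.weight_eq]

theorem score_eq (h : Agree X Y ω) (β : Fin p → ℝ) : score Y ω β = score X ω β := by
  funext k
  simp only [score, Triple.integralN, h.time_eq, h.event_eq, h.covariate_eq, h.zbar_eq]

theorem hessian_eq (h : Agree X Y ω) (β : Fin p → ℝ) : hessian Y ω β = hessian X ω β := by
  ext k l
  simp only [hessian, Matrix.of_apply, Triple.integralN, h.time_eq, h.event_eq, h.covariate_eq,
    h.zbar_eq, h.normWeight_eq]

theorem vhat_eq (h : Agree X Y ω) (β : Fin p → ℝ) : vhat Y ω β = vhat X ω β := by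
  ext k l
  simp only [vhat, Matrix.of_apply, Triple.integralN, h.time_eq, h.event_eq, h.covariate_eq,
    h.zbar_eq]

theorem kappa_eq (h : Agree X Y ω) (β : Fin p → ℝ) : kappa Y ω β = kappa X ω β := by
  simp only [kappa, h.hessian_eq]

theorem isLasso (h : Agree X Y ω) {lam : ℝ} {b : Fin p → ℝ} (hb : IsLasso X ω lam b) :
    IsLasso Y ω lam b := by
  simpa only [IsLasso, h.logLik_eq] using hb

end Agree

end Transfer

section Regularise

variable {Ω : Type*} [MeasurableSpace Ω] {p : ℕ} {X : Triple Ω p} {P : Measure Ω} {K : ℝ}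

theorem ae_agree_regTriple [IsProbabilityMeasure P] {n : ℕ} (hB : X.BoundedCovariates P K)
    (hL : X.LeftContinuousCovariates P) (hT : ∀ᵐ ω ∂P, X.time ω ∈ X.timeSet P) :
    ∀ᵐ ω ∂(Measure.pi fun _ : Fin n => P), Agree X (regTriple X P K) ω := by
  have hae {q : Ω → Prop} (hq : ∀ᵐ ω ∂P, q ω) :
      ∀ᵐ ω ∂(Measure.pi fun _ : Fin n => P), ∀ i, q (ω i) :=
    ae_all_iff.mpr fun i => (Measure.quasiMeasurePreserving_eval (fun _ : Fin n => P) i).ae hq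
  filter_upwards [hae hT, hae (ae_regCov_eq hB hL)] with ω htime hcov
  exact ⟨rfl, rfl, fun i j => hcov j _ (htime i)⟩

theorem mu_regTriple (hB : X.BoundedCovariates P K) (hL : X.LeftContinuousCovariates P) {t : ℝ}
    (ht : t ∈ X.timeSet P) (β : Fin p → ℝ) : (regTriple X P K).mu P t β = X.mu P t β := by
  have hcov : ∀ᵐ ω ∂P, (regTriple X P K).covariate t ω = X.covariate t ω := by
    filter_upwards [ae_regCov_eq hB hL] with ω hω using hω t ht
  have hweight : ∀ᵐ ω ∂P, (regTriple X P K).weight t β ω = X.weight t β ω := by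
    filter_upwards [hcov] with ω hω
    rw [Triple.weight, hω]
    rfl
  funext k
  refine congrArg₂ (· / ·) (integral_congr_ae ?_) (integral_congr_ae hweight)
  filter_upwards [hcov, hweight] with ω hcov hweight
  rw [hcov, hweight]

theorem sigma_regTriple (hB : X.BoundedCovariates P K) (hL : X.LeftContinuousCovariates P)
    (hT : ∀ᵐ ω ∂P, X.time ω ∈ X.timeSet P) (β : Fin p → ℝ) :
    (regTriple X P K).sigma P β = X.sigma P β := by
  ext k l
  refine integral_congr_ae ?_
  filter_upwards [ae_regCov_eq hB hL, hT] with ω hcov ht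
  have hcov' : (regTriple X P K).covariate (X.time ω) ω = X.covariate (X.time ω) ω :=
    hcov _ ht
  change X.event ω * (((regTriple X P K).covariate (X.time ω) ω k - _) *
    ((regTriple X P K).covariate (X.time ω) ω l - _)) = X.event ω * _
  rw [hcov', mu_regTriple hB hL (t := (regTriple X P K).time ω) ht]
  rfl

end Regularise

/-! ### Exponential tilting of a weighted average -/

section LogSumExp

variable {ι : Type*} (s : Finset ι) {w a z : ι → ℝ}

theorem one_add_add_sq_div_four_le_exp {x : ℝ} (hx : -2 ≤ x) : 1 + x + x ^ 2 / 4 ≤ Real.exp x := by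
  calc 1 + x + x ^ 2 / 4 = (x / 2 + 1) ^ 2 := by ring
    _ ≤ Real.exp (x / 2) ^ 2 := pow_le_pow_left₀ (by linarith) (Real.add_one_le_exp _) 2
    _ = Real.exp x := by rw [← Real.exp_nat_mul, Nat.cast_ofNat, mul_div_cancel₀ _ two_ne_zero]

theorem sum_mul_exp_eq_exp_mul_sum (m : ℝ) :
    ∑ i ∈ s, w i * Real.exp (a i) = Real.exp m * ∑ i ∈ s, w i * Real.exp (a i - m) := by
  rw [Finset.mul_sum]
  refine Finset.sum_congr rfl fun i _ => ?_
  rw [mul_left_comm, ← Real.exp_add, add_sub_cancel]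

theorem sum_mul_sub_mean (hs : ∑ i ∈ s, w i = 1) :
    ∑ i ∈ s, w i * (a i - ∑ j ∈ s, w j * a j) = 0 := by
  simp only [mul_sub, Finset.sum_sub_distrib, ← Finset.sum_mul, hs, one_mul, sub_self]

theorem one_le_sum_mul_exp_sub_mean (hw : ∀ i ∈ s, 0 ≤ w i) (hs : ∑ i ∈ s, w i = 1) :
    1 ≤ ∑ i ∈ s, w i * Real.exp (a i - ∑ j ∈ s, w j * a j) := by
  calc (1 : ℝ) = ∑ i ∈ s, w i * ((a i - ∑ j ∈ s, w j * a j) + 1) := by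
        simp only [mul_add, Finset.sum_add_distrib, sum_mul_sub_mean s hs, mul_one, hs, zero_add]
    _ ≤ _ := Finset.sum_le_sum fun i hi =>
        mul_le_mul_of_nonneg_left (Real.add_one_le_exp _) (hw i hi)

theorem sum_mul_exp_pos (hw : ∀ i ∈ s, 0 ≤ w i) (hs : ∑ i ∈ s, w i = 1) :
    0 < ∑ i ∈ s, w i * Real.exp (a i) := by
  rw [sum_mul_exp_eq_exp_mul_sum s (∑ j ∈ s, w j * a j)]
  exact mul_pos (Real.exp_pos _) (zero_lt_one.trans_le (one_le_sum_mul_exp_sub_mean s hw hs))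

theorem one_add_variance_le_sum_mul_exp_sub_mean (hw : ∀ i ∈ s, 0 ≤ w i) (hs : ∑ i ∈ s, w i = 1)
    (ha : ∀ i ∈ s, -2 ≤ a i - ∑ j ∈ s, w j * a j) :
    1 + (∑ i ∈ s, w i * (a i - ∑ j ∈ s, w j * a j) ^ 2) / 4 ≤
      ∑ i ∈ s, w i * Real.exp (a i - ∑ j ∈ s, w j * a j) := by
  have hmean := sum_mul_sub_mean s (a := a) hs
  set m := ∑ j ∈ s, w j * a j
  calc 1 + (∑ i ∈ s, w i * (a i - m) ^ 2) / 4
      = ∑ i ∈ s, w i * (1 + (a i - m) + (a i - m) ^ 2 / 4) := by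
        simp only [mul_add, Finset.sum_add_distrib, mul_one, hs, hmean, mul_div_assoc', add_zero,
          ← Finset.sum_div]
    _ ≤ _ := Finset.sum_le_sum fun i hi => mul_le_mul_of_nonneg_left
        (one_add_add_sq_div_four_le_exp (ha i hi)) (hw i hi)

theorem mean_add_variance_le_log_sum_mul_exp (hw : ∀ i ∈ s, 0 ≤ w i) (hs : ∑ i ∈ s, w i = 1)
    (ha : ∀ i ∈ s, |a i - ∑ j ∈ s, w j * a j| ≤ 1) :
    (∑ j ∈ s, w j * a j) + 1 / 8 * ∑ i ∈ s, w i * (a i - ∑ j ∈ s, w j * a j) ^ 2 ≤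
      Real.log (∑ i ∈ s, w i * Real.exp (a i)) := by
  have hexp := one_add_variance_le_sum_mul_exp_sub_mean s (a := a) hw hs
    fun i hi => by linarith [(abs_le.mp (ha i hi)).1]
  set m := ∑ j ∈ s, w j * a j
  set V := ∑ i ∈ s, w i * (a i - m) ^ 2
  have hV0 : 0 ≤ V := Finset.sum_nonneg fun i hi => mul_nonneg (hw i hi) (sq_nonneg _)
  have hV1 : V ≤ 1 := hs ▸ Finset.sum_le_sum fun i hi =>
    mul_le_of_le_one_right (hw i hi) ((sq_le_one_iff_abs_le_one _).mpr (ha i hi))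
  have hpos : 0 < 1 + V / 4 := by positivity
  have hlog : V / 8 ≤ Real.log (1 + V / 4) := by
    calc V / 8 ≤ V / 4 / (1 + V / 4) := by rw [le_div_iff₀ hpos]; nlinarith
      _ = 1 - (1 + V / 4)⁻¹ := by field_simp; ring
      _ ≤ _ := Real.one_sub_inv_le_log_of_pos hpos
  rw [sum_mul_exp_eq_exp_mul_sum s m, Real.log_mul (Real.exp_pos m).ne' (by linarith),
    Real.log_exp]
  linarith [Real.log_le_log hpos hexp]

theorem log_sum_mul_exp_mul_le (hw : ∀ i ∈ s, 0 ≤ w i) (hs : ∑ i ∈ s, w i = 1) {t : ℝ}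
    (h0 : 0 ≤ t) (h1 : t ≤ 1) :
    Real.log (∑ i ∈ s, w i * Real.exp (t * a i)) ≤
      t * Real.log (∑ i ∈ s, w i * Real.exp (a i)) := by
  have hpos (b : ι → ℝ) : 0 < ∑ i ∈ s, w i * Real.exp (b i) := sum_mul_exp_pos s hw hs
  set m := Real.log (∑ i ∈ s, w i * Real.exp (a i)) with hm
  have hone : ∑ i ∈ s, w i * Real.exp (a i - m) = 1 := by
    have hsplit := sum_mul_exp_eq_exp_mul_sum s (w := w) (a := a) m
    rw [hm, Real.exp_log (hpos a), ← hm] at hsplit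
    exact (mul_eq_left₀ (hpos a).ne').mp hsplit.symm
  rw [Real.log_le_iff_le_exp (hpos _), sum_mul_exp_eq_exp_mul_sum s (t * m)]
  refine mul_le_of_le_one_right (Real.exp_pos _).le ?_
  calc ∑ i ∈ s, w i * Real.exp (t * a i - t * m)
      ≤ ∑ i ∈ s, w i * ((1 - t) + t * Real.exp (a i - m)) := by
        refine Finset.sum_le_sum fun i hi => mul_le_mul_of_nonneg_left ?_ (hw i hi)
        simpa [mul_sub] using convexOn_exp.2 (Set.mem_univ 0) (Set.mem_univ (a i - m))
          (sub_nonneg.mpr h1) h0 (sub_add_cancel 1 t)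
    _ = 1 := by
        simp only [mul_add, Finset.sum_add_distrib, ← Finset.sum_mul, hs, mul_left_comm _ t,
          ← Finset.mul_sum, hone]
        ring

theorem abs_tilted_mean_sub_mean_le (hw : ∀ i ∈ s, 0 ≤ w i) (hs : ∑ i ∈ s, w i = 1) {A δ : ℝ}
    (hz : ∀ i ∈ s, |z i - ∑ j ∈ s, w j * z j| ≤ A)
    (ha : ∀ i ∈ s, |a i - ∑ j ∈ s, w j * a j| ≤ δ) (hδ : δ ≤ 1) :
    |(∑ i ∈ s, w i * z i * Real.exp (a i)) / (∑ i ∈ s, w i * Real.exp (a i)) -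
      ∑ i ∈ s, w i * z i| ≤ A * (2 * δ) := by
  have hS := one_le_sum_mul_exp_sub_mean s (a := a) hw hs
  have hzmean := sum_mul_sub_mean s (a := z) hs
  rw [sum_mul_exp_eq_exp_mul_sum s (∑ j ∈ s, w j * a j),
    sum_mul_exp_eq_exp_mul_sum s (w := w) (∑ j ∈ s, w j * a j),
    mul_div_mul_left _ _ (Real.exp_pos _).ne']
  set m := ∑ j ∈ s, w j * a j
  set ζ := ∑ j ∈ s, w j * z j
  set S := ∑ i ∈ s, w i * Real.exp (a i - m)
  have hSpos : 0 < S := zero_lt_one.trans_le hS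
  have hdiff : (∑ i ∈ s, w i * z i * Real.exp (a i - m)) / S - ζ =
      (∑ i ∈ s, w i * ((z i - ζ) * (Real.exp (a i - m) - 1))) / S := by
    rw [div_sub' hSpos.ne']
    congr 1
    rw [← sub_zero (∑ i ∈ s, _ - _), ← hzmean, mul_comm S, Finset.mul_sum,
      ← Finset.sum_sub_distrib, ← Finset.sum_sub_distrib]
    exact Finset.sum_congr rfl fun i _ => by ring
  rw [hdiff, abs_div, abs_of_pos hSpos]
  calc _ ≤ |∑ i ∈ s, w i * ((z i - ζ) * (Real.exp (a i - m) - 1))| :=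
        div_le_self (abs_nonneg _) hS
    _ ≤ ∑ i ∈ s, w i * (A * (2 * δ)) := by
        refine (Finset.abs_sum_le_sum_abs _ _).trans (Finset.sum_le_sum fun i hi => ?_)
        rw [abs_mul, abs_mul, abs_of_nonneg (hw i hi)]
        have hexp := Real.abs_exp_sub_one_le ((ha i hi).trans hδ)
        exact mul_le_mul_of_nonneg_left (mul_le_mul (hz i hi) (by linarith [ha i hi])
          (abs_nonneg _) ((abs_nonneg _).trans (hz i hi))) (hw i hi)
    _ = A * (2 * δ) := by rw [← Finset.sum_mul, hs, one_mul]

end LogSumExp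

/-! ### Expansion of the log-partial likelihood -/

section Expansion

variable {Ω : Type*} {p n : ℕ} {X : Triple Ω p} (ω : Fin n → Ω) (β u : Fin p → ℝ)

theorem weight_add (s : ℝ) (w : Ω) :
    X.weight s (β + u) w = X.weight s β w * Real.exp (u ⬝ᵥ X.covariate s w) := by
  simp only [Triple.weight, add_dotProduct, Real.exp_add, mul_assoc]

theorem sum_normWeight_time (m : Fin n) : ∑ i, normWeight X ω (X.time (ω m)) β i = 1 := by
  simp only [normWeight, ← Finset.sum_div]
  exact div_self (sum_weight_pos X ω β m).ne'

theorem sum_normWeight_mul_dotProduct (s : ℝ) :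
    ∑ i, normWeight X ω s β i * (u ⬝ᵥ X.covariate s (ω i)) = u ⬝ᵥ zbar X ω s β := by
  simp only [dotProduct, zbar, Finset.mul_sum]
  rw [Finset.sum_comm]
  exact Finset.sum_congr rfl fun k _ => Finset.sum_congr rfl fun i _ => by ring

theorem sum_normWeight_mul_exp (s : ℝ) :
    ∑ i, normWeight X ω s β i * Real.exp (u ⬝ᵥ X.covariate s (ω i)) =
      (∑ i, X.weight s (β + u) (ω i)) / ∑ i, X.weight s β (ω i) := by
  simp only [weight_add, normWeight, Finset.sum_div]
  exact Finset.sum_congr rfl fun i _ => by ring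

variable (X) in
/-- The increment from `β` to `β + u` of the logarithm of the risk-set sum at time `s`, written as
a log-sum-exp with the normalised weights at `β`. -/
def logIncr (s : ℝ) : ℝ :=
  Real.log (∑ i, normWeight X ω s β i * Real.exp (u ⬝ᵥ X.covariate s (ω i)))

theorem log_sum_weight_add (m : Fin n) :
    Real.log (∑ j, X.weight (X.time (ω m)) (β + u) (ω j)) =
      Real.log (∑ j, X.weight (X.time (ω m)) β (ω j)) + logIncr X ω β u (X.time (ω m)) := by
  rw [logIncr, sum_normWeight_mul_exp,
    Real.log_div (sum_weight_pos X ω _ m).ne' (sum_weight_pos X ω _ m).ne', add_sub_cancel]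

theorem logLik_add : logLik X ω (β + u) = logLik X ω β +
    (1 / (n : ℝ)) * ∑ i, X.event (ω i) * (u ⬝ᵥ X.covariate (X.time (ω i)) (ω i)) -
    (1 / (n : ℝ)) * ∑ i, X.event (ω i) * logIncr X ω β u (X.time (ω i)) := by
  simp only [logLik, Triple.integralN, log_sum_weight_add, add_dotProduct, mul_add,
    Finset.sum_add_distrib]
  ring

theorem score_dotProduct : score X ω β ⬝ᵥ u =
    (1 / (n : ℝ)) * ∑ i, X.event (ω i) * (u ⬝ᵥ X.covariate (X.time (ω i)) (ω i)) -
    (1 / (n : ℝ)) * ∑ i, X.event (ω i) * (u ⬝ᵥ zbar X ω (X.time (ω i)) β) := by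
  simp only [score, Triple.integralN, dotProduct, Finset.sum_mul, Finset.mul_sum]
  rw [Finset.sum_comm, ← Finset.sum_sub_distrib]
  refine Finset.sum_congr rfl fun i _ => ?_
  rw [← Finset.sum_sub_distrib]
  exact Finset.sum_congr rfl fun k _ => by ring

theorem dotProduct_neg_hessian_mulVec : u ⬝ᵥ (-hessian X ω β) *ᵥ u =
    (1 / (n : ℝ)) * ∑ m, X.event (ω m) * ∑ i, normWeight X ω (X.time (ω m)) β i *
      (u ⬝ᵥ X.covariate (X.time (ω m)) (ω i) - u ⬝ᵥ zbar X ω (X.time (ω m)) β) ^ 2 := by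
  have hsq (m i : Fin n) :
      (u ⬝ᵥ X.covariate (X.time (ω m)) (ω i) - u ⬝ᵥ zbar X ω (X.time (ω m)) β) ^ 2 =
      ∑ k, ∑ l, u k * (X.covariate (X.time (ω m)) (ω i) k - zbar X ω (X.time (ω m)) β k) *
        (u l * (X.covariate (X.time (ω m)) (ω i) l - zbar X ω (X.time (ω m)) β l)) := by
    rw [← dotProduct_sub, sq, dotProduct, Finset.sum_mul_sum]
    rfl
  have hcomm (F : Fin n → Fin n → Fin p → Fin p → ℝ) :
      ∑ m, ∑ i, ∑ k, ∑ l, F m i k l = ∑ k, ∑ l, ∑ m, ∑ i, F m i k l := by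
    simp_rw [Finset.sum_comm (s := (Finset.univ : Finset (Fin n)))
      (t := (Finset.univ : Finset (Fin p)))]
  simp only [hsq]
  simp only [dotProduct, mulVec, hessian, Matrix.neg_apply, Matrix.of_apply, neg_neg,
    Triple.integralN, Finset.mul_sum, Finset.sum_mul]
  rw [hcomm]
  exact Finset.sum_congr rfl fun k _ => Finset.sum_congr rfl fun l _ =>
    Finset.sum_congr rfl fun m _ => Finset.sum_congr rfl fun i _ => by ring

theorem dotProduct_neg_hessian_mulVec_nonneg : 0 ≤ u ⬝ᵥ (-hessian X ω β) *ᵥ u := by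
  rw [dotProduct_neg_hessian_mulVec]
  exact mul_nonneg (by positivity) (Finset.sum_nonneg fun m _ => mul_nonneg (event_nonneg X _)
    (Finset.sum_nonneg fun i _ => mul_nonneg (normWeight_nonneg X ω _ β i) (sq_nonneg _)))

theorem le_logLik_add_smul {t : ℝ} (h0 : 0 ≤ t) (h1 : t ≤ 1) :
    (1 - t) * logLik X ω β + t * logLik X ω (β + u) ≤ logLik X ω (β + t • u) := by
  have hincr (m : Fin n) :
      logIncr X ω β (t • u) (X.time (ω m)) ≤ t * logIncr X ω β u (X.time (ω m)) := by
    simpa only [logIncr, smul_dotProduct, smul_eq_mul] using log_sum_mul_exp_mul_le Finset.univ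
      (fun i _ => normWeight_nonneg X ω (X.time (ω m)) β i) (sum_normWeight_time ω β m) h0 h1
  have hsum : (1 / (n : ℝ)) * ∑ i, X.event (ω i) * logIncr X ω β (t • u) (X.time (ω i)) ≤
      t * ((1 / (n : ℝ)) * ∑ i, X.event (ω i) * logIncr X ω β u (X.time (ω i))) := by
    rw [mul_left_comm t, Finset.mul_sum _ _ t]
    refine mul_le_mul_of_nonneg_left (Finset.sum_le_sum fun i _ => ?_) (by positivity)
    rw [mul_left_comm]
    exact mul_le_mul_of_nonneg_left (hincr i) (event_nonneg X _)
  have hlin : ∑ i, X.event (ω i) * (t • u ⬝ᵥ X.covariate (X.time (ω i)) (ω i)) =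
      t * ∑ i, X.event (ω i) * (u ⬝ᵥ X.covariate (X.time (ω i)) (ω i)) := by
    simp only [Finset.mul_sum, smul_dotProduct, smul_eq_mul, mul_left_comm t]
  rw [logLik_add, logLik_add, hlin]
  linarith

variable {K : ℝ}

theorem abs_covariate_sub_zbar_le (hK : 0 ≤ K) (hX : ∀ t w k, |X.covariate t w k| ≤ K)
    (s : ℝ) (i : Fin n) (k : Fin p) : |X.covariate s (ω i) k - zbar X ω s β k| ≤ 2 * K :=
  (abs_sub _ _).trans (by linarith [hX s (ω i) k, abs_zbar_le hK hX β ω s k])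

theorem abs_dotProduct_covariate_sub_zbar_le (hK : 0 ≤ K)
    (hX : ∀ t w k, |X.covariate t w k| ≤ K) (s : ℝ) (i : Fin n) :
    |u ⬝ᵥ X.covariate s (ω i) - u ⬝ᵥ zbar X ω s β| ≤ 2 * K * l1 u := by
  rw [← dotProduct_sub, mul_comm]
  exact abs_dotProduct_le u (abs_covariate_sub_zbar_le ω β hK hX s i)

theorem logLik_add_le (hK : 0 ≤ K) (hX : ∀ t w k, |X.covariate t w k| ≤ K)
    (hu : 2 * K * l1 u ≤ 1) :
    logLik X ω (β + u) ≤ logLik X ω β + score X ω β ⬝ᵥ u -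
      1 / 8 * (u ⬝ᵥ (-hessian X ω β) *ᵥ u) := by
  have hincr (m : Fin n) : u ⬝ᵥ zbar X ω (X.time (ω m)) β +
      1 / 8 * ∑ i, normWeight X ω (X.time (ω m)) β i *
        (u ⬝ᵥ X.covariate (X.time (ω m)) (ω i) - u ⬝ᵥ zbar X ω (X.time (ω m)) β) ^ 2 ≤
      logIncr X ω β u (X.time (ω m)) := by
    rw [← sum_normWeight_mul_dotProduct]
    refine mean_add_variance_le_log_sum_mul_exp Finset.univ
      (fun i _ => normWeight_nonneg X ω _ β i) (sum_normWeight_time ω β m) fun i _ => ?_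
    rw [sum_normWeight_mul_dotProduct]
    exact (abs_dotProduct_covariate_sub_zbar_le ω β u hK hX _ i).trans hu
  have hsum := mul_le_mul_of_nonneg_left
    (Finset.sum_le_sum fun (m : Fin n) (_ : m ∈ Finset.univ) =>
      mul_le_mul_of_nonneg_left (hincr m) (event_nonneg X (ω m)))
    (by positivity : 0 ≤ 1 / (n : ℝ))
  simp only [mul_add, mul_left_comm _ (1 / 8 : ℝ), Finset.sum_add_distrib, ← Finset.mul_sum]
    at hsum
  rw [logLik_add, score_dotProduct, dotProduct_neg_hessian_mulVec]
  linarith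

theorem zbar_add_eq_div (m : Fin n) (k : Fin p) : zbar X ω (X.time (ω m)) (β + u) k =
    (∑ i, normWeight X ω (X.time (ω m)) β i * X.covariate (X.time (ω m)) (ω i) k *
      Real.exp (u ⬝ᵥ X.covariate (X.time (ω m)) (ω i))) /
    ∑ i, normWeight X ω (X.time (ω m)) β i *
      Real.exp (u ⬝ᵥ X.covariate (X.time (ω m)) (ω i)) := by
  have hpos := sum_weight_pos X ω β m
  have hpos' := sum_weight_pos X ω (β + u) m
  rw [sum_normWeight_mul_exp, zbar, Finset.sum_div]
  refine Finset.sum_congr rfl fun i _ => ?_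
  rw [normWeight, normWeight, weight_add]
  field_simp

theorem abs_zbar_add_sub_le (hK : 0 ≤ K) (hX : ∀ t w k, |X.covariate t w k| ≤ K)
    (hu : 2 * K * l1 u ≤ 1) (m : Fin n) (k : Fin p) :
    |zbar X ω (X.time (ω m)) (β + u) k - zbar X ω (X.time (ω m)) β k| ≤ 8 * K ^ 2 * l1 u := by
  have hzbar (s : ℝ) : zbar X ω s β k = ∑ i, normWeight X ω s β i * X.covariate s (ω i) k :=
    Finset.sum_congr rfl fun i _ => mul_comm _ _
  rw [zbar_add_eq_div, hzbar]
  refine (abs_tilted_mean_sub_mean_le Finset.univ (fun i _ => normWeight_nonneg X ω _ β i)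
    (sum_normWeight_time ω β m) (A := 2 * K) (fun i _ => ?_) (fun i _ => ?_) hu).trans_eq (by ring)
  · rw [← hzbar]
    exact abs_covariate_sub_zbar_le ω β hK hX _ i k
  · rw [sum_normWeight_mul_dotProduct]
    exact abs_dotProduct_covariate_sub_zbar_le ω β u hK hX _ i

theorem abs_vhat_add_sub_le (hK : 0 ≤ K) (hX : ∀ t w k, |X.covariate t w k| ≤ K)
    (hu : 2 * K * l1 u ≤ 1) (k l : Fin p) :
    |vhat X ω (β + u) k l - vhat X ω β k l| ≤ 32 * K ^ 3 * l1 u := by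
  have hl := l1_nonneg u
  simp only [vhat, Matrix.of_apply, Triple.integralN]
  rw [← mul_sub, ← Finset.sum_sub_distrib, abs_mul, abs_of_nonneg (by positivity)]
  simp_rw [← mul_sub]
  calc 1 / (n : ℝ) * |∑ i, _| ≤ 1 / (n : ℝ) * ∑ _i : Fin n, 32 * K ^ 3 * l1 u := by
        gcongr
        refine (Finset.abs_sum_le_sum_abs _ _).trans (Finset.sum_le_sum fun i _ => ?_)
        refine (abs_event_mul_le X _ _).trans ((abs_mul_sub_mul_le
          (abs_covariate_sub_zbar_le ω β hK hX _ i k)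
          (abs_covariate_sub_zbar_le ω (β + u) hK hX _ i l)).trans ?_)
        have hzbar (j : Fin p) := abs_zbar_add_sub_le ω β u hK hX hu i j
        calc _ ≤ 2 * K * (8 * K ^ 2 * l1 u + 8 * K ^ 2 * l1 u) := by
              gcongr
              exacts [hzbar k, hzbar l]
          _ = 32 * K ^ 3 * l1 u := by ring
    _ = (n : ℝ)⁻¹ * n * (32 * K ^ 3 * l1 u) := by
        rw [Finset.sum_const, Finset.card_univ, Fintype.card_fin, nsmul_eq_mul]
        ring
    _ ≤ _ := mul_le_of_le_one_left (by positivity) inv_mul_le_one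

end Expansion

/-! ### The Lasso -/

section Lasso

theorem l1_eq_sum_support_add {p : ℕ} (β v : Fin p → ℝ) :
    l1 v = ∑ j with β j ≠ 0, |v j| + ∑ j with β j = 0, |v j| := by
  rw [l1, ← Finset.sum_filter_add_sum_filter_not Finset.univ (fun j => β j ≠ 0)]
  simp only [not_not]

theorem l1_add_sub_le_l1_add {p : ℕ} (β u : Fin p → ℝ) :
    l1 β + ∑ j with β j = 0, |u j| - ∑ j with β j ≠ 0, |u j| ≤ l1 (β + u) := by
  have hoff : ∑ j with β j = 0, |β j| = 0 :=
    Finset.sum_eq_zero fun j hj => by simp [(Finset.mem_filter.mp hj).2]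
  have hoff_add : ∑ j with β j = 0, |(β + u) j| = ∑ j with β j = 0, |u j| :=
    Finset.sum_congr rfl fun j hj => by simp [(Finset.mem_filter.mp hj).2]
  have hon : ∑ j with β j ≠ 0, |β j| ≤
      ∑ j with β j ≠ 0, |(β + u) j| + ∑ j with β j ≠ 0, |u j| := by
    rw [← Finset.sum_add_distrib]
    refine Finset.sum_le_sum fun j _ => ?_
    simpa using abs_sub ((β + u) j) (u j)
  rw [l1_eq_sum_support_add β β, l1_eq_sum_support_add β (β + u), hoff, hoff_add]
  linarith

variable {Ω : Type*} {p n : ℕ} {X : Triple Ω p} {ω : Fin n → Ω} {β : Fin p → ℝ} {K lam : ℝ}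

theorem sum_support_le_of_inv_kappa_le {M : NNReal} (hκ : (kappa X ω β)⁻¹ ≤ M) {u : Fin p → ℝ}
    (hcone : ∑ j with β j = 0, |u j| ≤ 2 * ∑ j with β j ≠ 0, |u j|) :
    ∑ j with β j ≠ 0, |u j| ≤ M * (√(sparsity β) * √(u ⬝ᵥ (-hessian X ω β) *ᵥ u)) := by
  rcases eq_or_ne u 0 with rfl | hu
  · simp
  have hnonneg : 0 ≤ ∑ j with β j ≠ 0, |u j| := Finset.sum_nonneg fun _ _ => abs_nonneg _
  rcases hnonneg.eq_or_lt with hzero | hpos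
  · rw [← hzero]
    positivity
  have hkappa : kappa X ω β ≤ ENNReal.ofReal (√(sparsity β) * √(u ⬝ᵥ (-hessian X ω β) *ᵥ u)) /
      ENNReal.ofReal (∑ j with β j ≠ 0, |u j|) :=
    iInf_le_of_le ⟨u, hu, hcone⟩ le_rfl
  have hratio := (ENNReal.inv_le_inv.mpr hkappa).trans hκ
  rwa [ENNReal.inv_div (Or.inl ENNReal.ofReal_ne_top) (Or.inl (by simpa using hpos)),
    ENNReal.div_le_iff_le_mul (Or.inr ENNReal.coe_ne_top) (Or.inl ENNReal.ofReal_ne_top),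
    ← ENNReal.ofReal_coe_nnreal, ← ENNReal.ofReal_mul M.coe_nonneg,
    ENNReal.ofReal_le_ofReal_iff (by positivity)] at hratio

theorem basic_inequality (hK : 0 ≤ K) (hX : ∀ t w k, |X.covariate t w k| ≤ K)
    (hlam : 0 ≤ lam) (hscore : ∀ k, |score X ω β k| ≤ lam / 3) {u : Fin p → ℝ}
    (hu : 2 * K * l1 u ≤ 1)
    (hle : -logLik X ω (β + u) + lam * l1 (β + u) ≤ -logLik X ω β + lam * l1 β) :
    lam * (2 / 3 * ∑ j with β j = 0, |u j|) + 1 / 8 * (u ⬝ᵥ (-hessian X ω β) *ᵥ u) ≤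
      lam * (4 / 3 * ∑ j with β j ≠ 0, |u j|) := by
  have hloglik := logLik_add_le ω β u hK hX hu
  have hpenalty := mul_le_mul_of_nonneg_left (l1_add_sub_le_l1_add β u) hlam
  have hlinear : score X ω β ⬝ᵥ u ≤ l1 u * (lam / 3) := by
    rw [dotProduct_comm]
    exact (le_abs_self _).trans (abs_dotProduct_le u hscore)
  rw [l1_eq_sum_support_add β u] at hlinear
  linarith

theorem l1_le_of_penalised_le (hK : 0 ≤ K) (hX : ∀ t w k, |X.covariate t w k| ≤ K)
    (hlam : 0 < lam) (hscore : ∀ k, |score X ω β k| ≤ lam / 3) {M : NNReal}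
    (hκ : (kappa X ω β)⁻¹ ≤ M) {u : Fin p → ℝ} (hu : 2 * K * l1 u ≤ 1)
    (hle : -logLik X ω (β + u) + lam * l1 (β + u) ≤ -logLik X ω β + lam * l1 β) :
    l1 u ≤ 32 * M ^ 2 * sparsity β * lam := by
  have hbasic := basic_inequality hK hX hlam.le hscore hu hle
  have hQ : 0 ≤ u ⬝ᵥ (-hessian X ω β) *ᵥ u := dotProduct_neg_hessian_mulVec_nonneg ω β u
  have hcompat := sum_support_le_of_inv_kappa_le hκ (u := u)
  rw [l1_eq_sum_support_add β u]
  set a := ∑ j with β j ≠ 0, |u j|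
  set b := ∑ j with β j = 0, |u j|
  set Q := u ⬝ᵥ (-hessian X ω β) *ᵥ u
  have ha : 0 ≤ a := Finset.sum_nonneg fun _ _ => abs_nonneg _
  have hb : 0 ≤ b := Finset.sum_nonneg fun _ _ => abs_nonneg _
  have hcone : b ≤ 2 * a := by
    have : lam * (2 / 3 * b) ≤ lam * (4 / 3 * a) := by linarith
    linarith [le_of_mul_le_mul_left this hlam]
  have hQle : Q ≤ 32 / 3 * lam * a := by nlinarith
  have hsq : a * a ≤ 32 / 3 * M ^ 2 * sparsity β * lam * a := by
    calc a * a = a ^ 2 := (sq a).symm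
      _ ≤ (M * (√(sparsity β) * √Q)) ^ 2 := pow_le_pow_left₀ ha (hcompat hcone) 2
      _ = M ^ 2 * (sparsity β * Q) := by
          rw [mul_pow, mul_pow, Real.sq_sqrt (Nat.cast_nonneg _), Real.sq_sqrt hQ]
      _ ≤ M ^ 2 * (sparsity β * (32 / 3 * lam * a)) := by gcongr
      _ = _ := by ring
  have ha_le : a ≤ 32 / 3 * M ^ 2 * sparsity β * lam := by
    rcases ha.eq_or_lt with hzero | hpos
    · rw [← hzero]
      positivity
    · exact le_of_mul_le_mul_right hsq hpos
  linarith

theorem IsLasso.penalised_add_smul_le (hlam : 0 ≤ lam) {v : Fin p → ℝ}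
    (hv : IsLasso X ω lam (β + v)) {t : ℝ} (h0 : 0 ≤ t) (h1 : t ≤ 1) :
    -logLik X ω (β + t • v) + lam * l1 (β + t • v) ≤ -logLik X ω β + lam * l1 β := by
  have hconcave := le_logLik_add_smul (X := X) ω β v h0 h1
  have hconvex : l1 (β + t • v) ≤ (1 - t) * l1 β + t * l1 (β + v) := by
    have hseg : β + t • v = (1 - t) • β + t • (β + v) := by
      rw [sub_smul, smul_add, one_smul]
      abel
    rw [hseg]
    refine (l1_add_le _ _).trans ?_
    rw [l1_smul, l1_smul, abs_of_nonneg h0, abs_of_nonneg (sub_nonneg.mpr h1)]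
  have hpenalty := mul_le_mul_of_nonneg_left hconvex hlam
  have hmin := mul_le_mul_of_nonneg_left (hv β) h0
  nlinarith

-- The quadratic lower bound holds only for small increments, so it is applied to the estimator
-- shrunk towards `β` until its error is at most `1 / (2 * K)`.
theorem IsLasso.l1_le (hK : 0 < K) (hX : ∀ t w k, |X.covariate t w k| ≤ K)
    (hlam : 0 < lam) (hscore : ∀ k, |score X ω β k| ≤ lam / 3) {M : NNReal}
    (hκ : (kappa X ω β)⁻¹ ≤ M) (hsmall : 2 * K * (32 * M ^ 2 * sparsity β * lam) < 1)
    {v : Fin p → ℝ} (hv : IsLasso X ω lam (β + v)) :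
    l1 v ≤ 32 * M ^ 2 * sparsity β * lam := by
  have hshrunk (t : ℝ) (h0 : 0 ≤ t) (h1 : t ≤ 1) (ht : 2 * K * (t * l1 v) ≤ 1) :
      t * l1 v ≤ 32 * M ^ 2 * sparsity β * lam := by
    have hnorm : l1 (t • v) = t * l1 v := by rw [l1_smul, abs_of_nonneg h0]
    rw [← hnorm] at ht ⊢
    exact l1_le_of_penalised_le hK.le hX hlam hscore hκ ht
      (hv.penalised_add_smul_le hlam.le h0 h1)
  rcases le_or_gt (2 * K * l1 v) 1 with hle | hgt
  · simpa using hshrunk 1 zero_le_one le_rfl (by simpa using hle)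
  · have hscale : 2 * K * ((2 * K * l1 v)⁻¹ * l1 v) = 1 := by
      rw [mul_left_comm, inv_mul_cancel₀ (zero_lt_one.trans hgt).ne']
    have hlarge := mul_le_mul_of_nonneg_left
      (hshrunk (2 * K * l1 v)⁻¹ (inv_nonneg.mpr (zero_le_one.trans hgt.le))
        (inv_le_one_of_one_le₀ hgt.le) hscale.le) (by positivity : 0 ≤ 2 * K)
    linarith

end Lasso

/-! ### The CLIME estimator -/

section Clime

variable {p : ℕ} {A S T V : Matrix (Fin p) (Fin p) ℝ} {lam η : ℝ}

theorem l1_single (j : Fin p) : l1 (Pi.single j (1 : ℝ)) = 1 := by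
  rw [l1, Finset.sum_eq_single j (fun i _ hi => by simp [Pi.single_eq_of_ne hi]) (by simp)]
  simp

theorem abs_le_l1 (v : Fin p → ℝ) (j : Fin p) : |v j| ≤ l1 v :=
  Finset.single_le_sum (f := fun j => |v j|) (fun _ _ => abs_nonneg _) (Finset.mem_univ j)

theorem l1_pos {v : Fin p → ℝ} (hv : v ≠ 0) : 0 < l1 v := by
  obtain ⟨j, hj⟩ := Function.ne_iff.mp hv
  exact (abs_pos.mpr hj).trans_le (abs_le_l1 v j)

theorem abs_mulVec_le (hA : ∀ i j, |A i j| ≤ η) (v : Fin p → ℝ) (i : Fin p) :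
    |(A *ᵥ v) i| ≤ η * l1 v := by
  rw [mulVec, dotProduct_comm, mul_comm]
  exact abs_dotProduct_le v (hA i)

theorem bddAbove_opOne (A : Matrix (Fin p) (Fin p) ℝ) :
    BddAbove (Set.range fun v : {v : Fin p → ℝ // v ≠ 0} => l1 (A *ᵥ v.1) / l1 v.1) := by
  refine ⟨∑ i, l1 (A i), ?_⟩
  rintro _ ⟨⟨v, hv⟩, rfl⟩
  rw [div_le_iff₀ (l1_pos hv), l1, Finset.sum_mul]
  exact Finset.sum_le_sum fun i _ => abs_dotProduct_le (A i) (abs_le_l1 v)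

theorem opOne_nonneg (A : Matrix (Fin p) (Fin p) ℝ) : 0 ≤ opOne A :=
  Real.iSup_nonneg fun _ => div_nonneg (l1_nonneg _) (l1_nonneg _)

theorem l1_col_le_opOne (A : Matrix (Fin p) (Fin p) ℝ) (j : Fin p) :
    l1 (fun i => A i j) ≤ opOne A := by
  have hne : (Pi.single j 1 : Fin p → ℝ) ≠ 0 := by simp
  calc l1 (fun i => A i j) = l1 (A *ᵥ Pi.single j 1) / l1 (Pi.single j 1) := by
        rw [l1_single, div_one, mulVec_single_one]
        rfl
    _ ≤ opOne A := le_ciSup (bddAbove_opOne A) ⟨Pi.single j 1, hne⟩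

theorem l1_row_le_opOne (hA : A.IsSymm) (j : Fin p) : l1 (A j) ≤ opOne A := by
  simpa only [hA.apply] using l1_col_le_opOne A j

theorem card_support_le_maxColSupport (hA : A.IsSymm) (j : Fin p) :
    (Finset.univ.filter fun i => A j i ≠ 0).card ≤ maxColSupport A := by
  calc (Finset.univ.filter fun i => A j i ≠ 0).card = {i : Fin p | A i j ≠ 0}.ncard := by
        rw [← Set.ncard_coe_finset]
        simp only [Finset.coe_filter, Finset.mem_univ, true_and, hA.apply j]
    _ ≤ maxColSupport A :=
        Finset.le_sup (f := fun j => {i : Fin p | A i j ≠ 0}.ncard) (Finset.mem_univ j)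

theorem isSymm_inv (hS : S.IsSymm) : (S⁻¹).IsSymm := by
  rw [Matrix.IsSymm, transpose_nonsing_inv, hS]

theorem mulVec_inv_row (hdet : IsUnit S.det) (hS : S.IsSymm) (j : Fin p) :
    S *ᵥ S⁻¹ j = Pi.single j 1 := by
  have hrow : S⁻¹ j = S⁻¹ *ᵥ Pi.single j 1 := by
    funext i
    simpa using (isSymm_inv hS).apply i j
  rw [hrow, mulVec_mulVec, mul_nonsing_inv _ hdet, one_mulVec]

theorem abs_le_opOne_inv_mul (hdet : IsUnit S.det) (hS : S.IsSymm) {x : Fin p → ℝ}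
    (hx : ∀ i, |(S *ᵥ x) i| ≤ η) (i : Fin p) : |x i| ≤ opOne S⁻¹ * η := by
  have hη : 0 ≤ η := (abs_nonneg _).trans (hx i)
  calc |x i| = |(S⁻¹ *ᵥ (S *ᵥ x)) i| := by
        rw [mulVec_mulVec, nonsing_inv_mul _ hdet, one_mulVec]
    _ ≤ l1 (S⁻¹ i) * η := abs_dotProduct_le (S⁻¹ i) hx
    _ ≤ opOne S⁻¹ * η := mul_le_mul_of_nonneg_right (l1_row_le_opOne (isSymm_inv hS) i) hη

theorem l1_sub_le_of_l1_le {x y : Fin p → ℝ} (hxy : l1 x ≤ l1 y) (hη : ∀ i, |x i - y i| ≤ η) :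
    l1 (x - y) ≤ 2 * (Finset.univ.filter fun i => y i ≠ 0).card * η := by
  have hcone := l1_add_sub_le_l1_add y (x - y)
  rw [add_sub_cancel] at hcone
  have hsupport : ∑ j with y j ≠ 0, |(x - y) j| ≤
      (Finset.univ.filter fun i => y i ≠ 0).card * η := by
    rw [← nsmul_eq_mul]
    exact Finset.sum_le_card_nsmul _ _ _ fun i _ => hη i
  rw [l1_eq_sum_support_add y]
  linarith

theorem mem_climeFeasible_iff (hlam : 0 ≤ lam) {j : Fin p} {b : Fin p → ℝ} :
    b ∈ climeFeasible V lam j ↔ ∀ i, |(V *ᵥ b - (Pi.single j 1 : Fin p → ℝ)) i| ≤ lam :=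
  pi_norm_le_iff_of_nonneg hlam

theorem IsClime.l1_row_sub_le (hdet : IsUnit S.det) (hS : S.IsSymm)
    (hη : ∀ i j, |V i j - S i j| ≤ η) (hη0 : 0 ≤ η) (hlam : η * opOne S⁻¹ ≤ lam)
    (hT : IsClime V lam T) (j : Fin p) :
    l1 (T j - S⁻¹ j) ≤ 4 * maxColSupport S⁻¹ * opOne S⁻¹ * lam := by
  have hop := opOne_nonneg S⁻¹
  have hlam0 : 0 ≤ lam := le_trans (by positivity) hlam
  have hrow := l1_row_le_opOne (isSymm_inv hS) j
  have hperturb {b : Fin p → ℝ} (hb : l1 b ≤ opOne S⁻¹) (i : Fin p) :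
      |(V *ᵥ b - S *ᵥ b) i| ≤ lam := by
    rw [← sub_mulVec]
    exact (abs_mulVec_le (A := V - S) hη b i).trans
      ((mul_le_mul_of_nonneg_left hb hη0).trans hlam)
  have hfeasible : S⁻¹ j ∈ climeFeasible V lam j := by
    rw [mem_climeFeasible_iff hlam0, ← mulVec_inv_row hdet hS j]
    exact hperturb hrow
  obtain ⟨hTfeasible, hTmin⟩ := hT j ⟨_, hfeasible⟩
  have hTle : l1 (T j) ≤ l1 (S⁻¹ j) := hTmin _ hfeasible
  have hresidual (i : Fin p) : |(S *ᵥ (T j - S⁻¹ j)) i| ≤ 2 * lam := by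
    have hsplit : S *ᵥ (T j - S⁻¹ j) = (V *ᵥ T j - Pi.single j 1) - (V *ᵥ T j - S *ᵥ T j) := by
      rw [mulVec_sub, mulVec_inv_row hdet hS, sub_sub_sub_cancel_left]
    rw [hsplit, two_mul]
    exact (abs_sub _ _).trans (add_le_add ((mem_climeFeasible_iff hlam0).mp hTfeasible i)
      (hperturb (hTle.trans hrow) i))
  have hcard : ((Finset.univ.filter fun i => S⁻¹ j i ≠ 0).card : ℝ) ≤ maxColSupport S⁻¹ :=
    mod_cast card_support_le_maxColSupport (isSymm_inv hS) j
  calc l1 (T j - S⁻¹ j)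
      ≤ 2 * (Finset.univ.filter fun i => S⁻¹ j i ≠ 0).card * (opOne S⁻¹ * (2 * lam)) :=
        l1_sub_le_of_l1_le hTle (abs_le_opOne_inv_mul hdet hS hresidual)
    _ ≤ 2 * maxColSupport S⁻¹ * (opOne S⁻¹ * (2 * lam)) := by gcongr
    _ = 4 * maxColSupport S⁻¹ * opOne S⁻¹ * lam := by ring

theorem abs_dotProduct_mulVec_le (c : Fin p → ℝ) {x : Fin p → ℝ} {a b : ℝ}
    (hA : ∀ j, l1 (A j) ≤ a) (hx : ∀ j, |x j| ≤ b) (hb : 0 ≤ b) :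
    |c ⬝ᵥ A *ᵥ x| ≤ l1 c * (a * b) :=
  abs_dotProduct_le c fun j =>
    (abs_dotProduct_le (A j) hx).trans (mul_le_mul_of_nonneg_right (hA j) hb)

theorem isSymm_sigma {Ω : Type*} [MeasurableSpace Ω] (X : Triple Ω p) (P : Measure Ω)
    (β : Fin p → ℝ) : (X.sigma P β).IsSymm := by
  refine Matrix.IsSymm.ext fun i j => ?_
  simp only [Triple.sigma, Matrix.of_apply, mul_comm]

end Clime

/-! ### The error of the one-step correction -/

section Error

variable {Ω : Type*} {p n : ℕ}

theorem abs_dotProduct_clime_sub_le {X : Triple Ω p} {ω : Fin n → Ω} {β b : Fin p → ℝ}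
    {K lam lamC τ η : ℝ} {M : NNReal} {S T : Matrix (Fin p) (Fin p) ℝ} (hK : 0 < K)
    (hX : ∀ t w k, |X.covariate t w k| ≤ K) (hτ : 0 < τ) (hη : 0 ≤ η) (hlam : 3 * τ ≤ lam)
    (hdet : IsUnit S.det) (hS : S.IsSymm) (hscore : ∀ k, |score X ω β k| ≤ τ)
    (hV : ∀ k l, |vhat X ω β k l - S k l| ≤ η) (hκ : (kappa X ω β)⁻¹ ≤ M)
    (hsmall : 2 * K * (32 * M ^ 2 * sparsity β * lam) < 1)
    (hlamC : (32 * K ^ 3 * (32 * M ^ 2 * sparsity β * lam) + η) * opOne S⁻¹ ≤ lamC)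
    (hb : IsLasso X ω lam b) (hT : IsClime (vhat X ω b) lamC T) (c : Fin p → ℝ) :
    |c ⬝ᵥ (T - S⁻¹) *ᵥ score X ω β| ≤
      l1 c * (4 * maxColSupport S⁻¹ * opOne S⁻¹ * lamC * τ) := by
  have hlam0 : 0 < lam := by linarith
  rw [← add_sub_cancel β b] at hb
  have hlasso : l1 (b - β) ≤ 32 * M ^ 2 * sparsity β * lam :=
    hb.l1_le hK hX hlam0 (fun k => (hscore k).trans (by linarith)) hκ hsmall
  have hsmall' : 2 * K * l1 (b - β) ≤ 1 :=
    (mul_le_mul_of_nonneg_left hlasso (by positivity)).trans hsmall.le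
  have hplugin (k l : Fin p) : |vhat X ω b k l - S k l| ≤
      32 * K ^ 3 * (32 * M ^ 2 * sparsity β * lam) + η := by
    have hmove := abs_vhat_add_sub_le ω β (b - β) hK.le hX hsmall' k l
    rw [add_sub_cancel] at hmove
    calc |vhat X ω b k l - S k l|
        ≤ |vhat X ω b k l - vhat X ω β k l| + |vhat X ω β k l - S k l| := abs_sub_le _ _ _
      _ ≤ 32 * K ^ 3 * l1 (b - β) + η := add_le_add hmove (hV k l)
      _ ≤ 32 * K ^ 3 * (32 * M ^ 2 * sparsity β * lam) + η := by gcongr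
  exact abs_dotProduct_mulVec_le c
    (hT.l1_row_sub_le hdet hS hplugin (by positivity) hlamC) hscore hτ.le

end Error

section Probability

variable {Ω : Type*} [MeasurableSpace Ω] {p n : ℕ}

theorem natCast_mul_exp_neg_mul_log_le {a k : ℕ} {x y : ℝ} (hx : 0 < x) (hy : 0 < y)
    (h : a * y ≤ x ^ k) :
    (a : ENNReal) * (2 * ENNReal.ofReal (Real.exp (-(k * Real.log x)))) ≤
      ENNReal.ofReal (2 / y) := by
  have hexp : Real.exp (-(k * Real.log x)) = (x ^ k)⁻¹ := by
    rw [Real.exp_neg, Real.exp_nat_mul, Real.exp_log hx]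
  rw [hexp, ← ENNReal.ofReal_natCast a, ← ENNReal.ofReal_ofNat 2,
    ← ENNReal.ofReal_mul zero_le_two, ← ENNReal.ofReal_mul (Nat.cast_nonneg a)]
  refine ENNReal.ofReal_le_ofReal ?_
  calc a * (2 * (x ^ k)⁻¹) = 2 * (a * y) / (x ^ k * y) := by field_simp
    _ ≤ 2 * x ^ k / (x ^ k * y) := by gcongr
    _ = 2 / y := by field_simp

theorem natCast_sum_mul_half_le_pow (hn : 0 < n) (hp : 0 < p) :
    ((n * p * n + p * p : ℕ) : ℝ) * (n / 2) ≤ (n * p) ^ 3 := by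
  have hfirst : n * p * n * n ≤ (n * p) ^ 3 :=
    calc n * p * n * n = n ^ 3 * p ^ 1 := by ring
      _ ≤ n ^ 3 * p ^ 3 := by gcongr; omega
      _ = (n * p) ^ 3 := by ring
  have hsecond : p * p * n ≤ (n * p) ^ 3 :=
    calc p * p * n = n ^ 1 * p ^ 2 := by ring
      _ ≤ n ^ 3 * p ^ 3 := by gcongr <;> omega
      _ = (n * p) ^ 3 := by ring
  have hfirst' : (n : ℝ) * p * n * n ≤ (n * p) ^ 3 := mod_cast hfirst
  have hsecond' : (p : ℝ) * p * n ≤ (n * p) ^ 3 := mod_cast hsecond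
  push_cast
  linarith

variable {X : Triple Ω p} {P : Measure Ω} [IsProbabilityMeasure P] {β : Fin p → ℝ} {K : ℝ}

theorem IsRegular.measure_pi_score_or_vhat_le {E : Type*} [MeasurableSpace E] {π : Ω → E}
    {Z : ℝ → E → Fin p → ℝ} {I : Set ℝ} {haz : ℝ → ℝ} (h : IsRegular X P β K π Z I haz)
    (hK : 0 < K) (hn : 0 < n) (hp : 0 < p) (hℓ : 1 ≤ Real.log (n * p)) :
    (Measure.pi fun _ : Fin n => P)
        ({ω | ∃ k, 5 * K * (√(Real.log (n * p)) / √n) < |score X ω β k|} ∪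
          {ω | ∃ k l, (72 * K ^ 2 * Real.exp (l1 β * K) ^ 2 + 28 * K ^ 2) *
            (√(Real.log (n * p)) / √n) < |vhat X ω β k l - X.sigma P β k l|}) ≤
      ENNReal.ofReal (6 / n) := by
  have hn1 : (1 : ℝ) ≤ n := mod_cast hn
  have hp1 : (1 : ℝ) ≤ p := mod_cast hp
  have hnp : (0 : ℝ) < n * p := by positivity
  have hsq : (p : ℝ) * n ≤ (n * p) ^ 2 := by
    rw [mul_comm (p : ℝ)]
    exact le_self_pow₀ (one_le_mul_of_one_le_of_one_le hn1 hp1) two_ne_zero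
  refine (measure_union_le _ _).trans ((add_le_add
    ((h.measure_pi_lt_abs_score_le hK hn (by linarith)).trans
      (natCast_mul_exp_neg_mul_log_le (k := 2) hnp (by linarith) hsq))
    ((h.measure_pi_lt_abs_vhat_sub_sigma_le hK hn hℓ).trans
      (natCast_mul_exp_neg_mul_log_le (k := 3) hnp (by linarith)
        (natCast_sum_mul_half_le_pow hn hp)))).trans (le_of_eq ?_))
  rw [← ENNReal.ofReal_add (by positivity) (by positivity)]
  congr 1
  field_simp
  norm_num

theorem measure_pi_lt_abs_dotProduct_clime_sub_le {haz : ℝ → ℝ} {lam lamC η a : ℝ} {M : NNReal}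
    (hK : 0 < K) (hX : X.IsCoxModel P β haz) (hdet : IsUnit (X.sigma P β).det)
    (hB : X.BoundedCovariates P K) (hL : X.LeftContinuousCovariates P)
    (hna : ∀ t, P {ω | X.time ω = t} = 0) (hn : 0 < n) (hp : 0 < p)
    (hℓ : 1 ≤ Real.log (n * p)) (hlam : 15 * K * (√(Real.log (n * p)) / √n) ≤ lam)
    (hη : (72 * K ^ 2 * Real.exp (l1 β * K) ^ 2 + 28 * K ^ 2) * (√(Real.log (n * p)) / √n) ≤ η)
    (hsmall : 2 * K * (32 * M ^ 2 * sparsity β * lam) < 1)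
    (hlamC : (32 * K ^ 3 * (32 * M ^ 2 * sparsity β * lam) + η) * opOne (X.sigma P β)⁻¹ ≤ lamC)
    {b : (Fin n → Ω) → Fin p → ℝ} (hb : ∀ ω, IsLasso X ω lam (b ω))
    {T : (Fin n → Ω) → Matrix (Fin p) (Fin p) ℝ}
    (hT : ∀ ω, IsClime (vhat X ω (b ω)) lamC (T ω)) {c : Fin p → ℝ}
    (ha : l1 c * (4 * maxColSupport (X.sigma P β)⁻¹ * opOne (X.sigma P β)⁻¹ * lamC *
      (5 * K * (√(Real.log (n * p)) / √n))) ≤ a) :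
    (Measure.pi fun _ : Fin n => P)
        {ω | a < |c ⬝ᵥ (T ω - (X.sigma P β)⁻¹) *ᵥ score X ω β|} ≤
      (Measure.pi fun _ : Fin n => P) {ω | (M : ENNReal) < (kappa X ω β)⁻¹} +
        ENNReal.ofReal (6 / n) := by
  obtain ⟨haz', hreg⟩ := exists_isRegular_regTriple hK.le hX hB hL hna
  have htime : ∀ᵐ ω ∂P, X.time ω ∈ X.timeSet P :=
    (ae_time_mem_ico X P hX.measurable_time hX.time_nonneg hna).mono
      fun _ h => ico_tPlus_subset_timeSet h
  have hbad := hreg.measure_pi_score_or_vhat_le hK hn hp hℓ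
  rw [sigma_regTriple hB hL htime β] at hbad
  set rate := √(Real.log (n * p)) / √n
  have hrate : 0 < rate := by positivity
  refine (measure_mono_ae ?_).trans ((measure_union_le _ _).trans (add_le_add le_rfl hbad))
  filter_upwards [ae_agree_regTriple (n := n) hB hL htime] with ω hagree (herror : a < _)
  by_contra hgood
  have hκ : (kappa (regTriple X P K) ω β)⁻¹ ≤ M :=
    hagree.kappa_eq β ▸ le_of_not_gt fun h => hgood (Or.inl h)
  have hscore (k : Fin p) := le_of_not_gt fun h => hgood (Or.inr (Or.inl ⟨k, h⟩))
  have hvhat (k l : Fin p) := le_of_not_gt fun h => hgood (Or.inr (Or.inr ⟨k, l, h⟩))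
  have hclime : IsClime (vhat (regTriple X P K) ω (b ω)) lamC (T ω) :=
    hagree.vhat_eq (b ω) ▸ hT ω
  have hbound := abs_dotProduct_clime_sub_le hK hreg.abs_covariate_le
    (mul_pos (by positivity) hrate) (le_trans (by positivity) hη) (by linarith) hdet
    (isSymm_sigma X P β) hscore (fun k l => (hvhat k l).trans hη) hκ hsmall hlamC
    (hagree.isLasso (hb ω)) hclime c
  rw [hagree.score_eq] at hbound
  exact (hbound.trans ha).not_gt herror

end Probability

/-! ### Rates -/

section Rates

variable {l : Filter ℕ} {p : ℕ → ℕ} {ℓ d s R o r lam lamC : ℕ → ℝ} {δ : ℝ}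

theorem sparsity_eq_zero_iff {p : ℕ} {β : Fin p → ℝ} : sparsity β = 0 ↔ β = 0 := by
  rw [sparsity, Set.ncard_eq_zero, Set.eq_empty_iff_forall_notMem, funext_iff]
  simp

theorem pos_of_l1_ne_zero {p : ℕ} {v : Fin p → ℝ} (hv : l1 v ≠ 0) : 0 < p := by
  by_contra! hp
  obtain rfl : p = 0 := Nat.le_zero.mp hp
  exact hv Finset.sum_empty

theorem eventually_ofReal_div_natCast_le (a : ℝ) {ε : ENNReal} (hε : 0 < ε) :
    ∀ᶠ n : ℕ in atTop, ENNReal.ofReal (a / n) ≤ ε := by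
  have hzero := ENNReal.tendsto_ofReal (tendsto_const_div_atTop_nhds_zero_nat a)
  rw [ENNReal.ofReal_zero] at hzero
  exact ENNReal.tendsto_nhds_zero.mp hzero ε hε

theorem eventually_le_mul_of_isLittleO {f g : ℕ → ℝ} (h : f =o[l] g) (hg : ∀ n, 0 ≤ g n) {c : ℝ}
    (hc : 0 < c) : ∀ᶠ n in l, f n ≤ c * g n := by
  filter_upwards [h.bound hc] with n hn
  rw [Real.norm_of_nonneg (hg n)] at hn
  exact (le_abs_self _).trans hn

theorem tendsto_log_mul_atTop (hp : ∀ n, 0 < p n) :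
    Tendsto (fun n : ℕ => Real.log (n * p n)) atTop atTop := by
  refine tendsto_atTop_mono' _ ?_ (Real.tendsto_log_atTop.comp tendsto_natCast_atTop_atTop)
  filter_upwards [eventually_gt_atTop 0] with n hn
  exact Real.log_le_log (by positivity) (le_mul_of_one_le_right (by positivity) (mod_cast hp n))

theorem isLittleO_natCast_rpow_rpow {a b : ℝ} (hab : a < b) :
    (fun n : ℕ => (n : ℝ) ^ a) =o[atTop] fun n => (n : ℝ) ^ b := by
  have hone : (fun _ : ℕ => (1 : ℝ)) =o[atTop] fun n => (n : ℝ) ^ (b - a) :=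
    isLittleO_const_left.mpr (Or.inr (tendsto_norm_atTop_atTop.comp
      ((tendsto_rpow_atTop (sub_pos.mpr hab)).comp tendsto_natCast_atTop_atTop)))
  refine ((isBigO_refl (fun n : ℕ => (n : ℝ) ^ a) atTop).mul_isLittleO hone).congr'
    (Eventually.of_forall fun _ => mul_one _) ?_
  filter_upwards [eventually_gt_atTop 0] with n hn
  rw [← Real.rpow_add (mod_cast hn), add_sub_cancel]

theorem isLittleO_log_mul (hl : l ≤ atTop) (hp : ∀ n, 0 < p n) {a b : ℝ} (hab : a < b) (hb : 0 < b)
    (h : (fun n => (p n : ℝ)) =o[l] fun n => Real.exp ((n : ℝ) ^ a)) :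
    (fun n : ℕ => Real.log (n * p n)) =o[l] fun n => (n : ℝ) ^ b := by
  have hlog_n : (fun n : ℕ => Real.log n) =o[l] fun n => (n : ℝ) ^ b :=
    ((isLittleO_log_rpow_atTop hb).comp_tendsto tendsto_natCast_atTop_atTop).mono hl
  have hpow : (fun n : ℕ => (n : ℝ) ^ a) =o[l] fun n => (n : ℝ) ^ b :=
    (isLittleO_natCast_rpow_rpow hab).mono hl
  have hlog_p : (fun n => Real.log (p n)) =O[l] fun n => (n : ℝ) ^ a := by
    refine IsBigO.of_bound 1 ?_
    filter_upwards [h.bound one_pos] with n hn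
    have hp1 : (1 : ℝ) ≤ p n := mod_cast hp n
    rw [one_mul, Real.norm_of_nonneg (by positivity), Real.norm_of_nonneg (Real.exp_nonneg _)] at hn
    rw [one_mul, Real.norm_of_nonneg (Real.log_nonneg hp1), Real.norm_of_nonneg (by positivity)]
    exact (Real.log_le_iff_le_exp (by positivity)).mpr hn
  refine (hlog_n.add (hlog_p.trans_isLittleO hpow)).congr' ?_ EventuallyEq.rfl
  filter_upwards [hl (eventually_gt_atTop 0)] with n hn
  have hp0 := hp n
  exact (Real.log_mul (by positivity) (by positivity)).symm

theorem tendsto_mul_sqrt_div_sqrt_zero (h : d =o[l] fun n => √n / √(ℓ n)) :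
    Tendsto (fun n => d n * (√(ℓ n) / √n)) l (𝓝 0) := by
  simpa only [div_div_eq_mul_div, mul_div_assoc] using h.tendsto_div_nhds_zero

theorem isLittleO_sqrt_div_sqrt (hl : l ≤ atTop)
    (h : ℓ =o[l] fun n => (n : ℝ) ^ ((1 : ℝ) / 3 + 2 * δ)) :
    (fun n => √(ℓ n) / √n) =o[l] fun n => (n : ℝ) ^ (-((1 : ℝ) / 3 - δ)) := by
  have hsqrt := (h.sqrt (Eventually.of_forall fun n => by positivity)).mul_isBigO
    (isBigO_refl (fun n : ℕ => (√n)⁻¹) l)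
  refine hsqrt.congr' EventuallyEq.rfl ?_
  filter_upwards [hl (eventually_gt_atTop 0)] with n hn
  have hn0 : (0 : ℝ) < n := mod_cast hn
  rw [Real.sqrt_eq_rpow, Real.sqrt_eq_rpow, ← Real.rpow_mul hn0.le, ← Real.rpow_neg hn0.le,
    ← Real.rpow_add hn0]
  ring_nf

theorem isLittleO_sqrt_self (h : Tendsto ℓ l atTop) : (fun n => √(ℓ n)) =o[l] ℓ := by
  have hone : (fun _ => (1 : ℝ)) =o[l] fun n => √(ℓ n) :=
    isLittleO_const_left.mpr (Or.inr (tendsto_norm_atTop_atTop.comp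
      (Real.tendsto_sqrt_atTop.comp h)))
  refine ((isBigO_refl (fun n => √(ℓ n)) l).mul_isLittleO hone).congr'
    (Eventually.of_forall fun _ => mul_one _) ?_
  filter_upwards [h.eventually_ge_atTop 0] with n hn using Real.mul_self_sqrt hn

theorem isLittleO_one_add_mul_sqrt_div_sqrt (h : Tendsto ℓ l atTop) (hd : ∀ᶠ n in l, 1 ≤ d n) :
    (fun n => (1 + d n) * (√(ℓ n) / √n)) =o[l] fun n => d n * ℓ n / √n := by
  have hadd : (fun n => 1 + d n) =O[l] d := by
    refine IsBigO.of_bound 2 ?_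
    filter_upwards [hd] with n hn
    rw [Real.norm_of_nonneg (by linarith), Real.norm_of_nonneg (by linarith)]
    linarith
  refine (hadd.mul_isLittleO ((isLittleO_sqrt_self h).mul_isBigO
    (isBigO_refl (fun n : ℕ => (√n)⁻¹) l))).congr_right fun n => ?_
  rw [← mul_assoc, div_eq_mul_inv]

theorem isLittleO_one_add_mul_rate {d : ℕ → ℕ} (h : Tendsto ℓ atTop atTop)
    (hzero : ℓ =o[atTop ⊓ 𝓟 {n | d n = 0}] fun n => (n : ℝ) ^ ((1 : ℝ) / 3 + 2 * δ)) :
    (fun n => (1 + (d n : ℝ)) * (√(ℓ n) / √n)) =o[atTop]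
      fun n => max (d n * ℓ n / √n) ((n : ℝ) ^ (-((1 : ℝ) / 3 - δ))) := by
  have hsplit : (atTop : Filter ℕ) = atTop ⊓ 𝓟 {n | d n = 0} ⊔ atTop ⊓ 𝓟 {n | d n = 0}ᶜ := by
    rw [← inf_sup_left, sup_principal, Set.union_compl_self, principal_univ, inf_top_eq]
  rw [hsplit]
  refine IsLittleO.sup ?_ ?_
  · refine ((isLittleO_sqrt_div_sqrt inf_le_left hzero).congr' ?_ EventuallyEq.rfl).trans_isBigO
      (isBigO_of_le _ fun n => ?_)
    · filter_upwards [mem_inf_of_right (mem_principal_self _)] with n hn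
      rw [show d n = 0 from hn, Nat.cast_zero, add_zero, one_mul]
    · rw [Real.norm_of_nonneg (by positivity)]
      exact (le_max_right _ _).trans (le_abs_self _)
  · have hd : ∀ᶠ n in atTop ⊓ 𝓟 {n | d n = 0}ᶜ, (1 : ℝ) ≤ d n := by
      filter_upwards [mem_inf_of_right (mem_principal_self _)] with n hn
      exact mod_cast Nat.one_le_iff_ne_zero.mpr hn
    refine (isLittleO_one_add_mul_sqrt_div_sqrt (h.mono_left inf_le_left) hd).trans_isBigO
      (IsBigO.of_bound 1 ?_)
    filter_upwards [(h.mono_left inf_le_left).eventually_ge_atTop 0] with n hn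
    rw [one_mul, Real.norm_of_nonneg (by positivity)]
    exact (le_max_left _ _).trans (le_abs_self _)

theorem eventually_plugin_le (hd : ∀ n, 0 ≤ d n) (hlam : lam =O[l] s)
    (hrate : (fun n => (1 + d n) * s n) =o[l] R) (hlamC : (fun n => o n * R n) =O[l] lamC)
    (hlamC0 : ∀ n, 0 ≤ lamC n) (A H : ℝ) :
    ∀ᶠ n in l, (A * (d n * lam n) + H * s n) * o n ≤ lamC n := by
  have hdom (f : ℕ → ℝ) (hf : ∀ n, 0 ≤ f n ∧ f n ≤ 1 + d n) :
      (fun n => f n * s n) =O[l] fun n => (1 + d n) * s n := by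
    refine (isBigO_of_le l fun n => ?_).mul (isBigO_refl s l)
    rw [Real.norm_of_nonneg (hf n).1, Real.norm_of_nonneg (by linarith [hd n])]
    exact (hf n).2
  have hlasso : (fun n => d n * lam n) =O[l] fun n => (1 + d n) * s n :=
    ((isBigO_refl d l).mul hlam).trans (hdom d fun n => ⟨hd n, by linarith⟩)
  have hconc : s =O[l] fun n => (1 + d n) * s n := by
    simpa only [one_mul] using hdom (fun _ => 1) fun n => ⟨zero_le_one, by linarith [hd n]⟩
  have htotal : (fun n => (A * (d n * lam n) + H * s n) * o n) =o[l] lamC :=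
    ((((hlasso.const_mul_left A).add (hconc.const_mul_left H)).trans_isLittleO hrate).mul_isBigO
      (isBigO_refl o l)).trans_isBigO (by simpa only [mul_comm] using hlamC)
  simpa only [one_mul] using eventually_le_mul_of_isLittleO htotal hlamC0 one_pos

theorem isLittleO_clime_mul_score (hl : l ≤ atTop) (hℓ : Tendsto ℓ l atTop)
    (hlamC : lamC =O[l] fun n => o n * R n)
    (h : (fun n => o n ^ 2 * R n * r n) =o[l] fun n => 1 / √(ℓ n)) :
    (fun n => r n * o n * lamC n * (√(ℓ n) / √n)) =o[l] fun n => (n : ℝ) ^ (-(1 : ℝ) / 2) := by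
  have hclime : (fun n => r n * o n * lamC n) =o[l] fun n => 1 / √(ℓ n) := by
    refine IsBigO.trans_isLittleO ?_ h
    refine ((isBigO_refl (fun n => r n * o n) l).mul hlamC).congr_right fun n => ?_
    ring
  refine (hclime.mul_isBigO (isBigO_refl (fun n => √(ℓ n) / √n) l)).congr' EventuallyEq.rfl ?_
  filter_upwards [hℓ.eventually_gt_atTop 0, hl (eventually_gt_atTop 0)] with n hℓn hn
  rw [neg_div, Real.rpow_neg (Nat.cast_nonneg n), ← Real.sqrt_eq_rpow]
  field_simp

end Rates

end Cox

end

theorem proposition2_general (K : ℝ) (hK : 0 < K) :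
    ∃ A₀ : ℝ, 0 < A₀ ∧
    ∀ (B δ₀ : ℝ) (p : ℕ → ℕ) (Ω : ℕ → Type*) [∀ n, MeasurableSpace (Ω n)]
      (P : ∀ n, Measure (Ω n)) [∀ n, IsProbabilityMeasure (P n)]
      (X : ∀ n, Cox.Triple (Ω n) (p n)) (β : ∀ n, Fin (p n) → ℝ) (haz : ℕ → ℝ → ℝ)
      (_ : ∀ n, (X n).IsCoxModel (P n) (β n) (haz n))
      (_ : ∀ n, IsUnit ((X n).sigma (P n) (β n)).det)
      (_ : ∀ n, Cox.l1 (β n) ≤ B)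
      (_ : ∀ n, (X n).BoundedCovariates (P n) K)
      (_ : ∀ n, (X n).LeftContinuousCovariates (P n))
      (_ : ∀ n t, P n {ω | (X n).time ω = t} = 0)
      (_ : (fun n => (Cox.sparsity (β n) : ℝ)) =o[atTop]
        fun n => √(n : ℝ) / √(Real.log (n * p n)))
      (_ : (fun n : ℕ => Real.log (n * p n)) =o[atTop ⊓ 𝓟 {n | β n = 0}]
        fun n => (n : ℝ) ^ ((1 : ℝ) / 3 + 2 * δ₀))
      (_ : Cox.IsBigOpOne (fun n => Measure.pi fun _ : Fin n => P n)
        fun n ω => (Cox.kappa (X n) ω (β n))⁻¹)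
      (_ : (fun n => Cox.opOne ((X n).sigma (P n) (β n))⁻¹ ^ 2 *
          max (Cox.sparsity (β n) * Real.log (n * p n) / √(n : ℝ))
            ((n : ℝ) ^ (-((1 : ℝ) / 3 - δ₀))) *
          (Cox.maxColSupport ((X n).sigma (P n) (β n))⁻¹ : ℝ)) =o[atTop]
        fun n => 1 / √(Real.log (n * p n)))
      (lam : ℕ → ℝ) (_ : lam =O[atTop] fun n => √(Real.log (n * p n)) / √(n : ℝ))
      (_ : ∀ᶠ n in atTop, A₀ * (√(Real.log (n * p n)) / √(n : ℝ)) ≤ lam n)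
      (βhat : ∀ n, (Fin n → Ω n) → Fin (p n) → ℝ)
      (_ : ∀ n ω, Cox.IsLasso (X n) ω (lam n) (βhat n ω))
      (lamC : ℕ → ℝ) (_ : ∀ n, 0 < lamC n)
      (_ : lamC =Θ[atTop] fun n =>
        max (Cox.opOne ((X n).sigma (P n) (β n))⁻¹ *
            (Cox.sparsity (β n) * Real.log (n * p n) / √(n : ℝ)))
          (Cox.opOne ((X n).sigma (P n) (β n))⁻¹ * (n : ℝ) ^ (-((1 : ℝ) / 3 - δ₀))))
      (Θhat : ∀ n, (Fin n → Ω n) → Matrix (Fin (p n)) (Fin (p n)) ℝ)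
      (_ : ∀ n ω, Cox.IsClime (Cox.vhat (X n) ω (βhat n ω)) (lamC n) (Θhat n ω))
      (c : ∀ n, Fin (p n) → ℝ) (_ : ∀ n, Cox.l1 (c n) = 1),
      Cox.IsLittleOp (fun n => Measure.pi fun _ : Fin n => P n)
        (fun n ω => c n ⬝ᵥ
          (Θhat n ω - ((X n).sigma (P n) (β n))⁻¹) *ᵥ Cox.score (X n) ω (β n))
        (fun n => (n : ℝ) ^ (-(1 : ℝ) / 2)) := by
  refine ⟨15 * K, by positivity, ?_⟩
  intro B δ₀ p Ω _ P _ X β haz hX hdet hβ hB hL hna hsparse hgrowth hκ hprecision lam hlam hlam_ge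
    βhat hlasso lamC hlamC0 hlamC Θhat hclime c hc
  simp only [← mul_max_of_nonneg _ _ (Cox.opOne_nonneg _)] at hlamC
  have hp (n : ℕ) : 0 < p n := Cox.pos_of_l1_ne_zero (by rw [hc n]; exact one_ne_zero)
  have hlog := Cox.tendsto_log_mul_atTop hp
  simp only [← Cox.sparsity_eq_zero_iff] at hgrowth
  have hrate := Cox.isLittleO_one_add_mul_rate hlog hgrowth
  have herror := Cox.isLittleO_clime_mul_score le_rfl hlog hlamC.1 hprecision
  have hlasso_zero : Tendsto (fun n => Cox.sparsity (β n) * lam n) atTop (𝓝 0) :=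
    ((isBigO_refl _ _).mul hlam).trans_tendsto (Cox.tendsto_mul_sqrt_div_sqrt_zero hsparse)
  intro ε hε
  refine ENNReal.tendsto_nhds_zero.mpr fun ε' hε' => ?_
  obtain ⟨M, hM⟩ := hκ (ε' / 2) (ENNReal.half_pos hε'.ne')
  have hsmall := hlasso_zero.const_mul (2 * K * (32 * M ^ 2))
  rw [mul_zero] at hsmall
  filter_upwards [hM, hlog.eventually_ge_atTop 1, hlam_ge, eventually_gt_atTop 0,
    Cox.eventually_plugin_le (fun n => Nat.cast_nonneg _) hlam hrate hlamC.2
      (fun n => (hlamC0 n).le) (32 * K ^ 3 * (32 * M ^ 2))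
      (72 * K ^ 2 * Real.exp (B * K) ^ 2 + 28 * K ^ 2),
    hsmall.eventually_lt_const one_pos,
    Cox.eventually_le_mul_of_isLittleO (herror.const_mul_left (20 * K))
      (fun n => by positivity) hε,
    Cox.eventually_ofReal_div_natCast_le 6 (ENNReal.half_pos hε'.ne')]
    with n hκ_n hlog_n hlam_n hn hplugin_n hsmall_n herror_n htail_n
  refine (Cox.measure_pi_lt_abs_dotProduct_clime_sub_le
    (η := (72 * K ^ 2 * Real.exp (B * K) ^ 2 + 28 * K ^ 2) * (√(Real.log (n * p n)) / √n))
    hK (hX n) (hdet n) (hB n) (hL n) (hna n) hn (hp n) hlog_n hlam_n ?_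
    (lt_of_eq_of_lt (by ring) hsmall_n) (le_of_eq_of_le (by ring) hplugin_n)
    (hlasso n) (hclime n) (le_of_eq_of_le (by rw [hc n]; ring) herror_n)).trans
      ((add_le_add hκ_n htail_n).trans (ENNReal.add_halves ε').le)
  gcongr
  exact hβ n

theorem proposition2 (K : ℝ) (hK : 0 < K) :
    -- the threshold for the Lasso tuning parameter depends on the covariate bound only
    ∃ A₀ : ℝ, 0 < A₀ ∧
    ∀ (L C B δ₀ : ℝ) (_ : 0 < L) (_ : 0 < δ₀)
      -- for each `n`: dimension, law of the generic triple, true parameters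
      (p : ℕ → ℕ)
      (Ω : ℕ → Type*) [∀ n, MeasurableSpace (Ω n)]
      (P : ∀ n, Measure (Ω n)) [∀ n, IsProbabilityMeasure (P n)]
      (X : ∀ n, Cox.Triple (Ω n) (p n))
      (β : ∀ n, Fin (p n) → ℝ) (haz : ℕ → ℝ → ℝ)
      (_ : ∀ n, (X n).IsCoxModel (P n) (β n) (haz n))
      (_ : ∀ n, IsUnit ((X n).sigma (P n) (β n)).det)
      (_ : ∀ n, Cox.l1 (β n) ≤ B)
      -- bounded and Lipschitz covariates, bounded density of the observed time
      (_ : ∀ n, (X n).BoundedCovariates (P n) K)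
      (_ : ∀ n, (X n).LipschitzCovariates (P n) L)
      (_ : ∀ n, (X n).BoundedDensity (P n) C)
      -- sparsity of the regression vector
      (_ : (fun n => (Cox.sparsity (β n) : ℝ)) =o[atTop]
        fun n => √(n : ℝ) / √(Real.log (n * p n)))
      -- dimension growth, required only along those `n` for which `β n = 0`
      (_ : ∀ a : ℝ, 0 < a → (fun n => (p n : ℝ))
        =o[atTop ⊓ 𝓟 {n | β n = 0}] fun n => Real.exp ((n : ℝ) ^ a))
      -- compatibility factor bounded away from zero in probability
      (_ : Cox.IsBigOpOne (fun n => Measure.pi fun _ : Fin n => P n)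
        fun n ω => (Cox.kappa (X n) ω (β n))⁻¹)
      -- sparsity and size of the population precision matrix
      (_ : (fun n => Cox.opOne ((X n).sigma (P n) (β n))⁻¹ ^ 2 *
          max (Cox.sparsity (β n) * Real.log (n * p n) / √(n : ℝ))
            ((n : ℝ) ^ (-((1 : ℝ) / 3 - δ₀))) *
          (Cox.maxColSupport ((X n).sigma (P n) (β n))⁻¹ : ℝ)) =o[atTop]
        fun n => 1 / √(Real.log (n * p n)))
      -- the Lasso tuning parameter and estimator
      (lam : ℕ → ℝ) (_ : ∀ n, 0 < lam n)
      (_ : lam =Θ[atTop] fun n => √(Real.log (n * p n)) / √(n : ℝ))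
      (_ : ∀ᶠ n in atTop, A₀ * (√(Real.log (n * p n)) / √(n : ℝ)) ≤ lam n)
      (βhat : ∀ n, (Fin n → Ω n) → Fin (p n) → ℝ)
      (_ : ∀ n ω, Cox.IsLasso (X n) ω (lam n) (βhat n ω))
      -- the CLIME tuning parameter and estimator
      (lamC : ℕ → ℝ) (_ : ∀ n, 0 < lamC n)
      (_ : lamC =Θ[atTop] fun n =>
        max (Cox.opOne ((X n).sigma (P n) (β n))⁻¹ *
            (Cox.sparsity (β n) * Real.log (n * p n) / √(n : ℝ)))
          (Cox.opOne ((X n).sigma (P n) (β n))⁻¹ * (n : ℝ) ^ (-((1 : ℝ) / 3 - δ₀))))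
      (Θhat : ∀ n, (Fin n → Ω n) → Matrix (Fin (p n)) (Fin (p n)) ℝ)
      (_ : ∀ n ω, Cox.IsClime (Cox.vhat (X n) ω (βhat n ω)) (lamC n) (Θhat n ω))
      (c : ∀ n, Fin (p n) → ℝ) (_ : ∀ n, Cox.l1 (c n) = 1),
      Cox.IsLittleOp (fun n => Measure.pi fun _ : Fin n => P n)
        (fun n ω => c n ⬝ᵥ
          (Θhat n ω - ((X n).sigma (P n) (β n))⁻¹) *ᵥ Cox.score (X n) ω (β n))
        (fun n => (n : ℝ) ^ (-(1 : ℝ) / 2)) := by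
  obtain ⟨A₀, hA₀, hgeneral⟩ := proposition2_general K hK
  refine ⟨A₀, hA₀, ?_⟩
  intro L C B δ₀ _ hδ₀ p Ω _ P _ X β haz hX hdet hβ hB hL hD hsparse hgrowth hκ hprecision lam _
    hlam hlam_ge βhat hlasso lamC hlamC0 hlamC Θhat hclime c hc
  have hp (n : ℕ) : 0 < p n := Cox.pos_of_l1_ne_zero (by rw [hc n]; exact one_ne_zero)
  have hlog := Cox.isLittleO_log_mul (b := 1 / 3 + 2 * δ₀) inf_le_left hp (by linarith)
    (by positivity) (hgrowth (1 / 3) (by norm_num))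
  exact hgeneral B δ₀ p Ω P X β haz hX hdet hβ hB (fun n => (hL n).leftContinuousCovariates)
    (fun n => (hD n).measure_time_eq (hX n).measurable_time) hsparse hlog hκ hprecision lam
    hlam.1 hlam_ge βhat hlasso lamC hlamC0 hlamC Θhat hclime c hc
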